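/- **Model.** Let $(X_i,\varepsilon_i,U_i)$, $i\ge 1$, be i.i.d. copies of $(X,\varepsilon,U)$, where $U\sim N(0,\sigma_u^2)$, $\sigma_u^2>0$, is independent of $(X,\varepsilon)$, $X$ has Lebesgue density $f_X$ on $\mathbb R$, $E(\varepsilon|X)=0$, $0<\tau^2(X)=E(\varepsilon^2|X)<\infty$ and $\mu(X)=E(|\varepsilon|^3|X)<\infty$. Let $Y_i=g(X_i)+\varepsilon_i$ and $Z_i=X_i+U_i$. Write $\phi(\cdot\,;m,s)$ for the normal density with mean $m$ and variance $s$. **Estimator.** For $h>0$, $\lambda\ge 0$ let $$\tilde S_{jn}(x)=\frac1n\sum_{i=1}^n E\big[(Z_i+V-x)^j\phi(Z_i+V-x;0,h^2)\,\big|\,Z_i,Y_i\big],\qquad \tilde T_{ln}(x)=\frac1n\sum_{i=1}^n E\big[(Z_i+V-x)^lY_i\,\phi(Z_i+V-x;0,h^2)\,\big|\,Z_i,Y_i\big],$$ where $V\sim N(0,\lambda\sigma_u^2)$ is independent of the data ($V=0$ if $\lambda=0$), and $$\hat g_n(x;\lambda)=\frac{\tilde S_{2n}(x)\tilde T_{0n}(x)-\tilde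 S_{1n}(x)\tilde T_{1n}(x)}{\tilde S_{2n}(x)\tilde S_{0n}(x)-\tilde S_{1n}(x)^2}.$$ **Conditions.** C1: $f_X,g,\tau^2,\mu$ are twice continuously differentiable on $\mathbb R$, and for each $x$ in the support of $X$ the functions $t\mapsto\eta'(t+x)$ and $t\mapsto\eta''(t+x)$ belong to $L_2(\phi(t;0,\sigma_u^2)dt)$ for $\eta=f_X,g,g^2,\tau^2,\tau^4,\mu,\mu^2$. C2: the bandwidths $h=h_n>0$ satisfy $h\to0$ and $nh\to\infty$ as $n\to\infty$. **Notation.** For integers $j\ge0$ and $\lambda\ge0$ let $$f_{j,\lambda}(x)=\int t^jf_X(t)\phi(t;x,(1+\lambda)\sigma_u^2)dt,\qquad g_{j,\lambda}(x)=\int t^jg(t)f_X(t)\phi(t;x,(1+\lambda)\sigma_u^2)dt,$$ and let $G_{j,\lambda}$, $H_{j,\lambda}$ be defined like $g_{j,\lambda}$ with $g^2$, respectively $\tau^2$, in place of $g$. Let $$B(x;\lambda)=\frac{f_{0,\lambda}g_{0,\lambda}''-f_{0,\lambda}''g_{0,\lambda}}{2f_{0,\lambda}^2}(x)+\frac{\big(f_{1,\lambda}(x)-xf_{0,\lambda}(x)\big)\big(g_{0,\lambda}(x)f_{1,\lambda}(x)-f_{0,\lambda}(x)g_{1,\lambda}(x)\big)}{(\lambda+1)^2\sigma_u^4f_{0,\lambda}(x)^3},$$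 $$c_{0\lambda}(x)=-\frac{g_{0,\lambda}(x)}{f_{0,\lambda}(x)^2},\qquad d_{0\lambda}(x)=\frac1{f_{0,\lambda}(x)},\qquad \Delta_{0,0}(x)=\frac1{2\sqrt\pi}\Big[\frac{G_{0,0}(x)+H_{0,0}(x)}{f_{0,0}(x)^2}-\frac{g_{0,0}(x)^2}{f_{0,0}(x)^3}\Big],$$ and for $\lambda,\lambda'>0$, with $\kappa=\frac{\lambda\lambda'}{\lambda+\lambda'}$, $s=\sqrt{2\pi(\lambda+\lambda')\sigma_u^2}$, and all functions evaluated at $x$, $$\Delta_{\lambda,\lambda'}=c_{0\lambda}c_{0\lambda'}\Big[\frac{f_{0,\kappa}}{s}-f_{0,\lambda}f_{0,\lambda'}\Big]+c_{0\lambda}d_{0\lambda'}\Big[\frac{g_{0,\kappa}}{s}-f_{0,\lambda}g_{0,\lambda'}\Big]+c_{0\lambda'}d_{0\lambda}\Big[\frac{g_{0,\kappa}}{s}-f_{0,\lambda'}g_{0,\lambda}\Big]+d_{0\lambda}d_{0\lambda'}\Big[\frac{G_{0,\kappa}+H_{0,\kappa}}{s}-g_{0,\lambda}g_{0,\lambda'}\Big].$$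 **Theorem 3.** Assume the model and C1–C2. Let $0<\lambda_1<\dots<\lambda_K<\infty$, let $x$ be in the support of $X$, and suppose that the integrals $G_{0,\lambda}(x)$ and $H_{0,\lambda}(x)$ converge for some $\lambda>\lambda_K/2$. Put $\lambda_0=0$. Then there are nonrandom remainders $\rho_{n,k}=o(h^2)$, $k=0,\dots,K$, such that $$\begin{pmatrix}\sqrt{nh}\,\big[\hat g_n(x;0)-g_{0,0}(x)/f_{0,0}(x)-h^2B(x;0)+\rho_{n,0}\big]\\ \sqrt n\,\big[\hat g_n(x;\lambda_1)-g_{0,\lambda_1}(x)/f_{0,\lambda_1}(x)-h^2B(x;\lambda_1)+\rho_{n,1}\big]\\ \vdots\\ \sqrt n\,\big[\hat g_n(x;\lambda_K)-g_{0,\lambda_K}(x)/f_{0,\lambda_K}(x)-h^2B(x;\lambda_K)+\rho_{n,K}\big]\end{pmatrix}\Longrightarrow N(0,\Delta(x)),$$ where $\Delta(x)$ is the symmetric positive semidefinite $(K+1)\times(K+1)$ matrix, indexed by $0,\dots,K$, with entries $\Delta_{0,0}(x)$ at $(0,0)$, $0$ at $(0,j)$ and $(j,0)$ for $j\ge1$,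 and $\Delta_{\lambda_i,\lambda_j}(x)$ at $(i,j)$ for $i,j\ge1$. -/

import Mathlib

open MeasureTheory ProbabilityTheory Filter Topology Asymptotics
open scoped NNReal ENNReal

noncomputable section

namespace ExtrapolationEstimator

/-! ### The estimator -/

/-- The rescaled kernel `K_h(u) = h⁻¹ K(u / h)`, where `K` is the standard normal density. -/
def kernel (h u : ℝ) : ℝ := h⁻¹ * gaussianPDFReal 0 1 (u / h)

/-- The conditional kernel moment
`S̃_{jn}(x) = n⁻¹ ∑ᵢ E[(Zᵢ(λ) - x)^j K_h(Zᵢ(λ) - x) | Zᵢ, Yᵢ]`, where `Zᵢ(λ) = Zᵢ + v` and the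
pseudo-error `v` has law `N(0, λ σ_u²)`. For `λ = 0` this law is the Dirac mass at `0`. -/
def sTilde (σ2 lam : ℝ≥0) (h : ℝ) (n : ℕ) (Z : ℕ → ℝ) (j : ℕ) (x : ℝ) : ℝ :=
  (n : ℝ)⁻¹ * ∑ i ∈ Finset.range n,
    ∫ v, (Z i + v - x) ^ j * kernel h (Z i + v - x) ∂(gaussianReal 0 (lam * σ2))

/-- The conditional kernel moment weighted by the response,
`T̃_{ln}(x) = n⁻¹ ∑ᵢ E[(Zᵢ(λ) - x)^l Yᵢ K_h(Zᵢ(λ) - x) | Zᵢ, Yᵢ]`. -/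
def tTilde (σ2 lam : ℝ≥0) (h : ℝ) (n : ℕ) (Z Y : ℕ → ℝ) (l : ℕ) (x : ℝ) : ℝ :=
  (n : ℝ)⁻¹ * ∑ i ∈ Finset.range n,
    ∫ v, (Z i + v - x) ^ l * Y i * kernel h (Z i + v - x) ∂(gaussianReal 0 (lam * σ2))

/-- The estimator `ĝ_n(x; λ)`: the `β₀`-component of the solution of the normal equations
`S̃₀ β₀ + S̃₁ β₁ = T̃₀`, `S̃₁ β₀ + S̃₂ β₁ = T̃₁`. -/
def gHat (σ2 lam : ℝ≥0) (h : ℝ) (n : ℕ) (Z Y : ℕ → ℝ) (x : ℝ) : ℝ :=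
  (sTilde σ2 lam h n Z 2 x * tTilde σ2 lam h n Z Y 0 x
      - sTilde σ2 lam h n Z 1 x * tTilde σ2 lam h n Z Y 1 x) /
    (sTilde σ2 lam h n Z 2 x * sTilde σ2 lam h n Z 0 x - sTilde σ2 lam h n Z 1 x ^ 2)

/-! ### The functions in the limit -/

/-- `f_{j,λ}(x) = ∫ t^j f_X(t) φ(t; x, (1+λ)σ_u²) dt`. -/
def fMom (σ2 : ℝ≥0) (fX : ℝ → ℝ) (j : ℕ) (lam : ℝ≥0) (x : ℝ) : ℝ :=
  ∫ t, t ^ j * fX t * gaussianPDFReal x ((1 + lam) * σ2) t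

/-- `g_{j,λ}(x) = ∫ t^j g(t) f_X(t) φ(t; x, (1+λ)σ_u²) dt`. -/
def gMom (σ2 : ℝ≥0) (fX g : ℝ → ℝ) (j : ℕ) (lam : ℝ≥0) (x : ℝ) : ℝ :=
  ∫ t, t ^ j * g t * fX t * gaussianPDFReal x ((1 + lam) * σ2) t

/-- `G_{j,λ}(x) = ∫ t^j g²(t) f_X(t) φ(t; x, (1+λ)σ_u²) dt`. -/
def gSqMom (σ2 : ℝ≥0) (fX g : ℝ → ℝ) (j : ℕ) (lam : ℝ≥0) (x : ℝ) : ℝ :=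
  ∫ t, t ^ j * g t ^ 2 * fX t * gaussianPDFReal x ((1 + lam) * σ2) t

/-- `H_{j,λ}(x) = ∫ t^j τ²(t) f_X(t) φ(t; x, (1+λ)σ_u²) dt`; the argument `τ2` is the function
`τ²`. -/
def tauMom (σ2 : ℝ≥0) (fX τ2 : ℝ → ℝ) (j : ℕ) (lam : ℝ≥0) (x : ℝ) : ℝ :=
  ∫ t, t ^ j * τ2 t * fX t * gaussianPDFReal x ((1 + lam) * σ2) t

/-- The bias coefficient `B(x; λ)`; primes are derivatives with respect to `x`. -/
def bias (σ2 : ℝ≥0) (fX g : ℝ → ℝ) (lam : ℝ≥0) (x : ℝ) : ℝ :=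
  (fMom σ2 fX 0 lam x * iteratedDeriv 2 (gMom σ2 fX g 0 lam) x
      - iteratedDeriv 2 (fMom σ2 fX 0 lam) x * gMom σ2 fX g 0 lam x) /
    (2 * fMom σ2 fX 0 lam x ^ 2)
  + (fMom σ2 fX 1 lam x - x * fMom σ2 fX 0 lam x) *
      (gMom σ2 fX g 0 lam x * fMom σ2 fX 1 lam x - fMom σ2 fX 0 lam x * gMom σ2 fX g 1 lam x) /
    (((lam : ℝ) + 1) ^ 2 * (σ2 : ℝ) ^ 2 * fMom σ2 fX 0 lam x ^ 3)

/-- `c_{0λ}(x) = - g_{0,λ}(x) / f_{0,λ}(x)²`. -/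
def c0 (σ2 : ℝ≥0) (fX g : ℝ → ℝ) (lam : ℝ≥0) (x : ℝ) : ℝ :=
  -(gMom σ2 fX g 0 lam x / fMom σ2 fX 0 lam x ^ 2)

/-- `d_{0λ}(x) = 1 / f_{0,λ}(x)`. -/
def d0 (σ2 : ℝ≥0) (fX : ℝ → ℝ) (lam : ℝ≥0) (x : ℝ) : ℝ := 1 / fMom σ2 fX 0 lam x

/-- The asymptotic variance `Δ_{0,0}(x)` of the naive estimator. -/
def deltaZero (σ2 : ℝ≥0) (fX g τ2 : ℝ → ℝ) (x : ℝ) : ℝ :=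
  1 / (2 * √Real.pi) *
    ((gSqMom σ2 fX g 0 0 x + tauMom σ2 fX τ2 0 0 x) / fMom σ2 fX 0 0 x ^ 2
      - gMom σ2 fX g 0 0 x ^ 2 / fMom σ2 fX 0 0 x ^ 3)

/-- The asymptotic covariance `Δ_{λ,λ'}(x)` for `λ, λ' > 0`. Here the integrals against
`φ(t; x, (λλ'/(λ+λ') + 1)σ_u²)` are the functions `f_{0,κ}`, `g_{0,κ}`, `G_{0,κ}`, `H_{0,κ}` at
`κ = λλ'/(λ+λ')`. -/
def deltaPos (σ2 : ℝ≥0) (fX g τ2 : ℝ → ℝ) (lam lam' : ℝ≥0) (x : ℝ) : ℝ :=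
  let κ : ℝ≥0 := lam * lam' / (lam + lam')
  let s : ℝ := √(2 * Real.pi * ((lam : ℝ) + lam') * σ2)
  c0 σ2 fX g lam x * c0 σ2 fX g lam' x *
      (fMom σ2 fX 0 κ x / s - fMom σ2 fX 0 lam x * fMom σ2 fX 0 lam' x)
  + c0 σ2 fX g lam x * d0 σ2 fX lam' x *
      (gMom σ2 fX g 0 κ x / s - fMom σ2 fX 0 lam x * gMom σ2 fX g 0 lam' x)
  + c0 σ2 fX g lam' x * d0 σ2 fX lam x *
      (gMom σ2 fX g 0 κ x / s - fMom σ2 fX 0 lam' x * gMom σ2 fX g 0 lam x)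
  + d0 σ2 fX lam x * d0 σ2 fX lam' x *
      ((gSqMom σ2 fX g 0 κ x + tauMom σ2 fX τ2 0 κ x) / s
        - gMom σ2 fX g 0 lam x * gMom σ2 fX g 0 lam' x)

/-- The limit covariance matrix `Δ(x)`: index `0` belongs to `λ = 0`, index `i + 1` to the `i`-th
positive value of `λ`. -/
def deltaMatrix {K : ℕ} (σ2 : ℝ≥0) (fX g τ2 : ℝ → ℝ) (lam : Fin K → ℝ≥0) (x : ℝ) :
    Matrix (Fin (K + 1)) (Fin (K + 1)) ℝ :=
  Matrix.of fun a b =>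
    Fin.cases (Fin.cases (deltaZero σ2 fX g τ2 x) (fun _ => 0) b)
      (fun i => Fin.cases 0 (fun j => deltaPos σ2 fX g τ2 (lam i) (lam j) x) b) a

/-! ### The model and the regularity conditions -/

/-- The regression model with measurement error `Y = g(X) + ε`, `Z = X + U`: the triples
`(Xᵢ, εᵢ, Uᵢ)` are i.i.d., `X` has Lebesgue density `fX`, `U ~ N(0, σ_u²)` is independent of
`(X, ε)`, and, in terms of the conditional law of `ε` given `X`,
`E(ε | X) = 0`, `E(ε² | X) = τ²(X) ∈ (0, ∞)` and `E(|ε|³ | X) = m3(X) < ∞`.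
(The regression function `g` enters through `Y`.) -/
structure IsModel {Ω : Type*} [MeasurableSpace Ω] (P : Measure Ω) [IsProbabilityMeasure P]
    (X ε U : ℕ → Ω → ℝ) (σ2 : ℝ≥0) (fX τ2 m3 : ℝ → ℝ) : Prop where
  measurable_X : ∀ i, Measurable (X i)
  measurable_ε : ∀ i, Measurable (ε i)
  measurable_U : ∀ i, Measurable (U i)
  indep : iIndepFun (fun i ω => (X i ω, ε i ω, U i ω)) P
  identDistrib : ∀ i, IdentDistrib (fun ω => (X i ω, ε i ω, U i ω))
    (fun ω => (X 0 ω, ε 0 ω, U 0 ω)) P P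
  density_nonneg : ∀ t, 0 ≤ fX t
  law_X : P.map (X 0) = volume.withDensity (fun t => ENNReal.ofReal (fX t))
  law_U : P.map (U 0) = gaussianReal 0 σ2
  indep_U : IndepFun (fun ω => (X 0 ω, ε 0 ω)) (U 0) P
  integrable_cube : ∀ᵐ t ∂(P.map (X 0)),
    Integrable (fun e : ℝ => |e| ^ 3) (condDistrib (ε 0) (X 0) P t)
  cond_mean : ∀ᵐ t ∂(P.map (X 0)), ∫ e, e ∂(condDistrib (ε 0) (X 0) P t) = 0
  cond_var : ∀ᵐ t ∂(P.map (X 0)), ∫ e, e ^ 2 ∂(condDistrib (ε 0) (X 0) P t) = τ2 t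
  cond_var_pos : ∀ᵐ t ∂(P.map (X 0)), 0 < τ2 t
  cond_third : ∀ᵐ t ∂(P.map (X 0)), ∫ e, |e| ^ 3 ∂(condDistrib (ε 0) (X 0) P t) = m3 t

/-- The smoothness condition: `f_X`, `g`, `τ²` and `m3` are twice continuously differentiable, and
for each `x` in the support `S` of `X` the functions `t ↦ η'(t + x)` and `t ↦ η''(t + x)` are square
integrable against the `N(0, σ_u²)` density, for `η = f_X, g, g², τ², τ⁴, m3, m3²`. -/
structure IsRegular (S : Set ℝ) (σ2 : ℝ≥0) (fX g τ2 m3 : ℝ → ℝ) : Prop where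
  contDiff_fX : ContDiff ℝ 2 fX
  contDiff_g : ContDiff ℝ 2 g
  contDiff_τ2 : ContDiff ℝ 2 τ2
  contDiff_m3 : ContDiff ℝ 2 m3
  memLp_deriv : ∀ x ∈ S,
    ∀ η ∈ ({fX, g, fun t => g t ^ 2, τ2, fun t => τ2 t ^ 2, m3, fun t => m3 t ^ 2} : Set (ℝ → ℝ)),
      MemLp (fun t => deriv η (t + x)) 2 (gaussianReal 0 σ2) ∧
        MemLp (fun t => iteratedDeriv 2 η (t + x)) 2 (gaussianReal 0 σ2)

/-- The bandwidth condition: `h_n > 0`, `h_n → 0` and `n h_n → ∞`. -/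
structure IsBandwidth (h : ℕ → ℝ) : Prop where
  pos : ∀ n, 0 < h n
  tendsto_zero : Tendsto h atTop (𝓝 0)
  tendsto_atTop : Tendsto (fun n : ℕ => (n : ℝ) * h n) atTop atTop

/-- The list `(0, λ₁, …, λ_K)`. -/
def withZero {K : ℕ} (lam : Fin K → ℝ≥0) : Fin (K + 1) → ℝ≥0 := Fin.cons 0 lam

/-- The normalizing factors `(√(n h), √n, …, √n)`. -/
def rate (K : ℕ) (h : ℝ) (n : ℕ) : Fin (K + 1) → ℝ := Fin.cons (√(n * h)) (fun _ => √(n : ℝ))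

end ExtrapolationEstimator

end

/-! Everything is Gaussian except the law of (X, ε), so every smoothing step can be carried out
exactly. Averaging the kernel over the pseudo-error V replaces the variance h² by r = λσ_u² + h²;
after a common factor h² is cancelled, the estimator is (AN − pq)/(AM − p²), where M and N average
φ_r(Z − x) and Yφ_r(Z − x), and A, p, q are averages with explicit weights (`gHat_eq`). Taking
expectations over U adds σ_u² to the variance once more, so all means are moments of (X, Y) against
a normal density of variance ρ + h² with ρ = (1 + λ)σ_u². The case λ = 0 needs no separate
treatment.

Bias: the ratio of the means is a function of u = h² (`centering`), differentiable at u = 0, and its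
first-order Taylor remainder is the o(h²) term (`centering_isLittleO`). Its derivative is B(x; λ),
because differentiating a normal density in its variance is half of differentiating twice in its
centre (`iteratedDeriv_two_integral_gauss_sub`).

Fluctuation: since φ_r² is of the order of r^(-1/2) φ_{r/2}, the averages fluctuate at rate √n for λ
> 0 and √(nh) for λ = 0. Around the means A, p and q drop out to first order, and the error is
asymptotically the centred average of (dY + c)φ_r(Z − x), with d = 1/f and c = −g/f²
(`tendsto_ratio_linearization`).

Limit law: a vector Lindeberg theorem (`tendstoInDistribution_array`), with truncation function
min(y², |y|³), uses only second moments of Y. The product of two centred normal densities of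
variances r and r' is a constant times one of variance rr'/(r + r'), which is where κ comes from.
The factor √h kills the covariances between λ = 0 and λ > 0.

Integrability: if Y²φ_ρ'(X − x) is integrable for some ρ' above every λσ_u²/2 + σ_u², the second
moments are finite with room for domination; and since φ_{2ρ'}² is proportional to φ_ρ', the first
moments are finite up to variance 2ρ' > (1 + λ)σ_u². Such a ρ' comes from the hypothesis at λ_K, or
from the smoothness conditions when K = 0. -/

noncomputable section

namespace ExtrapolationEstimator

/-! ### The centred normal density -/

/-- The centred normal density with variance `ρ`. -/
def gauss (ρ a : ℝ) : ℝ := (√(2 * Real.pi * ρ))⁻¹ * Real.exp (-a ^ 2 / (2 * ρ))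

/-- A real variance parameter is what allows differentiation in the variance. -/
lemma gaussianPDFReal_eq_gauss (x : ℝ) (v : ℝ≥0) (t : ℝ) :
    gaussianPDFReal x v t = gauss v (t - x) := rfl

lemma gauss_nonneg (ρ a : ℝ) : 0 ≤ gauss ρ a := by unfold gauss; positivity

lemma gauss_pos {ρ : ℝ} (hρ : 0 < ρ) (a : ℝ) : 0 < gauss ρ a := by unfold gauss; positivity

lemma gauss_le (ρ a : ℝ) (hρ : 0 ≤ ρ) : gauss ρ a ≤ (√(2 * Real.pi * ρ))⁻¹ := by
  unfold gauss
  refine mul_le_of_le_one_right (by positivity) (Real.exp_le_one_iff.2 ?_)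
  rw [neg_div]
  exact neg_nonpos.2 (by positivity)

@[fun_prop]
lemma measurable_gauss (ρ : ℝ) : Measurable (gauss ρ) := by unfold gauss; fun_prop

lemma kernel_eq_gauss {h : ℝ} (hh : 0 < h) (u : ℝ) : kernel h u = gauss (h ^ 2) u := by
  unfold kernel gaussianPDFReal gauss
  have : √(2 * Real.pi * h ^ 2) = √(2 * Real.pi) * h := by
    rw [Real.sqrt_mul (by positivity), Real.sqrt_sq hh.le]
  rw [this, mul_inv, ← mul_assoc]
  congr 1
  · simp [mul_comm]
  · congr 1; simp; field_simp

lemma gauss_mul_gauss_eq {r : ℝ} (hr : 0 ≤ r) (s a b : ℝ) :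
    gauss r a * gauss s b = (√(2 * Real.pi * r * (2 * Real.pi * s)))⁻¹ *
      Real.exp (-a ^ 2 / (2 * r) + -b ^ 2 / (2 * s)) := by
  rw [Real.sqrt_mul (by positivity), Real.exp_add, gauss, gauss, mul_inv]
  ring

/-- Completing the square: the joint density is refactored as a marginal of variance r + s times the
conditional density of w = a + u, which has mean ar/(r + s) and variance rs/(r + s). -/
lemma gauss_mul_gauss {r s : ℝ} (hr : 0 < r) (hs : 0 < s) (a u : ℝ) :
    gauss s u * gauss r (a + u) =
      gauss (r + s) a * gauss (r * s / (r + s)) (a + u - a * r / (r + s)) := by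
  have hrs : 0 < r + s := by positivity
  rw [gauss_mul_gauss_eq hs.le, gauss_mul_gauss_eq hrs.le]
  congr 1
  · congr 2; field_simp
  · congr 1; field_simp; ring

/-- Precisions 1/r and 1/s add; this is the source of κ in the limit covariance. -/
lemma gauss_mul_gauss_self {r s : ℝ} (hr : 0 < r) (hs : 0 < s) (a : ℝ) :
    gauss r a * gauss s a = (√(2 * Real.pi * (r + s)))⁻¹ * gauss (r * s / (r + s)) a := by
  have hrs : 0 < r + s := by positivity
  rw [gauss_mul_gauss_eq hr.le, gauss, ← mul_assoc (√(2 * Real.pi * (r + s)))⁻¹, ← mul_inv,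
    ← Real.sqrt_mul (by positivity)]
  congr 1
  · congr 2; field_simp
  · congr 1; field_simp; ring

/-- Tilting a normal law by a normal density gives a normal law again, so the local moments of order
0, 1, 2 become elementary. -/
lemma integral_comp_add_mul_gauss (ψ : ℝ → ℝ) (a : ℝ) {r : ℝ} (hr : 0 < r) (s : ℝ≥0) :
    ∫ u, ψ (a + u) * gauss r (a + u) ∂(gaussianReal 0 s) =
      gauss (r + s) a *
        ∫ w, ψ w ∂(gaussianReal (a * r / (r + s)) (r * s / (r + s)).toNNReal) := by
  -- For s = 0 both laws are Dirac masses; this is the case λ = 0.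
  rcases eq_or_ne s 0 with rfl | hs
  · simp [hr.ne', mul_comm]
  have hs' : (0 : ℝ) < s := NNReal.coe_pos.2 (pos_iff_ne_zero.2 hs)
  have hv : 0 < r * s / (r + s) := by positivity
  rw [integral_gaussianReal_eq_integral_smul hs,
    integral_gaussianReal_eq_integral_smul (by simpa using hv), ← integral_const_mul,
    ← integral_add_left_eq_self (μ := volume) (fun w => gauss (r + s) a *
      (gaussianPDFReal (a * r / (r + s)) (r * s / (r + s)).toNNReal w • ψ w)) a]
  refine integral_congr_ae (ae_of_all _ fun u => ?_)
  simp only [smul_eq_mul, gaussianPDFReal_eq_gauss, Real.coe_toNNReal _ hv.le, sub_zero]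
  linear_combination ψ (a + u) * gauss_mul_gauss hr hs' a u

lemma integral_sq_gaussianReal (μ : ℝ) (v : ℝ≥0) :
    ∫ w, w ^ 2 ∂(gaussianReal μ v) = v + μ ^ 2 := by
  have h := variance_eq_sub (μ := gaussianReal μ v) (X := id) (memLp_id_gaussianReal 2)
  rw [variance_id_gaussianReal] at h
  simp only [id_eq, Pi.pow_apply, integral_id_gaussianReal] at h
  linarith

lemma integral_gauss_add (a : ℝ) {r : ℝ} (hr : 0 < r) (s : ℝ≥0) :
    ∫ u, gauss r (a + u) ∂(gaussianReal 0 s) = gauss (r + s) a := by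
  simpa using integral_comp_add_mul_gauss (fun _ => 1) a hr s

lemma integral_id_mul_gauss_add (a : ℝ) {r : ℝ} (hr : 0 < r) (s : ℝ≥0) :
    ∫ u, (a + u) * gauss r (a + u) ∂(gaussianReal 0 s) = r / (r + s) * (a * gauss (r + s) a) := by
  rw [integral_comp_add_mul_gauss (fun w => w) a hr s, integral_id_gaussianReal]
  ring

lemma integral_sq_mul_gauss_add (a : ℝ) {r : ℝ} (hr : 0 < r) (s : ℝ≥0) :
    ∫ u, (a + u) ^ 2 * gauss r (a + u) ∂(gaussianReal 0 s) =
      (r * s / (r + s) + (r / (r + s)) ^ 2 * a ^ 2) * gauss (r + s) a := by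
  rw [integral_comp_add_mul_gauss (fun w => w ^ 2) a hr s, integral_sq_gaussianReal,
    Real.coe_toNNReal _ (by positivity)]
  ring

/-! ### Closed form of the estimator -/

/-- The average of `ψ (Y i) (A i)` over the first `n` observations. -/
def avg (n : ℕ) (A Y : ℕ → ℝ) (ψ : ℝ → ℝ → ℝ) : ℝ :=
  (n : ℝ)⁻¹ * ∑ i ∈ Finset.range n, ψ (Y i) (A i)

/-- The weight of the second-order local moment, where `s = λσ_u²`. -/
def quadWeight (s h a : ℝ) : ℝ :=
  (s / (s + h ^ 2) + h ^ 2 * a ^ 2 / (s + h ^ 2) ^ 2) * gauss (s + h ^ 2) a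

/-- The weight of the first-order local moment, where `s = λσ_u²`. -/
def linWeight (s h a : ℝ) : ℝ := h / (s + h ^ 2) * a * gauss (s + h ^ 2) a

/-- Gaussian convolution evaluates each conditional moment. The order-one moments carry a factor h
and the order-two moment a factor h², so h² cancels from numerator and denominator; the weights that
remain have means of order one or smaller, also for λ = 0. -/
lemma gHat_eq (σ2 lam : ℝ≥0) {h : ℝ} (hh : 0 < h) (n : ℕ) (Z Y : ℕ → ℝ) (x : ℝ) :
    gHat σ2 lam h n Z Y x =
      (avg n (fun i => Z i - x) Y (fun _ a => quadWeight (lam * σ2) h a) *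
          avg n (fun i => Z i - x) Y (fun y a => y * gauss (lam * σ2 + h ^ 2) a) -
        avg n (fun i => Z i - x) Y (fun _ a => linWeight (lam * σ2) h a) *
          avg n (fun i => Z i - x) Y (fun y a => y * linWeight (lam * σ2) h a)) /
      (avg n (fun i => Z i - x) Y (fun _ a => quadWeight (lam * σ2) h a) *
          avg n (fun i => Z i - x) Y (fun _ a => gauss (lam * σ2 + h ^ 2) a) -
        avg n (fun i => Z i - x) Y (fun _ a => linWeight (lam * σ2) h a) ^ 2) := by
  have h2 : 0 < h ^ 2 := by positivity
  have hk : ∀ z v : ℝ, kernel h (z + v - x) = gauss (h ^ 2) ((z - x) + v) := fun z v => by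
    rw [kernel_eq_gauss hh]; congr 1; ring
  have hz : ∀ z v : ℝ, z + v - x = (z - x) + v := fun z v => by ring
  have hr : (lam : ℝ) * σ2 + h ^ 2 ≠ 0 := by positivity
  set V := gaussianReal 0 (lam * σ2)
  have i0 : ∀ z : ℝ, ∫ v, (z + v - x) ^ 0 * kernel h (z + v - x) ∂V
      = gauss (lam * σ2 + h ^ 2) (z - x) := fun z => by
    simp only [hk, pow_zero, one_mul]
    rw [integral_gauss_add _ h2]; push_cast; rw [add_comm]
  have i1 : ∀ z : ℝ, ∫ v, (z + v - x) ^ 1 * kernel h (z + v - x) ∂V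
      = h * linWeight (lam * σ2) h (z - x) := fun z => by
    simp only [hk, pow_one]
    simp only [hz]
    rw [integral_id_mul_gauss_add _ h2, linWeight]; push_cast; rw [add_comm (h ^ 2)]; field_simp
  have i2 : ∀ z : ℝ, ∫ v, (z + v - x) ^ 2 * kernel h (z + v - x) ∂V
      = h ^ 2 * quadWeight (lam * σ2) h (z - x) := fun z => by
    simp only [hk]
    simp only [hz]
    rw [integral_sq_mul_gauss_add _ h2, quadWeight]; push_cast; rw [add_comm (h ^ 2)]; field_simp
  have hT : ∀ (z y : ℝ) (j : ℕ), ∫ v, (z + v - x) ^ j * y * kernel h (z + v - x) ∂V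
      = y * ∫ v, (z + v - x) ^ j * kernel h (z + v - x) ∂V := fun z y j => by
    rw [← integral_const_mul]; congr 1; ext v; ring
  have S0 : sTilde σ2 lam h n Z 0 x =
      avg n (fun i => Z i - x) Y (fun _ a => gauss (lam * σ2 + h ^ 2) a) := by
    simp only [sTilde, avg, i0, V]
  have S1 : sTilde σ2 lam h n Z 1 x =
      h * avg n (fun i => Z i - x) Y (fun _ a => linWeight (lam * σ2) h a) := by
    simp only [sTilde, avg, i1, V, ← Finset.mul_sum]; ring
  have S2 : sTilde σ2 lam h n Z 2 x =
      h ^ 2 * avg n (fun i => Z i - x) Y (fun _ a => quadWeight (lam * σ2) h a) := by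
    simp only [sTilde, avg, i2, V, ← Finset.mul_sum]; ring
  have T0 : tTilde σ2 lam h n Z Y 0 x =
      avg n (fun i => Z i - x) Y (fun y a => y * gauss (lam * σ2 + h ^ 2) a) := by
    simp only [tTilde, avg, hT, i0, V]
  have T1 : tTilde σ2 lam h n Z Y 1 x =
      h * avg n (fun i => Z i - x) Y (fun y a => y * linWeight (lam * σ2) h a) := by
    simp only [tTilde, avg, hT, i1, V, mul_left_comm _ h, ← Finset.mul_sum]
  rw [gHat, S0, S1, S2, T0, T1, eq_comm, ← mul_div_mul_left _ _ h2.ne']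
  congr 1 <;> ring

/-! ### Comparison of normal densities -/

lemma exists_pow_mul_exp_neg_le (j : ℕ) {c : ℝ} (hc : 0 < c) :
    ∃ C, 0 < C ∧ ∀ a : ℝ, |a| ^ j * Real.exp (-(c * a ^ 2)) ≤ C := by
  -- The two terms come from |a|^j ≤ 1 + (a²)^j and y^j/j! ≤ e^y at y = ca².
  refine ⟨1 + j.factorial / c ^ j, by positivity, fun a => ?_⟩
  have h0 : 0 ≤ c * a ^ 2 := by positivity
  have h1 := Real.pow_div_factorial_le_exp _ h0 j
  have h2 : |a| ^ j ≤ 1 + (a ^ 2) ^ j := by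
    rw [← sq_abs, ← pow_mul, mul_comm, pow_mul]
    nlinarith [sq_nonneg (|a| ^ j - 1)]
  have h3 : (a ^ 2) ^ j ≤ j.factorial / c ^ j * Real.exp (c * a ^ 2) := by
    rw [mul_pow, div_le_iff₀ (by positivity)] at h1
    rw [div_mul_eq_mul_div, le_div_iff₀ (by positivity)]
    linarith
  rw [Real.exp_neg, ← div_eq_mul_inv, div_le_iff₀ (Real.exp_pos _)]
  have h4 : 1 ≤ Real.exp (c * a ^ 2) := Real.one_le_exp h0
  nlinarith

/-- A polynomial times a normal density is dominated by a normal density with larger variance,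
uniformly for variances in a compact set. -/
lemma exists_pow_mul_gauss_le (j : ℕ) {ρa ρb ρ' : ℝ} (ha : 0 < ρa) (hb : ρb < ρ')
    (hab : ρa ≤ ρb) :
    ∃ C, 0 < C ∧ ∀ ρ ∈ Set.Icc ρa ρb, ∀ a : ℝ, |a| ^ j * gauss ρ a ≤ C * gauss ρ' a := by
  have hb0 : 0 < ρb := ha.trans_le hab
  have hρ' : 0 < ρ' := hb0.trans hb
  -- Excess decay left after splitting off φ_ρ'; it absorbs the polynomial.
  have hc : 0 < 1 / (2 * ρb) - 1 / (2 * ρ') :=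
    sub_pos.2 (one_div_lt_one_div_of_lt (by positivity) (by linarith))
  obtain ⟨C, hC, h⟩ := exists_pow_mul_exp_neg_le j hc
  refine ⟨C * √(2 * Real.pi * ρ') / √(2 * Real.pi * ρa), by positivity, fun ρ hρ a => ?_⟩
  have hρ0 : 0 < ρ := ha.trans_le hρ.1
  have h1 : gauss ρ a ≤ (√(2 * Real.pi * ρa))⁻¹ * Real.exp (-a ^ 2 / (2 * ρb)) := by
    unfold gauss
    gcongr ?_⁻¹ * Real.exp ?_
    · exact Real.sqrt_le_sqrt (by have := hρ.1; gcongr)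
    · rw [neg_div, neg_div]
      have := hρ.2
      gcongr
  have h2 : Real.exp (-a ^ 2 / (2 * ρb)) =
      Real.exp (-((1 / (2 * ρb) - 1 / (2 * ρ')) * a ^ 2)) * Real.exp (-a ^ 2 / (2 * ρ')) := by
    rw [← Real.exp_add]; congr 1; ring
  calc |a| ^ j * gauss ρ a
      ≤ |a| ^ j * ((√(2 * Real.pi * ρa))⁻¹ * Real.exp (-a ^ 2 / (2 * ρb))) := by gcongr
    _ = (√(2 * Real.pi * ρa))⁻¹ *
        (|a| ^ j * Real.exp (-((1 / (2 * ρb) - 1 / (2 * ρ')) * a ^ 2))) *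
          Real.exp (-a ^ 2 / (2 * ρ')) := by rw [h2]; ring
    _ ≤ (√(2 * Real.pi * ρa))⁻¹ * C * Real.exp (-a ^ 2 / (2 * ρ')) := by
        have := h a
        gcongr
    _ = C * √(2 * Real.pi * ρ') / √(2 * Real.pi * ρa) * gauss ρ' a := by
        unfold gauss
        have : √(2 * Real.pi * ρ') ≠ 0 := by positivity
        field_simp

/-- The bound `exists_pow_mul_gauss_le`, uniformly over bounded shifts of the argument. -/
lemma exists_pow_mul_gauss_sub_le (j : ℕ) {ρ ρ' : ℝ} (hρ : 0 < ρ) (hb : ρ < ρ') {R : ℝ} :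
    ∃ C, 0 < C ∧ ∀ y : ℝ, |y| ≤ R → ∀ a : ℝ,
      |a - y| ^ j * gauss ρ (a - y) ≤ C * gauss ρ' a := by
  -- The passage from ρ to σ pays for the polynomial, that from σ to ρ' for the shift.
  obtain ⟨σ, hσ, hσ'⟩ := exists_between hb
  have hσ0 := hρ.trans hσ
  have hρ' := hσ0.trans hσ'
  obtain ⟨C, hC, h⟩ := exists_pow_mul_gauss_le j hρ hσ le_rfl
  set K : ℝ := Real.exp (R ^ 2 / (2 * (ρ' - σ)))
  refine ⟨C * (√(2 * Real.pi * ρ') / √(2 * Real.pi * σ) * K), by positivity, fun y hy a => ?_⟩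
  refine (h ρ (by simp) (a - y)).trans ?_
  rw [mul_assoc]
  gcongr
  have hd : 0 < ρ' - σ := by linarith
  -- The gap between y²/(2(ρ' − σ)) − a²/(2ρ') and −(a − y)²/(2σ) is a perfect square over a
  -- positive number.
  have h1 : -(a - y) ^ 2 / (2 * σ) ≤ R ^ 2 / (2 * (ρ' - σ)) + -a ^ 2 / (2 * ρ') := by
    have hy2 : y ^ 2 ≤ R ^ 2 := sq_le_sq' (by linarith [(abs_le.1 hy).1]) (abs_le.1 hy).2
    have h3 : y ^ 2 / (2 * (ρ' - σ)) ≤ R ^ 2 / (2 * (ρ' - σ)) := by gcongr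
    have h4 : y ^ 2 / (2 * (ρ' - σ)) + -a ^ 2 / (2 * ρ') - -(a - y) ^ 2 / (2 * σ) =
        (ρ' * (a - y) - σ * a) ^ 2 / (2 * σ * ρ' * (ρ' - σ))
          - (a - y) ^ 2 * 0 := by
      field_simp
      ring
    have h5 : 0 ≤ (ρ' * (a - y) - σ * a) ^ 2 / (2 * σ * ρ' * (ρ' - σ)) := by positivity
    linarith
  calc gauss σ (a - y)
      ≤ (√(2 * Real.pi * σ))⁻¹ *
        Real.exp (R ^ 2 / (2 * (ρ' - σ)) + -a ^ 2 / (2 * ρ')) := by unfold gauss; gcongr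
    _ = √(2 * Real.pi * ρ') / √(2 * Real.pi * σ) * K * gauss ρ' a := by
        rw [Real.exp_add]
        unfold gauss
        have : √(2 * Real.pi * ρ') ≠ 0 := by positivity
        field_simp
        simp only [K]

/-- Scale-invariant bound for the square of a polynomial times a normal density. -/
lemma exists_scaled_sq_gauss_le (j : ℕ) {θ : ℝ} (hθ : 1 / 2 < θ) :
    ∃ C, 0 < C ∧ ∀ r : ℝ, 0 < r → ∀ a : ℝ,
      ((|a| / √r) ^ j * gauss r a) ^ 2 ≤ C * ((√r)⁻¹ * gauss (θ * r) a) := by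
  have hθ0 : 0 < θ := by linarith
  -- φ_r² decays like a density of variance r/2; allowing θr with θ > 1/2 leaves this exponent to
  -- absorb the power of |a|/√r.
  have hc : 0 < 1 - 1 / (2 * θ) := by
    rw [sub_pos, div_lt_one (by positivity)]; linarith
  obtain ⟨C, hC, h⟩ := exists_pow_mul_exp_neg_le (2 * j) hc
  refine ⟨C * √(2 * Real.pi * θ) / (2 * Real.pi), by positivity, fun r hr a => ?_⟩
  have hsr : 0 < √r := Real.sqrt_pos.2 hr
  have hs2 : √r ^ 2 = r := Real.sq_sqrt hr.le
  set y := |a| / √r with hy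
  have hy2 : y ^ 2 = a ^ 2 / r := by rw [hy, div_pow, sq_abs, hs2]
  have hy0 : 0 ≤ y := by positivity
  have h1 := h y
  rw [abs_of_nonneg hy0] at h1
  have e1 : gauss r a = (√(2 * Real.pi * r))⁻¹ * Real.exp (-(y ^ 2 / 2)) := by
    unfold gauss; congr 2; rw [hy2]; field_simp
  have e2 : gauss (θ * r) a = (√(2 * Real.pi * θ) * √r)⁻¹ * Real.exp (-(y ^ 2 / (2 * θ))) := by
    rw [gauss, show 2 * Real.pi * (θ * r) = 2 * Real.pi * θ * r by ring,
      Real.sqrt_mul (by positivity), hy2]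
    congr 2
    field_simp
  have e3 : (Real.exp (-(y ^ 2 / 2))) ^ 2 =
      Real.exp (-((1 - 1 / (2 * θ)) * y ^ 2)) * Real.exp (-(y ^ 2 / (2 * θ))) := by
    rw [← Real.exp_nat_mul, ← Real.exp_add]; congr 1; push_cast; ring
  calc (y ^ j * gauss r a) ^ 2
      = (2 * Real.pi * r)⁻¹ * (y ^ (2 * j) * Real.exp (-((1 - 1 / (2 * θ)) * y ^ 2))) *
          Real.exp (-(y ^ 2 / (2 * θ))) := by
        rw [mul_pow, e1, mul_pow, e3, inv_pow, Real.sq_sqrt (by positivity)]; ring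
    _ ≤ (2 * Real.pi * r)⁻¹ * C * Real.exp (-(y ^ 2 / (2 * θ))) := by gcongr
    _ = C * √(2 * Real.pi * θ) / (2 * Real.pi) * ((√r)⁻¹ * gauss (θ * r) a) := by
        rw [e2]
        have : √(2 * Real.pi * θ) ≠ 0 := by positivity
        field_simp
        rw [hs2]

/-! ### Integrals against normal densities -/

lemma hasDerivAt_gauss_var {ρ : ℝ} (hρ : 0 < ρ) (a : ℝ) :
    HasDerivAt (fun ρ => gauss ρ a) ((a ^ 2 / ρ ^ 2 - 1 / ρ) / 2 * gauss ρ a) ρ := by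
  unfold gauss
  have h0 : 0 < 2 * Real.pi * ρ := by positivity
  have h1 : HasDerivAt (fun ρ => 2 * Real.pi * ρ) (2 * Real.pi) ρ := by
    simpa using (hasDerivAt_id ρ).const_mul (2 * Real.pi)
  have h2 := (h1.sqrt h0.ne').inv (Real.sqrt_pos.2 h0).ne'
  have h3 : HasDerivAt (fun ρ => 2 * ρ) 2 ρ := by simpa using (hasDerivAt_id ρ).const_mul 2
  have h4 : HasDerivAt (fun ρ => Real.exp (-a ^ 2 / (2 * ρ)))
      (Real.exp (-a ^ 2 / (2 * ρ)) * ((0 * (2 * ρ) - -a ^ 2 * 2) / (2 * ρ) ^ 2)) ρ :=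
    ((hasDerivAt_const ρ (-a ^ 2)).div h3 (by positivity)).exp
  refine (h2.mul h4).congr_deriv ?_
  have h5 : √(2 * Real.pi * ρ) ^ 2 = 2 * Real.pi * ρ := Real.sq_sqrt h0.le
  have h6 : √(2 * Real.pi * ρ) ≠ 0 := by positivity
  simp only [h5, Pi.inv_apply]
  field_simp
  ring

lemma hasDerivAt_pow_mul_gauss_sub (j : ℕ) {ρ : ℝ} (hρ : 0 < ρ) (t y : ℝ) :
    HasDerivAt (fun y => (t - y) ^ j * gauss ρ (t - y))
      (((t - y) ^ (j + 1) / ρ - j * (t - y) ^ (j - 1)) * gauss ρ (t - y)) y := by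
  unfold gauss
  have h1 : HasDerivAt (fun y => t - y) (-1) y := by simpa using (hasDerivAt_id y).const_sub t
  have h2 := ((h1.fun_pow 2).neg.div_const (2 * ρ)).exp
  refine ((h1.fun_pow j).mul (h2.const_mul (√(2 * Real.pi * ρ))⁻¹)).congr_deriv ?_
  field_simp
  simp
  ring_nf

/-! ### Domination by a wider normal density and differentiation under the integral. -/

section Dominated

variable {Ω : Type*} [MeasurableSpace Ω] {P : Measure Ω} {F T : Ω → ℝ}

lemma integrable_mul_pow_gauss_sub (hF : Measurable F) (hT : Measurable T) {ρ ρ' : ℝ}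
    (hint : Integrable (fun ω => F ω * gauss ρ' (T ω)) P) (j : ℕ) (hρ : 0 < ρ) (hρ' : ρ < ρ')
    (y : ℝ) : Integrable (fun ω => F ω * ((T ω - y) ^ j * gauss ρ (T ω - y))) P := by
  obtain ⟨C, hC, h⟩ := exists_pow_mul_gauss_sub_le j hρ hρ' (R := |y|)
  refine (hint.norm.const_mul C).mono' (by fun_prop) (ae_of_all _ fun ω => ?_)
  have := h y le_rfl (T ω)
  simp only [norm_mul, Real.norm_eq_abs, abs_pow, abs_of_nonneg (gauss_nonneg _ _)]
  calc |F ω| * (|T ω - y| ^ j * gauss ρ (T ω - y)) ≤ |F ω| * (C * gauss ρ' (T ω)) := by gcongr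
    _ = _ := by ring

lemma integrable_mul_pow_gauss (hF : Measurable F) (hT : Measurable T) {ρ ρ' : ℝ}
    (hint : Integrable (fun ω => F ω * gauss ρ' (T ω)) P) (j : ℕ) (hρ : 0 < ρ) (hρ' : ρ < ρ') :
    Integrable (fun ω => F ω * (T ω ^ j * gauss ρ (T ω))) P := by
  simpa using integrable_mul_pow_gauss_sub hF hT hint j hρ hρ' 0

lemma integrable_mul_gauss (hF : Measurable F) (hT : Measurable T) {ρ ρ' : ℝ}
    (hint : Integrable (fun ω => F ω * gauss ρ' (T ω)) P) (hρ : 0 < ρ) (hρ' : ρ < ρ') :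
    Integrable (fun ω => F ω * gauss ρ (T ω)) P := by
  simpa using integrable_mul_pow_gauss hF hT hint 0 hρ hρ'

/-- Differentiation of `E[F T^j φ_ρ(T)]` with respect to the variance `ρ`. -/
lemma hasDerivAt_integral_pow_gauss_var (hF : Measurable F) (hT : Measurable T) {ρ ρ' : ℝ}
    (hint : Integrable (fun ω => F ω * gauss ρ' (T ω)) P) (j : ℕ) (hρ : 0 < ρ) (hρ' : ρ < ρ') :
    HasDerivAt (fun ρ => ∫ ω, F ω * (T ω ^ j * gauss ρ (T ω)) ∂P)
      (∫ ω, F ω * (T ω ^ j * ((T ω ^ 2 / ρ ^ 2 - 1 / ρ) / 2 * gauss ρ (T ω))) ∂P) ρ := by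
  -- Variances in (ρ/2, b) stay away from 0 and below ρ', so one multiple of φ_ρ' dominates the
  -- derivative; the latter carries two more powers of T, hence the bounds for j and j + 2.
  obtain ⟨b, hb, hb'⟩ := exists_between hρ'
  have hab : ρ / 2 ≤ b := by linarith
  obtain ⟨C, hC, h⟩ := exists_pow_mul_gauss_le j (half_pos hρ) hb' hab
  obtain ⟨D, hD, h'⟩ := exists_pow_mul_gauss_le (j + 2) (half_pos hρ) hb' hab
  have hs : Set.Ioo (ρ / 2) b ∈ 𝓝 ρ := Ioo_mem_nhds (by linarith) hb
  refine (hasDerivAt_integral_of_dominated_loc_of_deriv_le (μ := P)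
    (F := fun ρ ω => F ω * (T ω ^ j * gauss ρ (T ω)))
    (F' := fun ρ ω => F ω * (T ω ^ j * ((T ω ^ 2 / ρ ^ 2 - 1 / ρ) / 2 * gauss ρ (T ω))))
    (bound := fun ω => (D / (ρ / 2) ^ 2 + C / (ρ / 2)) * ‖F ω * gauss ρ' (T ω)‖) hs
    (Eventually.of_forall fun σ => by fun_prop)
    (integrable_mul_pow_gauss hF hT hint j hρ hρ') (by fun_prop) ?_ (hint.norm.const_mul _)
    ?_).2
  · refine ae_of_all _ fun ω σ hσ => ?_
    have hσ0 : 0 < σ := by linarith [hσ.1]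
    have hmem : σ ∈ Set.Icc (ρ / 2) b := ⟨hσ.1.le, hσ.2.le⟩
    have h1 := h σ hmem (T ω)
    have h2 := h' σ hmem (T ω)
    have hg := gauss_nonneg σ (T ω)
    have hg' := gauss_nonneg ρ' (T ω)
    have h3 : |T ω ^ j * ((T ω ^ 2 / σ ^ 2 - 1 / σ) / 2 * gauss σ (T ω))| ≤
        |T ω| ^ (j + 2) * gauss σ (T ω) / (ρ / 2) ^ 2 + |T ω| ^ j * gauss σ (T ω) / (ρ / 2) := by
      rw [abs_mul, abs_mul, abs_of_nonneg hg, abs_pow]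
      have h4 : |(T ω ^ 2 / σ ^ 2 - 1 / σ) / 2| ≤ |T ω| ^ 2 / (ρ / 2) ^ 2 + 1 / (ρ / 2) := by
        have e1 : T ω ^ 2 / σ ^ 2 ≤ |T ω| ^ 2 / (ρ / 2) ^ 2 := by
          rw [sq_abs]; have := hσ.1; gcongr
        have e2 : 1 / σ ≤ 1 / (ρ / 2) := by have := hσ.1; gcongr
        have e3 : 0 ≤ T ω ^ 2 / σ ^ 2 := by positivity
        have e4 : 0 ≤ 1 / σ := by positivity
        rw [abs_le]; constructor <;> linarith
      calc |T ω| ^ j * (|(T ω ^ 2 / σ ^ 2 - 1 / σ) / 2| * gauss σ (T ω))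
          ≤ |T ω| ^ j * ((|T ω| ^ 2 / (ρ / 2) ^ 2 + 1 / (ρ / 2)) * gauss σ (T ω)) := by gcongr
        _ = _ := by ring
    rw [norm_mul (F ω), norm_mul (F ω), Real.norm_eq_abs (T ω ^ j * _), Real.norm_of_nonneg hg']
    calc ‖F ω‖ * |T ω ^ j * ((T ω ^ 2 / σ ^ 2 - 1 / σ) / 2 * gauss σ (T ω))|
        ≤ ‖F ω‖ * (D * gauss ρ' (T ω) / (ρ / 2) ^ 2 + C * gauss ρ' (T ω) / (ρ / 2)) := by
          gcongr
          exact h3.trans (by gcongr)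
      _ = _ := by ring
  · refine ae_of_all _ fun ω σ hσ => ?_
    have hσ0 : 0 < σ := by linarith [hσ.1]
    exact ((hasDerivAt_gauss_var hσ0 (T ω)).const_mul _).const_mul _

/-- Differentiation of `E[F (T - y)^j φ_ρ(T - y)]` with respect to `y`. -/
lemma hasDerivAt_integral_pow_gauss_sub (hF : Measurable F) (hT : Measurable T) {ρ ρ' : ℝ}
    (hint : Integrable (fun ω => F ω * gauss ρ' (T ω)) P) (j : ℕ) (hρ : 0 < ρ) (hρ' : ρ < ρ')
    (y : ℝ) :
    HasDerivAt (fun y => ∫ ω, F ω * ((T ω - y) ^ j * gauss ρ (T ω - y)) ∂P)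
      (∫ ω, F ω * (((T ω - y) ^ (j + 1) / ρ - j * (T ω - y) ^ (j - 1)) *
        gauss ρ (T ω - y)) ∂P) y := by
  -- For j = 0 the truncated exponent j − 1 is harmless, as it is multiplied by j. The radius |y| +
  -- 1 covers the unit ball about y.
  obtain ⟨C, hC, h⟩ := exists_pow_mul_gauss_sub_le (j - 1) hρ hρ' (R := |y| + 1)
  obtain ⟨D, hD, h'⟩ := exists_pow_mul_gauss_sub_le (j + 1) hρ hρ' (R := |y| + 1)
  refine (hasDerivAt_integral_of_dominated_loc_of_deriv_le (μ := P)
    (F := fun y ω => F ω * ((T ω - y) ^ j * gauss ρ (T ω - y)))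
    (F' := fun y ω => F ω * (((T ω - y) ^ (j + 1) / ρ - j * (T ω - y) ^ (j - 1)) *
        gauss ρ (T ω - y)))
    (bound := fun ω => (D / ρ + j * C) * ‖F ω * gauss ρ' (T ω)‖)
    (Metric.ball_mem_nhds y one_pos)
    (Eventually.of_forall fun σ => by fun_prop)
    (integrable_mul_pow_gauss_sub hF hT hint j hρ hρ' y) (by fun_prop) ?_ (hint.norm.const_mul _)
    ?_).2
  · refine ae_of_all _ fun ω z hz => ?_
    have hz' : |z| ≤ |y| + 1 := by
      rw [Metric.mem_ball, Real.dist_eq] at hz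
      have := abs_sub_abs_le_abs_sub z y
      linarith
    have h1 := h z hz' (T ω)
    have h2 := h' z hz' (T ω)
    have hg := gauss_nonneg ρ (T ω - z)
    have hg' := gauss_nonneg ρ' (T ω)
    have h3 : |((T ω - z) ^ (j + 1) / ρ - j * (T ω - z) ^ (j - 1)) * gauss ρ (T ω - z)| ≤
        |T ω - z| ^ (j + 1) * gauss ρ (T ω - z) / ρ +
          j * (|T ω - z| ^ (j - 1) * gauss ρ (T ω - z)) := by
      rw [abs_mul, abs_of_nonneg hg]
      refine (mul_le_mul_of_nonneg_right (abs_sub _ _) hg).trans (le_of_eq ?_)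
      rw [abs_div, abs_mul, abs_pow, abs_pow, abs_of_pos hρ, Nat.abs_cast]
      ring
    rw [norm_mul (F ω), norm_mul (F ω), Real.norm_eq_abs (_ * gauss ρ (T ω - z)),
      Real.norm_of_nonneg hg']
    calc ‖F ω‖ * |((T ω - z) ^ (j + 1) / ρ - j * (T ω - z) ^ (j - 1)) * gauss ρ (T ω - z)|
        ≤ ‖F ω‖ * (D * gauss ρ' (T ω) / ρ + j * (C * gauss ρ' (T ω))) := by
          gcongr
          exact h3.trans (by gcongr)
      _ = _ := by ring
  · refine ae_of_all _ fun ω z hz => ?_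
    exact (hasDerivAt_pow_mul_gauss_sub j hρ (T ω) z).const_mul _

end Dominated

/-! ### A central limit theorem for triangular arrays -/

/-- The function `min (y², |y|³)` controlling the remainder of the second-order expansion of the
characteristic function. -/
def truncSq (y : ℝ) : ℝ := min (y ^ 2) (|y| ^ 3)

lemma truncSq_nonneg (y : ℝ) : 0 ≤ truncSq y := le_min (sq_nonneg _) (by positivity)

lemma truncSq_le_sq (y : ℝ) : truncSq y ≤ y ^ 2 := min_le_left _ _

@[fun_prop]
lemma measurable_truncSq : Measurable truncSq := by unfold truncSq; fun_prop

lemma truncSq_le_of_abs_le {y z : ℝ} (h : |y| ≤ |z|) : truncSq y ≤ truncSq z :=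
  min_le_min (sq_le_sq.2 h) (by gcongr)

lemma truncSq_mul_le (c y : ℝ) : truncSq (c * y) ≤ (1 + |c|) ^ 3 * truncSq y := by
  have hc := abs_nonneg c
  have h1 : c ^ 2 ≤ (1 + |c|) ^ 3 := by rw [← sq_abs]; nlinarith [pow_nonneg hc 3]
  have h2 : |c| ^ 3 ≤ (1 + |c|) ^ 3 := by gcongr; linarith
  unfold truncSq
  rw [mul_min_of_nonneg _ _ (by positivity), mul_pow, abs_mul, mul_pow]
  exact min_le_min (by gcongr) (by gcongr)

/-- The sum is at most its number of terms times the largest one in absolute value, and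
`truncSq_mul_le` prices the scaling. -/
lemma truncSq_sum_le {ι : Type*} (s : Finset ι) (a : ι → ℝ) :
    truncSq (∑ k ∈ s, a k) ≤ (1 + (s.card : ℝ)) ^ 3 * ∑ k ∈ s, truncSq (a k) := by
  rcases s.eq_empty_or_nonempty with rfl | hs
  · simp [truncSq]
  obtain ⟨k, hk, hmax⟩ := s.exists_max_image (fun k => |a k|) hs
  have h1 : |∑ k ∈ s, a k| ≤ |(s.card : ℝ) * a k| := by
    rw [abs_mul, Nat.abs_cast]
    refine (Finset.abs_sum_le_sum_abs _ _).trans ?_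
    simpa using Finset.sum_le_card_nsmul s _ _ hmax
  refine (truncSq_le_of_abs_le h1).trans ((truncSq_mul_le _ _).trans ?_)
  rw [Nat.abs_cast]
  gcongr
  exact Finset.single_le_sum (f := fun k => truncSq (a k)) (fun i _ => truncSq_nonneg _) hk

lemma truncSq_sub_le (a b : ℝ) : truncSq (a - b) ≤ 27 * (truncSq a + truncSq b) := by
  -- The difference is at most twice the larger term, and 27 = (1 + 2)³.
  have h := fun c : ℝ => truncSq_mul_le 2 c
  norm_num at h
  have ha := truncSq_nonneg a
  have hb := truncSq_nonneg b
  rcases le_total |a| |b| with hab | hab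
  · have h1 : |a - b| ≤ |2 * b| := by
      rw [abs_mul, abs_two]; linarith [abs_sub a b]
    linarith [truncSq_le_of_abs_le h1, h b]
  · have h1 : |a - b| ≤ |2 * a| := by
      rw [abs_mul, abs_two]; linarith [abs_sub a b]
    linarith [truncSq_le_of_abs_le h1, h a]

/-- Taylor's bound of order three for |y| ≤ 1; for |y| ≥ 1 the four terms are simply added, each
being at most a multiple of y². -/
lemma norm_exp_mul_I_sub_le (y : ℝ) :
    ‖Complex.exp (y * Complex.I) - (1 + y * Complex.I - y ^ 2 / 2)‖ ≤ 4 * truncSq y := by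
  have hn : ‖(y : ℂ) * Complex.I‖ = |y| := by simp
  rcases le_total |y| 1 with h | h
  · have h3 : |y| ^ 3 ≤ y ^ 2 := by
      rw [← sq_abs]; exact pow_le_pow_of_le_one (abs_nonneg y) h (by norm_num)
    have := Complex.exp_bound (x := y * Complex.I) (by rwa [hn]) (n := 3) (by norm_num)
    rw [hn] at this
    rw [truncSq, min_eq_right h3]
    have e : ∑ m ∈ Finset.range 3, ((y : ℂ) * Complex.I) ^ m / (m.factorial : ℂ) =
        1 + y * Complex.I - y ^ 2 / 2 := by
      simp [Finset.sum_range_succ, Nat.factorial, mul_pow, Complex.I_sq]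
      ring
    rw [e] at this
    refine this.trans ?_
    have h0 : 0 ≤ |y| ^ 3 := by positivity
    norm_num [Nat.factorial]
    linarith
  · have h3 : y ^ 2 ≤ |y| ^ 3 := by
      rw [← sq_abs]; exact pow_le_pow_right₀ h (by norm_num)
    rw [truncSq, min_eq_left h3]
    have h1 : ‖Complex.exp (y * Complex.I)‖ = 1 := Complex.norm_exp_ofReal_mul_I y
    have h2 : ‖(y : ℂ) ^ 2 / 2‖ = y ^ 2 / 2 := by simp
    calc ‖Complex.exp (y * Complex.I) - (1 + y * Complex.I - y ^ 2 / 2)‖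
        ≤ ‖Complex.exp (y * Complex.I)‖ + ((‖(1 : ℂ)‖ + ‖(y : ℂ) * Complex.I‖) +
          ‖(y : ℂ) ^ 2 / 2‖) :=
          (norm_sub_le _ _).trans (add_le_add_right ((norm_sub_le _ _).trans
            (add_le_add_left (norm_add_le _ _) _)) _)
      _ = 1 + (1 + |y| + y ^ 2 / 2) := by rw [h1, hn, h2, norm_one]
      _ ≤ 4 * y ^ 2 := by rw [← sq_abs]; nlinarith

section CLT

variable {Ω : Type*} [MeasurableSpace Ω] {P : Measure Ω} [IsProbabilityMeasure P]

/-- The pointwise expansion is integrated; its linear term vanishes by centring. -/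
lemma norm_integral_exp_sub_le {ζ : Ω → ℝ} (hζ : MemLp ζ 2 P) (h0 : ∫ ω, ζ ω ∂P = 0) (c : ℝ) :
    ‖∫ ω, Complex.exp ((c * ζ ω : ℝ) * Complex.I) ∂P - (1 - (c ^ 2 * ∫ ω, ζ ω ^ 2 ∂P : ℝ) / 2)‖ ≤
      4 * ∫ ω, truncSq (c * ζ ω) ∂P := by
  have hm := hζ.aestronglyMeasurable.aemeasurable
  have hi : Integrable ζ P := hζ.integrable (by norm_num)
  have hs : Integrable (fun ω => ζ ω ^ 2) P := hζ.integrable_sq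
  have i1 : Integrable (fun ω => Complex.exp ((c * ζ ω : ℝ) * Complex.I)) P := by
    refine Integrable.of_bound (C := 1)
      (AEMeasurable.aestronglyMeasurable (by fun_prop)) (ae_of_all _ fun ω => ?_)
    rw [Complex.norm_exp_ofReal_mul_I]
  have i2 : Integrable (fun ω => ((c * ζ ω : ℝ) : ℂ)) P := (hi.const_mul c).ofReal
  have i3 : Integrable (fun ω => (((c * ζ ω) ^ 2 : ℝ) : ℂ)) P := by
    simp only [mul_pow]; exact (hs.const_mul _).ofReal
  have i4 : Integrable (fun ω => 1 + ((c * ζ ω : ℝ) : ℂ) * Complex.I) P :=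
    (integrable_const _).add (i2.mul_const _)
  have i5 : Integrable (fun ω => 1 + ((c * ζ ω : ℝ) : ℂ) * Complex.I -
      (((c * ζ ω) ^ 2 : ℝ) : ℂ) / 2) P := i4.sub (i3.div_const _)
  have e : ∫ ω, (1 + ((c * ζ ω : ℝ) : ℂ) * Complex.I - (((c * ζ ω) ^ 2 : ℝ) : ℂ) / 2) ∂P =
      1 - (c ^ 2 * ∫ ω, ζ ω ^ 2 ∂P : ℝ) / 2 := by
    rw [integral_sub i4 (i3.div_const _),
      integral_add (integrable_const _) (i2.mul_const _), integral_mul_const, integral_div,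
      integral_complex_ofReal, integral_complex_ofReal, integral_const_mul, h0]
    simp [mul_pow, integral_const_mul]
  rw [← e, ← integral_sub i1 i5,
    ← integral_const_mul]
  refine norm_integral_le_of_norm_le ?_ (ae_of_all _ fun ω => ?_)
  · refine Integrable.const_mul ?_ 4
    refine ((hs.const_mul (c ^ 2))).mono' (AEMeasurable.aestronglyMeasurable (by fun_prop))
      (ae_of_all _ fun ω => ?_)
    rw [Real.norm_of_nonneg (truncSq_nonneg _), ← mul_pow]
    exact truncSq_le_sq _
  · simpa using norm_exp_mul_I_sub_le (c * ζ ω)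

/-- **Lindeberg's theorem**, at the level of characteristic functions, for rows of i.i.d. centred
random variables. -/
lemma tendsto_integral_exp_pow {ζ : ℕ → Ω → ℝ} (hζ : ∀ᶠ n in atTop, MemLp (ζ n) 2 P)
    (h0 : ∀ᶠ n in atTop, ∫ ω, ζ n ω ∂P = 0) {v : ℝ}
    (hv : Tendsto (fun n => ∫ ω, ζ n ω ^ 2 ∂P) atTop (𝓝 v))
    (hL : Tendsto (fun n : ℕ => n * ∫ ω, truncSq ((√n)⁻¹ * ζ n ω) ∂P) atTop (𝓝 0)) :
    Tendsto (fun n : ℕ => (∫ ω, Complex.exp (((√n)⁻¹ * ζ n ω : ℝ) * Complex.I) ∂P) ^ n) atTop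
      (𝓝 (Complex.exp (-(v / 2 : ℝ)))) := by
  set z : ℕ → ℂ := fun n => ∫ ω, Complex.exp (((√n)⁻¹ * ζ n ω : ℝ) * Complex.I) ∂P with hz
  -- It is enough that n(z_n − 1) → −v/2, since then z_n^n converges to the exponential of that
  -- limit.
  have h1 : Tendsto (fun n : ℕ => (n : ℂ) * (z n - 1)) atTop (𝓝 (-(v / 2 : ℝ))) := by
    have h2 : Tendsto (fun n : ℕ => (-((∫ ω, ζ n ω ^ 2 ∂P) / 2 : ℝ) : ℂ)) atTop
        (𝓝 (-(v / 2 : ℝ))) :=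
      ((Complex.continuous_ofReal.tendsto _).comp (hv.div_const 2)).neg
    refine tendsto_of_tendsto_of_dist h2 ?_
    have h3 := hL.const_mul 4
    rw [mul_zero] at h3
    refine squeeze_zero' (Eventually.of_forall fun _ => dist_nonneg) ?_ h3
    filter_upwards [hζ, h0, eventually_gt_atTop 0] with n hn hn0 hnpos
    have hn' : (0 : ℝ) < n := by exact_mod_cast hnpos
    have h4 := norm_integral_exp_sub_le hn hn0 (√n)⁻¹
    have h5 : ((√n)⁻¹) ^ 2 = (n : ℝ)⁻¹ := by rw [inv_pow, Real.sq_sqrt hn'.le]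
    rw [h5] at h4
    rw [dist_comm, dist_eq_norm]
    have h6 : (n : ℂ) * (z n - 1) - -((∫ ω, ζ n ω ^ 2 ∂P) / 2 : ℝ) =
        n * (z n - (1 - ((n : ℝ)⁻¹ * ∫ ω, ζ n ω ^ 2 ∂P : ℝ) / 2)) := by
      have : (n : ℂ) ≠ 0 := by exact_mod_cast hnpos.ne'
      push_cast
      field_simp
      ring
    rw [h6, norm_mul, Complex.norm_natCast]
    calc (n : ℝ) * _ ≤ n * (4 * ∫ ω, truncSq ((√n)⁻¹ * ζ n ω) ∂P) := by gcongr
      _ = _ := by ring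
  have := Complex.tendsto_one_add_pow_exp_of_tendsto h1
  simpa only [add_sub_cancel] using this

variable {S ι : Type*} [MeasurableSpace S] [Fintype ι] [DecidableEq ι]

/-- **Lindeberg's central limit theorem** for a triangular array whose `n`-th row consists of the
random vectors `G n (V i)`, with `V i` i.i.d. -/
theorem tendstoInDistribution_array {V : ℕ → Ω → S} (hV : ∀ i, Measurable (V i))
    (hindep : iIndepFun V P) (hident : ∀ i, IdentDistrib (V i) (V 0) P P)
    {G : ℕ → S → ι → ℝ} (hG : ∀ n k, Measurable fun s => G n s k)
    (hL2 : ∀ᶠ n in atTop, ∀ k, MemLp (fun ω => G n (V 0 ω) k) 2 P)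
    {Δ : Matrix ι ι ℝ}
    (hmean : ∀ k, Tendsto (fun n => ∫ ω, G n (V 0 ω) k ∂P) atTop (𝓝 0))
    (hcov : ∀ k l, Tendsto (fun n => ∫ ω, G n (V 0 ω) k * G n (V 0 ω) l ∂P) atTop (𝓝 (Δ k l)))
    (hL : ∀ k, Tendsto (fun n : ℕ => n * ∫ ω, truncSq ((√n)⁻¹ * G n (V 0 ω) k) ∂P)
      atTop (𝓝 0)) :
    Δ.PosSemidef ∧
    TendstoInDistribution
      (fun (n : ℕ) ω => (WithLp.toLp 2 fun k => (√n)⁻¹ * ∑ i ∈ Finset.range n,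
        (G n (V i ω) k - ∫ ω, G n (V 0 ω) k ∂P) : EuclideanSpace ℝ ι))
      atTop (id : EuclideanSpace ℝ ι → EuclideanSpace ℝ ι) (fun _ => P)
      (multivariateGaussian 0 Δ) := by
  set m : ℕ → ι → ℝ := fun n k => ∫ ω, G n (V 0 ω) k ∂P with hm
  -- linear combinations of the coordinates
  have key : ∀ t : ι → ℝ, ∃ ζ : ℕ → Ω → ℝ,
      (∀ n ω, ζ n ω = ∑ k, t k * (G n (V 0 ω) k - m n k)) ∧
      (∀ᶠ n in atTop, MemLp (ζ n) 2 P) ∧ (∀ᶠ n in atTop, ∫ ω, ζ n ω ∂P = 0) ∧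
      Tendsto (fun n => ∫ ω, ζ n ω ^ 2 ∂P) atTop (𝓝 (∑ k, ∑ l, t k * t l * Δ k l)) ∧
      Tendsto (fun n : ℕ => n * ∫ ω, truncSq ((√n)⁻¹ * ζ n ω) ∂P) atTop (𝓝 0) := by
    intro t
    refine ⟨fun n ω => ∑ k, t k * (G n (V 0 ω) k - m n k), fun _ _ => rfl, ?_, ?_, ?_, ?_⟩
    · filter_upwards [hL2] with n hn
      exact memLp_finsetSum _ fun k _ => ((hn k).sub (memLp_const _)).const_mul _
    · filter_upwards [hL2] with n hn
      have hi : ∀ k, Integrable (fun ω => G n (V 0 ω) k) P := fun k =>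
        (hn k).integrable (by norm_num)
      have hi' : ∀ k, Integrable (fun ω => G n (V 0 ω) k - m n k) P := fun k =>
        (hi k).sub (integrable_const _)
      rw [integral_finsetSum _ fun k _ => (hi' k).const_mul _]
      refine Finset.sum_eq_zero fun k _ => ?_
      rw [integral_const_mul, integral_sub (hi k) (integrable_const _)]
      simp [hm]
    · have h1 : Tendsto (fun n => ∑ k, ∑ l, t k * t l *
          (∫ ω, G n (V 0 ω) k * G n (V 0 ω) l ∂P - m n k * m n l)) atTop
          (𝓝 (∑ k, ∑ l, t k * t l * (Δ k l - 0 * 0))) :=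
        tendsto_finsetSum _ fun k _ => tendsto_finsetSum _ fun l _ =>
          ((hcov k l).sub ((hmean k).mul (hmean l))).const_mul _
      simp only [mul_zero, sub_zero] at h1
      refine h1.congr' ?_
      filter_upwards [hL2] with n hn
      have hi : ∀ k, Integrable (fun ω => G n (V 0 ω) k) P := fun k =>
        (hn k).integrable (by norm_num)
      have hp : ∀ k l, Integrable (fun ω => (G n (V 0 ω) k - m n k) * (G n (V 0 ω) l - m n l)) P :=
        fun k l => ((hn k).sub (memLp_const _)).integrable_mul ((hn l).sub (memLp_const _))
      have e1 : ∀ ω, (∑ k, t k * (G n (V 0 ω) k - m n k)) ^ 2 =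
          ∑ k, ∑ l, t k * t l * ((G n (V 0 ω) k - m n k) * (G n (V 0 ω) l - m n l)) := fun ω => by
        rw [sq, Finset.sum_mul_sum]
        exact Finset.sum_congr rfl fun k _ => Finset.sum_congr rfl fun l _ => by ring
      simp only [e1]
      rw [integral_finsetSum _ fun k _ => integrable_finsetSum _ fun l _ => (hp k l).const_mul _]
      refine Finset.sum_congr rfl fun k _ => ?_
      rw [integral_finsetSum _ fun l _ => (hp k l).const_mul _]
      refine Finset.sum_congr rfl fun l _ => ?_
      rw [integral_const_mul]
      congr 1
      exact (covariance_eq_sub (hn k) (hn l)).symm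
    -- The Lindeberg sum of a combination is controlled by those of the coordinates plus n ·
    -- `truncSq (m/√n)` ≤ m², which vanishes with the means.
    · set N : ℝ := (1 + (Fintype.card ι : ℝ)) ^ 3
      have hB : Tendsto (fun n : ℕ => N * ∑ k, (1 + |t k|) ^ 3 * (27 *
          (n * ∫ ω, truncSq ((√n)⁻¹ * G n (V 0 ω) k) ∂P + m n k ^ 2)))
          atTop (𝓝 (N * ∑ k, (1 + |t k|) ^ 3 * (27 * (0 + 0 ^ 2)))) :=
        (tendsto_finsetSum _ fun k _ =>
          (((hL k).add ((hmean k).pow 2)).const_mul _).const_mul _).const_mul _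
      simp only [ne_eq, OfNat.ofNat_ne_zero, not_false_eq_true, zero_pow, add_zero, mul_zero,
        Finset.sum_const_zero] at hB
      refine squeeze_zero' (Eventually.of_forall fun n => mul_nonneg (Nat.cast_nonneg _)
        (integral_nonneg fun _ => truncSq_nonneg _)) ?_ hB
      filter_upwards [hL2, eventually_gt_atTop 0] with n hn hnpos
      have hn' : (0 : ℝ) < n := by exact_mod_cast hnpos
      set c : ℝ := (√n)⁻¹ with hc
      have hc2 : n * c ^ 2 = 1 := by
        rw [hc, inv_pow, Real.sq_sqrt hn'.le, mul_inv_cancel₀ hn'.ne']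
      have hint : ∀ k, Integrable (fun ω => truncSq (c * G n (V 0 ω) k)) P := fun k => by
        refine (((hn k).const_mul c).integrable_sq).mono'
          (measurable_truncSq.comp_aemeasurable
            ((hn k).const_mul c).aestronglyMeasurable.aemeasurable).aestronglyMeasurable
          (ae_of_all _ fun ω => ?_)
        rw [Real.norm_of_nonneg (truncSq_nonneg _)]
        exact truncSq_le_sq _
      have hint' : ∀ k, Integrable (fun ω => truncSq (c * G n (V 0 ω) k) + truncSq (c * m n k)) P :=
        fun k => (hint k).add (integrable_const _)
      have hpt : ∀ ω, truncSq (c * ∑ k, t k * (G n (V 0 ω) k - m n k)) ≤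
          N * ∑ k, (1 + |t k|) ^ 3 * (27 * (truncSq (c * G n (V 0 ω) k) +
            truncSq (c * m n k))) := fun ω => by
        have e : c * ∑ k, t k * (G n (V 0 ω) k - m n k) =
            ∑ k, t k * (c * G n (V 0 ω) k - c * m n k) := by
          rw [Finset.mul_sum]; exact Finset.sum_congr rfl fun k _ => by ring
        rw [e]
        refine (truncSq_sum_le _ _).trans ?_
        rw [Finset.card_univ]
        gcongr with k _
        refine (truncSq_mul_le _ _).trans ?_
        gcongr
        exact truncSq_sub_le _ _
      have hle : ∫ ω, truncSq (c * ∑ k, t k * (G n (V 0 ω) k - m n k)) ∂P ≤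
          N * ∑ k, (1 + |t k|) ^ 3 * (27 * (∫ ω, truncSq (c * G n (V 0 ω) k) ∂P +
            truncSq (c * m n k))) := by
        refine (integral_mono_of_nonneg (ae_of_all _ fun _ => truncSq_nonneg _)
          ((integrable_finsetSum _ fun k _ => ((hint' k).const_mul _).const_mul _).const_mul _)
          (ae_of_all _ hpt)).trans (le_of_eq ?_)
        rw [integral_const_mul, integral_finsetSum _ fun k _ =>
          ((hint' k).const_mul _).const_mul _]
        congr 1
        refine Finset.sum_congr rfl fun k _ => ?_
        rw [integral_const_mul, integral_const_mul, integral_add (hint k) (integrable_const _)]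
        simp
      calc (n : ℝ) * ∫ ω, truncSq (c * ∑ k, t k * (G n (V 0 ω) k - m n k)) ∂P
          ≤ n * (N * ∑ k, (1 + |t k|) ^ 3 * (27 * (∫ ω, truncSq (c * G n (V 0 ω) k) ∂P +
            truncSq (c * m n k)))) := by gcongr
        _ = N * ∑ k, (1 + |t k|) ^ 3 * (27 * (n * ∫ ω, truncSq (c * G n (V 0 ω) k) ∂P +
            n * truncSq (c * m n k))) := by
          rw [mul_left_comm, Finset.mul_sum]
          congr 1
          exact Finset.sum_congr rfl fun k _ => by ring
        _ ≤ _ := by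
          gcongr with k _
          calc n * truncSq (c * m n k) ≤ n * (c * m n k) ^ 2 := by
                gcongr; exact truncSq_le_sq _
            _ = m n k ^ 2 := by rw [mul_pow, ← mul_assoc, hc2, one_mul]
  have hquad : ∀ t : ι → ℝ, t ⬝ᵥ Δ.mulVec t = ∑ k, ∑ l, t k * t l * Δ k l := fun t => by
    simp only [dotProduct, Matrix.mulVec, Finset.mul_sum]
    exact Finset.sum_congr rfl fun k _ => Finset.sum_congr rfl fun l _ => by ring
  -- Symmetry and nonnegativity survive the limit: tᵀΔt is a limit of second moments. This must
  -- precede the formula for the characteristic function of the normal law.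
  have hpsd : Δ.PosSemidef := by
    refine .of_dotProduct_mulVec_nonneg ?_ fun t => ?_
    · ext k l
      rw [Matrix.conjTranspose_apply, star_trivial]
      refine tendsto_nhds_unique (hcov l k) ((hcov k l).congr fun n => ?_)
      simp only [mul_comm]
    · obtain ⟨ζ, -, -, -, h, -⟩ := key t
      rw [star_trivial, hquad]
      exact ge_of_tendsto' h fun n => integral_nonneg fun _ => sq_nonneg _
  refine ⟨hpsd, ?_⟩
  set ξ : ℕ → ℕ → Ω → EuclideanSpace ℝ ι := fun n i ω =>
    WithLp.toLp 2 fun k => (√n)⁻¹ * (G n (V i ω) k - m n k) with hξ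
  have hξm : ∀ n i, Measurable (ξ n i) := fun n i =>
    (WithLp.measurable_toLp 2 (ι → ℝ)).comp
      (measurable_pi_lambda _ fun k => (((hG n k).comp (hV i)).sub_const _).const_mul _)
  have hsum : ∀ (n : ℕ) ω, (WithLp.toLp 2 fun k => (√n)⁻¹ * ∑ i ∈ Finset.range n,
      (G n (V i ω) k - ∫ ω, G n (V 0 ω) k ∂P) : EuclideanSpace ℝ ι) =
      ∑ i ∈ Finset.range n, ξ n i ω := fun n ω => by
    ext k
    simp [hξ, hm, Finset.mul_sum, -Finset.sum_sub_distrib]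
  simp only [hsum]
  refine ⟨fun n => (Finset.measurable_sum _ fun i _ => hξm n i).aemeasurable, by fun_prop, ?_⟩
  -- Lévy's continuity theorem; the characteristic function of a row sum at t is the n-th power of
  -- one expectation, that of the combination with coefficients t.
  refine ProbabilityMeasure.tendsto_iff_tendsto_charFun.2 fun t => ?_
  obtain ⟨ζ, hζ, h1, h2, h3, h4⟩ := key t
  have hlim := tendsto_integral_exp_pow h1 h2 h3 h4
  simp only [ProbabilityMeasure.coe_mk, Measure.map_id]
  rw [charFun_multivariateGaussian hpsd]
  have e : Complex.exp (inner ℝ t 0 * Complex.I - (t ⬝ᵥ Δ.mulVec t : ℝ) / 2) =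
      Complex.exp (-((∑ k, ∑ l, t k * t l * Δ k l) / 2 : ℝ)) := by
    rw [hquad]; simp
  rw [e]
  refine hlim.congr fun n => ?_
  have hid : ∀ i, charFun (P.map (ξ n i)) t =
      ∫ ω, Complex.exp (((√n)⁻¹ * ζ n ω : ℝ) * Complex.I) ∂P := fun i => by
    have hφ : Measurable fun s : S => (WithLp.toLp 2 fun k => (√n)⁻¹ * (G n s k - m n k) :
        EuclideanSpace ℝ ι) :=
      (WithLp.measurable_toLp 2 (ι → ℝ)).comp
        (measurable_pi_lambda _ fun k => ((hG n k).sub_const _).const_mul _)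
    have : P.map (ξ n i) = P.map (ξ n 0) := ((hident i).comp hφ).map_eq
    rw [this, charFun_apply, integral_map (hξm n 0).aemeasurable (by fun_prop)]
    refine integral_congr_ae (ae_of_all _ fun ω => ?_)
    simp only [hξ, hζ]
    congr 3
    rw [EuclideanSpace.inner_eq_star_dotProduct]
    simp only [dotProduct, star_trivial, Finset.mul_sum]
    exact Finset.sum_congr rfl fun k _ => by ring
  have hind : iIndepFun (ξ n) P :=
    hindep.comp (fun _ s => (WithLp.toLp 2 fun k => (√n)⁻¹ * (G n s k - m n k) :
        EuclideanSpace ℝ ι)) fun _ => (WithLp.measurable_toLp 2 (ι → ℝ)).comp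
        (measurable_pi_lambda _ fun k => ((hG n k).sub_const _).const_mul _)
  rw [(hind.restrict _).charFun_map_fun_finsetSum_eq_prod fun i _ => (hξm n i).aemeasurable,
    Finset.prod_apply, Finset.prod_congr rfl fun i _ => hid i]
  simp

end CLT

/-! ### Convergence in probability as convergence along a filter -/

section Probability

variable {Ω : Type*} [MeasurableSpace Ω]

/-- The filter on `ℕ × Ω` of the sets whose `n`-th sections have probability tending to one.
Convergence along this filter is convergence in probability. -/
def probFilter (P : Measure Ω) : Filter (ℕ × Ω) where
  sets := {S | Tendsto (fun n => P {ω | (n, ω) ∉ S}) atTop (𝓝 0)}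
  univ_sets := by simp
  sets_of_superset {S T} hS hST :=
    tendsto_of_tendsto_of_tendsto_of_le_of_le tendsto_const_nhds hS (fun _ => zero_le)
      fun n => measure_mono fun ω hω h => hω (hST h)
  inter_sets {S T} hS hT := by
    have h := Tendsto.add (Set.mem_ofPred_eq ▸ hS) (Set.mem_ofPred_eq ▸ hT)
    rw [add_zero] at h
    refine tendsto_of_tendsto_of_tendsto_of_le_of_le tendsto_const_nhds h (fun _ => zero_le)
      fun n => (measure_mono ?_).trans (measure_union_le _ _)
    intro ω hω
    simp only [Set.mem_inter_iff, Set.mem_ofPred_eq, not_and_or] at hω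
    exact hω

lemma mem_probFilter {P : Measure Ω} {S : Set (ℕ × Ω)} :
    S ∈ probFilter P ↔ Tendsto (fun n => P {ω | (n, ω) ∉ S}) atTop (𝓝 0) := Iff.rfl

/-- A sequence of random variables is bounded in probability. -/
def IsBoundedInProb (P : Measure Ω) (V : ℕ → Ω → ℝ) : Prop :=
  ∀ ε : ℝ≥0∞, 0 < ε → ∃ M : ℝ, ∀ᶠ n in atTop, P {ω | M < |V n ω|} ≤ ε

variable {P : Measure Ω}

/-- Deterministic limits are thereby limits along `probFilter`, so the usual algebra of limits mixes
deterministic and random sequences. -/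
lemma tendsto_fst_probFilter : Tendsto Prod.fst (probFilter P) atTop := by
  refine tendsto_atTop.2 fun N => mem_probFilter.2 ?_
  refine tendsto_const_nhds.congr' ?_
  filter_upwards [eventually_ge_atTop N] with n hn
  simp [hn]

lemma isBoundedInProb_of_integral_sq_le {V : ℕ → Ω → ℝ} {C : ℝ}
    (h : ∀ᶠ n in atTop, Integrable (fun ω => V n ω ^ 2) P ∧ ∫ ω, V n ω ^ 2 ∂P ≤ C) :
    IsBoundedInProb P V := by
  intro ε hε
  rcases eq_or_ne ε ∞ with rfl | hε'
  · exact ⟨0, Eventually.of_forall fun _ => le_top⟩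
  have he : 0 < ε.toReal := ENNReal.toReal_pos hε.ne' hε'
  -- Chebyshev's inequality: M² is chosen so that max(C, 0) ≤ M²ε, the added 1 keeping M positive.
  set M := √(max C 0 / ε.toReal + 1)
  have hM2 : M ^ 2 = max C 0 / ε.toReal + 1 := Real.sq_sqrt (by positivity)
  have hM : 0 < M := by positivity
  refine ⟨M, ?_⟩
  filter_upwards [h] with n hn
  have h1 := mul_meas_ge_le_lintegral₀ (hn.1.aestronglyMeasurable.aemeasurable.ennreal_ofReal)
    (ENNReal.ofReal (M ^ 2))
  rw [← ofReal_integral_eq_lintegral_ofReal hn.1 (ae_of_all _ fun _ => sq_nonneg _)] at h1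
  have h2 : P {ω | M < |V n ω|} ≤
      P {ω | ENNReal.ofReal (M ^ 2) ≤ ENNReal.ofReal (V n ω ^ 2)} := by
    refine measure_mono fun ω hω => ENNReal.ofReal_le_ofReal ?_
    rw [← sq_abs (V n ω)]
    have : M < |V n ω| := hω
    gcongr
  have h3 : ENNReal.ofReal (M ^ 2) * P {ω | M < |V n ω|} ≤ ENNReal.ofReal (max C 0) :=
    (mul_le_mul_right h2 _).trans (h1.trans (ENNReal.ofReal_le_ofReal
      (hn.2.trans (le_max_left _ _))))
  have h4 : ENNReal.ofReal (max C 0) ≤ ENNReal.ofReal (M ^ 2) * ε := by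
    rw [← ENNReal.ofReal_toReal hε', ← ENNReal.ofReal_mul (by positivity)]
    refine ENNReal.ofReal_le_ofReal ?_
    rw [hM2, add_mul, div_mul_cancel₀ _ he.ne']
    linarith
  exact (ENNReal.mul_le_mul_iff_right (by simpa using hM.ne') ENNReal.ofReal_ne_top).1
    (h3.trans h4)

/-- o_P(1) · O_P(1) = o_P(1): half of ε is spent on the event |V| > M, and on its complement ξ only
has to be below δ/(|M| + 1). -/
lemma tendsto_mul_of_isBoundedInProb {ξ V : ℕ → Ω → ℝ}
    (hξ : Tendsto (fun z : ℕ × Ω => ξ z.1 z.2) (probFilter P) (𝓝 0))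
    (hV : IsBoundedInProb P V) :
    Tendsto (fun z : ℕ × Ω => ξ z.1 z.2 * V z.1 z.2) (probFilter P) (𝓝 0) := by
  rw [Metric.tendsto_nhds]
  intro δ hδ
  refine mem_probFilter.2 (ENNReal.tendsto_nhds_zero.2 fun ε hε => ?_)
  obtain ⟨M, hM⟩ := hV (ε / 2) (ENNReal.half_pos hε.ne')
  have h1 := mem_probFilter.1 (Metric.tendsto_nhds.1 hξ (δ / (|M| + 1)) (by positivity))
  filter_upwards [hM, ENNReal.tendsto_nhds_zero.1 h1 (ε / 2) (ENNReal.half_pos hε.ne')]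
    with n h2 h3
  refine (measure_mono ?_).trans ((measure_union_le _ _).trans
    ((add_le_add h3 h2).trans (ENNReal.add_halves ε).le))
  intro ω hω
  by_contra hcon
  simp only [Set.mem_union, Set.mem_ofPred_eq, not_or, not_lt, dist_zero_right,
    Real.norm_eq_abs] at hcon hω
  refine hω.not_gt ?_
  rw [abs_mul]
  have h4 : |V n ω| < |M| + 1 := hcon.2.trans_lt (by linarith [le_abs_self M])
  calc |ξ n ω| * |V n ω| ≤ |ξ n ω| * (|M| + 1) := by gcongr
    _ < δ / (|M| + 1) * (|M| + 1) := by have := not_le.1 hcon.1; gcongr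
    _ = δ := div_mul_cancel₀ _ (by positivity)

lemma tendsto_of_isBoundedInProb {A : ℕ → Ω → ℝ} {α R : ℕ → ℝ} {f : ℝ}
    (hR : Tendsto R atTop atTop) (hA : IsBoundedInProb P fun n ω => R n * (A n ω - α n))
    (hα : Tendsto α atTop (𝓝 f)) :
    Tendsto (fun z : ℕ × Ω => A z.1 z.2) (probFilter P) (𝓝 f) := by
  have h1 : Tendsto (fun z : ℕ × Ω => (R z.1)⁻¹) (probFilter P) (𝓝 0) :=
    (tendsto_inv_atTop_zero.comp hR).comp tendsto_fst_probFilter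
  have h2 := (hα.comp tendsto_fst_probFilter).add
    (tendsto_mul_of_isBoundedInProb (ξ := fun n _ => (R n)⁻¹) h1 hA)
  rw [add_zero] at h2
  refine h2.congr' ?_
  filter_upwards [tendsto_fst_probFilter.eventually (hR.eventually_gt_atTop 0)] with z hz
  simp only [Function.comp_apply]
  field_simp
  ring

lemma tendsto_fun_div {ι : Type*} {l : Filter ι} {u v : ι → ℝ} {a b : ℝ}
    (hu : Tendsto u l (𝓝 a)) (hv : Tendsto v l (𝓝 b)) (hb : b ≠ 0) :
    Tendsto (fun i => u i / v i) l (𝓝 (a / b)) := hu.div hv hb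

lemma tendstoInMeasure_of_tendsto_probFilter {E : Type*} [SeminormedAddCommGroup E]
    {V : ℕ → Ω → E} (h : Tendsto (fun z : ℕ × Ω => V z.1 z.2) (probFilter P) (𝓝 0)) :
    TendstoInMeasure P V atTop 0 := by
  rw [tendstoInMeasure_iff_norm]
  intro ε hε
  have := mem_probFilter.1 (Metric.tendsto_nhds.1 h ε hε)
  simpa [not_lt] using this

/-- Linearization of the ratio defining the local linear estimator. -/
lemma tendsto_ratio_linearization {A M N p q : ℕ → Ω → ℝ} {α μ ν a b R : ℕ → ℝ} {f g : ℝ}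
    (hR : Tendsto R atTop atTop)
    (hA : IsBoundedInProb P fun n ω => R n * (A n ω - α n))
    (hM : IsBoundedInProb P fun n ω => R n * (M n ω - μ n))
    (hN : IsBoundedInProb P fun n ω => R n * (N n ω - ν n))
    (hp : IsBoundedInProb P fun n ω => R n * (p n ω - a n))
    (hq : IsBoundedInProb P fun n ω => R n * (q n ω - b n))
    (hα : Tendsto α atTop (𝓝 f)) (hμ : Tendsto μ atTop (𝓝 f)) (hν : Tendsto ν atTop (𝓝 g))
    (ha : Tendsto a atTop (𝓝 0)) (hb : Tendsto b atTop (𝓝 0)) (hf : f ≠ 0) :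
    Tendsto (fun z : ℕ × Ω =>
      R z.1 * ((A z.1 z.2 * N z.1 z.2 - p z.1 z.2 * q z.1 z.2) /
          (A z.1 z.2 * M z.1 z.2 - p z.1 z.2 ^ 2) -
        (α z.1 * ν z.1 - a z.1 * b z.1) / (α z.1 * μ z.1 - a z.1 ^ 2)) -
      (1 / f * (R z.1 * (N z.1 z.2 - ν z.1)) + -(g / f ^ 2) * (R z.1 * (M z.1 z.2 - μ z.1))))
      (probFilter P) (𝓝 0) := by
  set m : ℕ → ℝ := fun n => (α n * ν n - a n * b n) / (α n * μ n - a n ^ 2) with hm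
  have hff : f * f - 0 ^ 2 ≠ 0 := by simpa using hf
  have hδ : Tendsto (fun n => α n * μ n - a n ^ 2) atTop (𝓝 (f * f - 0 ^ 2)) :=
    (hα.mul hμ).sub (ha.pow 2)
  have hmlim : Tendsto m atTop (𝓝 (g / f)) := by
    have h := tendsto_fun_div ((hα.mul hν).sub (ha.mul hb)) hδ hff
    rwa [show (f * g - 0 * 0) / (f * f - 0 ^ 2) = g / f by grind] at h
  have lA := tendsto_of_isBoundedInProb hR hA hα
  have lM := tendsto_of_isBoundedInProb hR hM hμ
  have lp := tendsto_of_isBoundedInProb hR hp ha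
  have lq := tendsto_of_isBoundedInProb hR hq hb
  have lD := (lA.mul lM).sub (lp.pow 2)
  have lm : Tendsto (fun z : ℕ × Ω => m z.1) (probFilter P) (𝓝 (g / f)) :=
    hmlim.comp tendsto_fst_probFilter
  have lμ : Tendsto (fun z : ℕ × Ω => μ z.1) (probFilter P) (𝓝 f) :=
    hμ.comp tendsto_fst_probFilter
  have lν : Tendsto (fun z : ℕ × Ω => ν z.1) (probFilter P) (𝓝 g) :=
    hν.comp tendsto_fst_probFilter
  have la : Tendsto (fun z : ℕ × Ω => a z.1) (probFilter P) (𝓝 0) :=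
    ha.comp tendsto_fst_probFilter
  -- The error is exactly a combination of the five centred averages with random coefficients. Those
  -- of N and M tend to 1/f and −g/f²; those of A, p and q tend to 0, because A multiplies both
  -- numerator and denominator and p, q have vanishing means. `t1` to `t5` are what is left once the
  -- limits are removed.
  have t1 : Tendsto (fun z : ℕ × Ω => (A z.1 z.2 / (A z.1 z.2 * M z.1 z.2 - p z.1 z.2 ^ 2) - 1 / f)
      * (R z.1 * (N z.1 z.2 - ν z.1))) (probFilter P) (𝓝 0) := by
    refine tendsto_mul_of_isBoundedInProb (ξ := fun n ω =>
      A n ω / (A n ω * M n ω - p n ω ^ 2) - 1 / f)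
      (V := fun n ω => R n * (N n ω - ν n)) ?_ hN
    have h := (tendsto_fun_div lA lD hff).sub_const (1 / f)
    rwa [show f / (f * f - 0 ^ 2) - 1 / f = 0 by grind] at h
  have t2 : Tendsto (fun z : ℕ × Ω => (g / f ^ 2 -
      m z.1 * A z.1 z.2 / (A z.1 z.2 * M z.1 z.2 - p z.1 z.2 ^ 2))
      * (R z.1 * (M z.1 z.2 - μ z.1))) (probFilter P) (𝓝 0) := by
    refine tendsto_mul_of_isBoundedInProb (ξ := fun n ω =>
      g / f ^ 2 - m n * A n ω / (A n ω * M n ω - p n ω ^ 2))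
      (V := fun n ω => R n * (M n ω - μ n)) ?_ hM
    have h := (tendsto_fun_div (lm.mul lA) lD hff).const_sub (g / f ^ 2)
    rwa [show g / f ^ 2 - g / f * f / (f * f - 0 ^ 2) = 0 by grind] at h
  have t3 : Tendsto (fun z : ℕ × Ω => ((ν z.1 - m z.1 * μ z.1) /
      (A z.1 z.2 * M z.1 z.2 - p z.1 z.2 ^ 2))
      * (R z.1 * (A z.1 z.2 - α z.1))) (probFilter P) (𝓝 0) := by
    refine tendsto_mul_of_isBoundedInProb (ξ := fun n ω =>
      (ν n - m n * μ n) / (A n ω * M n ω - p n ω ^ 2))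
      (V := fun n ω => R n * (A n ω - α n)) ?_ hA
    have h := tendsto_fun_div (lν.sub (lm.mul lμ)) lD hff
    rwa [show (g - g / f * f) / (f * f - 0 ^ 2) = 0 by grind] at h
  have t4 : Tendsto (fun z : ℕ × Ω => ((q z.1 z.2 - m z.1 * p z.1 z.2 - a z.1 * m z.1) /
      (A z.1 z.2 * M z.1 z.2 - p z.1 z.2 ^ 2))
      * (R z.1 * (p z.1 z.2 - a z.1))) (probFilter P) (𝓝 0) := by
    refine tendsto_mul_of_isBoundedInProb (ξ := fun n ω =>
      (q n ω - m n * p n ω - a n * m n) / (A n ω * M n ω - p n ω ^ 2))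
      (V := fun n ω => R n * (p n ω - a n)) ?_ hp
    have h := tendsto_fun_div ((lq.sub (lm.mul lp)).sub (la.mul lm)) lD hff
    rwa [show (0 - g / f * 0 - 0 * (g / f)) / (f * f - 0 ^ 2) = 0 by simp] at h
  have t5 : Tendsto (fun z : ℕ × Ω => (a z.1 / (A z.1 z.2 * M z.1 z.2 - p z.1 z.2 ^ 2))
      * (R z.1 * (q z.1 z.2 - b z.1))) (probFilter P) (𝓝 0) := by
    refine tendsto_mul_of_isBoundedInProb (ξ := fun n ω =>
      a n / (A n ω * M n ω - p n ω ^ 2))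
      (V := fun n ω => R n * (q n ω - b n)) ?_ hq
    have h := tendsto_fun_div la lD hff
    rwa [zero_div] at h
  have t := (((t1.add t2).add t3).sub t4).sub t5
  simp only [add_zero, sub_zero] at t
  refine t.congr' ?_
  filter_upwards [lD.eventually_ne hff,
    (hδ.comp (tendsto_fst_probFilter (P := P))).eventually_ne hff] with z hD hδz
  -- The constant term of the expansion vanishes by the choice of m as the ratio of the means.
  have hz : α z.1 * (ν z.1 - m z.1 * μ z.1) - a z.1 * (b z.1 - m z.1 * a z.1) = 0 := by
    have : m z.1 * (α z.1 * μ z.1 - a z.1 ^ 2) = α z.1 * ν z.1 - a z.1 * b z.1 :=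
      div_mul_cancel₀ _ hδz
    linear_combination -this
  set D := A z.1 z.2 * M z.1 z.2 - p z.1 z.2 ^ 2 with hDdef
  have e : (A z.1 z.2 * N z.1 z.2 - p z.1 z.2 * q z.1 z.2) / D - m z.1 =
      (A z.1 z.2 * (N z.1 z.2 - ν z.1) - m z.1 * A z.1 z.2 * (M z.1 z.2 - μ z.1) +
        (ν z.1 - m z.1 * μ z.1) * (A z.1 z.2 - α z.1) -
        (q z.1 z.2 - m z.1 * p z.1 z.2 - a z.1 * m z.1) * (p z.1 z.2 - a z.1) -
        a z.1 * (q z.1 z.2 - b z.1)) / D := by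
    rw [eq_div_iff hD, sub_mul, div_mul_cancel₀ _ hD, hDdef]
    linear_combination hz
  rw [e]
  ring

end Probability

/-! ### Moments of the local weights -/

/-- The Gaussian-weighted moment `E[F T^j φ_ρ(T)]`. -/
def gaussMoment {Ω : Type*} [MeasurableSpace Ω] (P : Measure Ω) (F T : Ω → ℝ) (j : ℕ) (ρ : ℝ) : ℝ :=
  ∫ ω, F ω * (T ω ^ j * gauss ρ (T ω)) ∂P

@[fun_prop]
lemma measurable_linWeight (s h : ℝ) : Measurable (linWeight s h) := by
  unfold linWeight; fun_prop

@[fun_prop]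
lemma measurable_quadWeight (s h : ℝ) : Measurable (quadWeight s h) := by
  unfold quadWeight; fun_prop

section Transfer

variable {Ω : Type*} [MeasurableSpace Ω] {P : Measure Ω} [IsProbabilityMeasure P]
  {W : Ω → ℝ × ℝ} {U : Ω → ℝ} {σ2 : ℝ≥0}

lemma integrable_gauss_comp {α : Type*} [MeasurableSpace α] {μ : Measure α} [IsFiniteMeasure μ]
    {T : α → ℝ} (hT : Measurable T) {ρ : ℝ} (hρ : 0 ≤ ρ) :
    Integrable (fun ω => gauss ρ (T ω)) μ := by
  refine Integrable.of_bound (Measurable.aestronglyMeasurable (by fun_prop))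
    (√(2 * Real.pi * ρ))⁻¹ (ae_of_all _ fun ω => ?_)
  rw [Real.norm_of_nonneg (gauss_nonneg _ _)]
  exact gauss_le _ _ hρ

lemma map_prodMk_eq_prod_gaussian (hW : Measurable W) (hU : Measurable U) (hind : IndepFun W U P)
    (hlaw : P.map U = gaussianReal 0 σ2) :
    P.map (fun ω => (W ω, U ω)) = (P.map W).prod (gaussianReal 0 σ2) := by
  rw [← hlaw]
  exact (indepFun_iff_map_prod_eq_prod_map_map hW.aemeasurable hU.aemeasurable).1 hind

/-- Fubini over the independent measurement error. -/
lemma integral_mul_comp_add (hW : Measurable W) (hU : Measurable U) (hind : IndepFun W U P)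
    (hlaw : P.map U = gaussianReal 0 σ2) {F : ℝ × ℝ → ℝ} (hF : Measurable F) {ψ : ℝ → ℝ}
    (hψ : Measurable ψ) (hint : Integrable (fun ω => F (W ω) * ψ ((W ω).1 + U ω)) P) :
    ∫ ω, F (W ω) * ψ ((W ω).1 + U ω) ∂P =
      ∫ ω, F (W ω) * ∫ u, ψ ((W ω).1 + u) ∂(gaussianReal 0 σ2) ∂P := by
  set Φ : (ℝ × ℝ) × ℝ → ℝ := fun z => F z.1 * ψ (z.1.1 + z.2)
  have hΦ : Measurable Φ := by fun_prop
  have hm := map_prodMk_eq_prod_gaussian hW hU hind hlaw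
  have hWU : Measurable fun ω => (W ω, U ω) := by fun_prop
  have hprob : IsProbabilityMeasure (P.map W) := Measure.isProbabilityMeasure_map hW.aemeasurable
  have hint' : Integrable Φ ((P.map W).prod (gaussianReal 0 σ2)) := by
    rw [← hm]
    exact (integrable_map_measure hΦ.aestronglyMeasurable hWU.aemeasurable).2 hint
  have h1 : ∫ ω, F (W ω) * ψ ((W ω).1 + U ω) ∂P = ∫ z, Φ z ∂(P.map fun ω => (W ω, U ω)) :=
    (integral_map hWU.aemeasurable hΦ.aestronglyMeasurable).symm
  rw [h1, hm, integral_prod _ hint', integral_map hW.aemeasurable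
    hint'.aestronglyMeasurable.integral_prod_right']
  simp only [Φ, integral_const_mul]

/-- The density is nonnegative, so the inner integral of the norm is computed exactly and
integrability transfers with variance r + σ_u². -/
lemma integrable_mul_gauss_add (hW : Measurable W) (hU : Measurable U) (hind : IndepFun W U P)
    (hlaw : P.map U = gaussianReal 0 σ2) {F : ℝ × ℝ → ℝ} (hF : Measurable F) {r : ℝ} (hr : 0 < r)
    (hint : Integrable (fun ω => F (W ω) * gauss (r + σ2) (W ω).1) P) :
    Integrable (fun ω => F (W ω) * gauss r ((W ω).1 + U ω)) P := by
  set Φ : (ℝ × ℝ) × ℝ → ℝ := fun z => F z.1 * gauss r (z.1.1 + z.2)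
  have hΦ : Measurable Φ := by fun_prop
  have hm := map_prodMk_eq_prod_gaussian hW hU hind hlaw
  have hWU : Measurable fun ω => (W ω, U ω) := by fun_prop
  have hprob : IsProbabilityMeasure (P.map W) := Measure.isProbabilityMeasure_map hW.aemeasurable
  have hg : ∀ a : ℝ, Integrable (fun u => gauss r (a + u)) (gaussianReal 0 σ2) := fun a =>
    integrable_gauss_comp (by fun_prop) hr.le
  have h1 : Integrable Φ (P.map fun ω => (W ω, U ω)) := by
    rw [hm, integrable_prod_iff hΦ.aestronglyMeasurable]
    refine ⟨ae_of_all _ fun w => (hg w.1).const_mul (F w), ?_⟩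
    have e : ∀ w : ℝ × ℝ, ∫ u, ‖Φ (w, u)‖ ∂(gaussianReal 0 σ2) =
        ‖F w * gauss (r + σ2) w.1‖ := fun w => by
      simp only [Φ, norm_mul, Real.norm_of_nonneg (gauss_nonneg _ _)]
      rw [integral_const_mul, integral_gauss_add _ hr]
    simp only [e]
    exact ((integrable_map_measure (f := W) (g := fun w => F w * gauss (r + σ2) w.1)
      (Measurable.aestronglyMeasurable (by fun_prop)) hW.aemeasurable).2 hint).norm
  exact (integrable_map_measure hΦ.aestronglyMeasurable hWU.aemeasurable).1 h1

lemma integral_mul_gauss_add (hW : Measurable W) (hU : Measurable U) (hind : IndepFun W U P)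
    (hlaw : P.map U = gaussianReal 0 σ2) {F : ℝ × ℝ → ℝ} (hF : Measurable F) {r : ℝ} (hr : 0 < r)
    (hint : Integrable (fun ω => F (W ω) * gauss (r + σ2) (W ω).1) P) :
    ∫ ω, F (W ω) * gauss r ((W ω).1 + U ω) ∂P = ∫ ω, F (W ω) * gauss (r + σ2) (W ω).1 ∂P := by
  rw [integral_mul_comp_add hW hU hind hlaw hF (measurable_gauss r)
    (integrable_mul_gauss_add hW hU hind hlaw hF hr hint)]
  simp only [integral_gauss_add _ hr]

lemma integral_mul_linWeight (hW : Measurable W) (hU : Measurable U) (hind : IndepFun W U P)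
    (hlaw : P.map U = gaussianReal 0 σ2) {F : ℝ × ℝ → ℝ} (hF : Measurable F) {s h : ℝ}
    (hs : 0 ≤ s) (hh : 0 < h)
    (hint : Integrable (fun ω => F (W ω) * linWeight s h ((W ω).1 + U ω)) P) :
    ∫ ω, F (W ω) * linWeight s h ((W ω).1 + U ω) ∂P =
      h / (s + h ^ 2 + σ2) *
        gaussMoment P (fun ω => F (W ω)) (fun ω => (W ω).1) 1 (s + h ^ 2 + σ2) := by
  have hr : 0 < s + h ^ 2 := by positivity
  rw [integral_mul_comp_add hW hU hind hlaw hF (by fun_prop) hint, gaussMoment,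
    ← integral_const_mul]
  refine integral_congr_ae (ae_of_all _ fun ω => ?_)
  simp only [linWeight, mul_assoc]
  rw [integral_const_mul, integral_id_mul_gauss_add _ hr]
  field_simp

/-- With r = s + h², the conditional variance contributes h²σ_u²/(r(r + σ_u²)); added to s/r it
gives 1 − h²/(r + σ_u²). -/
lemma integral_quadWeight (hW : Measurable W) (hU : Measurable U) (hind : IndepFun W U P)
    (hlaw : P.map U = gaussianReal 0 σ2) {s h : ℝ} (hs : 0 ≤ s) (hh : 0 < h) (hσ : 0 < σ2)
    (hint : Integrable (fun ω => quadWeight s h ((W ω).1 + U ω)) P) :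
    ∫ ω, quadWeight s h ((W ω).1 + U ω) ∂P =
      (1 - h ^ 2 / (s + h ^ 2 + σ2)) *
        gaussMoment P (fun _ => 1) (fun ω => (W ω).1) 0 (s + h ^ 2 + σ2) +
      h ^ 2 / (s + h ^ 2 + σ2) ^ 2 *
        gaussMoment P (fun _ => 1) (fun ω => (W ω).1) 2 (s + h ^ 2 + σ2) := by
  have hr : 0 < s + h ^ 2 := by positivity
  have hσ' : (0 : ℝ) < σ2 := NNReal.coe_pos.2 hσ
  have h1 := integral_mul_comp_add hW hU hind hlaw (F := fun _ => 1) (by fun_prop)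
    (ψ := quadWeight s h) (by fun_prop) (by simpa using hint)
  simp only [one_mul] at h1
  have hb : Measurable fun ω => (W ω).1 := by fun_prop
  have hρ : 0 < s + h ^ 2 + σ2 := by positivity
  have hi : ∀ j : ℕ, Integrable (fun ω => (1 : ℝ) * ((W ω).1 ^ j * gauss (s + h ^ 2 + σ2) (W ω).1))
      P := fun j =>
    integrable_mul_pow_gauss (ρ' := s + h ^ 2 + σ2 + 1) (by fun_prop) hb
      (by
        simp only [one_mul]
        exact integrable_gauss_comp hb (by positivity)) j hρ (by linarith)
  rw [h1, gaussMoment, gaussMoment, ← integral_const_mul, ← integral_const_mul,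
    ← integral_add ((hi 0).const_mul _) ((hi 2).const_mul _)]
  refine integral_congr_ae (ae_of_all _ fun ω => ?_)
  simp only
  generalize (W ω).1 = a
  have e : ∀ u, quadWeight s h (a + u) = s / (s + h ^ 2) * gauss (s + h ^ 2) (a + u) +
      h ^ 2 / (s + h ^ 2) ^ 2 * ((a + u) ^ 2 * gauss (s + h ^ 2) (a + u)) := fun u => by
    rw [quadWeight]; ring
  have i1 : Integrable (fun u => gauss (s + h ^ 2) (a + u)) (gaussianReal 0 σ2) :=
    integrable_gauss_comp (by fun_prop) hr.le
  have i2 : Integrable (fun u => (a + u) ^ 2 * gauss (s + h ^ 2) (a + u)) (gaussianReal 0 σ2) := by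
    obtain ⟨C, hC, hb⟩ := exists_pow_mul_gauss_le 2 hr (lt_add_one (s + h ^ 2)) le_rfl
    refine Integrable.of_bound (Measurable.aestronglyMeasurable (by fun_prop))
      (C * (√(2 * Real.pi * (s + h ^ 2 + 1)))⁻¹)
      (ae_of_all _ fun u => ?_)
    rw [Real.norm_of_nonneg (mul_nonneg (sq_nonneg _) (gauss_nonneg _ _)), ← sq_abs]
    refine (hb _ (by simp) _).trans ?_
    gcongr
    exact gauss_le _ _ (by positivity)
  simp only [e]
  rw [integral_add (i1.const_mul _) (i2.const_mul _), integral_const_mul, integral_const_mul,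
    integral_gauss_add _ hr, integral_sq_mul_gauss_add _ hr]
  field_simp
  ring

end Transfer

/-! ### Averages over the sample -/

/-- Variances of independent summands add, and a variance is at most the second moment. -/
lemma integral_sq_average_sub_le {Ω S : Type*} [MeasurableSpace Ω] [MeasurableSpace S]
    {P : Measure Ω} [IsProbabilityMeasure P] {V : ℕ → Ω → S} (hindep : iIndepFun V P)
    (hident : ∀ i, IdentDistrib (V i) (V 0) P P) {φ : S → ℝ} (hφ : Measurable φ)
    (hL2 : MemLp (fun ω => φ (V 0 ω)) 2 P) {n : ℕ} (hn : 0 < n) :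
    Integrable (fun ω => ((n : ℝ)⁻¹ * ∑ i ∈ Finset.range n, φ (V i ω) -
      ∫ ω, φ (V 0 ω) ∂P) ^ 2) P ∧
    ∫ ω, ((n : ℝ)⁻¹ * ∑ i ∈ Finset.range n, φ (V i ω) - ∫ ω, φ (V 0 ω) ∂P) ^ 2 ∂P ≤
      (n : ℝ)⁻¹ * ∫ ω, φ (V 0 ω) ^ 2 ∂P := by
  have hn' : (0 : ℝ) < n := by exact_mod_cast hn
  have hid : ∀ i, IdentDistrib (fun ω => φ (V i ω)) (fun ω => φ (V 0 ω)) P P := fun i =>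
    (hident i).comp hφ
  have hL : ∀ i, MemLp (fun ω => φ (V i ω)) 2 P := fun i => (hid i).memLp_iff.2 hL2
  have hsum : MemLp (fun ω => ∑ i ∈ Finset.range n, φ (V i ω)) 2 P :=
    memLp_finsetSum _ fun i _ => hL i
  have hav : MemLp (fun ω => (n : ℝ)⁻¹ * ∑ i ∈ Finset.range n, φ (V i ω)) 2 P :=
    hsum.const_mul _
  have hmean : ∫ ω, (n : ℝ)⁻¹ * ∑ i ∈ Finset.range n, φ (V i ω) ∂P = ∫ ω, φ (V 0 ω) ∂P := by
    rw [integral_const_mul, integral_finsetSum _ fun i _ => (hL i).integrable (by norm_num),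
      Finset.sum_congr rfl fun i _ => (hid i).integral_eq]
    simp [hn'.ne']
  refine ⟨(hav.sub (memLp_const _)).integrable_sq, ?_⟩
  have hvar : ∫ ω, ((n : ℝ)⁻¹ * ∑ i ∈ Finset.range n, φ (V i ω) - ∫ ω, φ (V 0 ω) ∂P) ^ 2 ∂P =
      Var[fun ω => (n : ℝ)⁻¹ * ∑ i ∈ Finset.range n, φ (V i ω); P] := by
    rw [variance_eq_integral hav.aestronglyMeasurable.aemeasurable, hmean]
  have hvs : Var[fun ω => ∑ i ∈ Finset.range n, φ (V i ω); P] =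
      ∑ i ∈ Finset.range n, Var[fun ω => φ (V i ω); P] := by
    have := IndepFun.variance_sum (μ := P) (X := fun i ω => φ (V i ω)) (s := Finset.range n)
      (fun i _ => hL i) fun i _ j _ hij => (hindep.indepFun hij).comp hφ hφ
    rw [← this]
    congr 1
    ext ω
    simp
  rw [hvar, variance_const_mul, hvs, Finset.sum_congr rfl fun i _ => (hid i).variance_eq]
  have h1 : Var[fun ω => φ (V 0 ω); P] ≤ ∫ ω, φ (V 0 ω) ^ 2 ∂P := by
    simpa using variance_le_expectation_sq (μ := P) hL2.aestronglyMeasurable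
  simp only [Finset.sum_const, Finset.card_range, nsmul_eq_mul]
  calc ((n : ℝ)⁻¹) ^ 2 * (n * Var[fun ω => φ (V 0 ω); P])
      = (n : ℝ)⁻¹ * Var[fun ω => φ (V 0 ω); P] := by field_simp
    _ ≤ _ := by gcongr

/-- An i.i.d. sample `((T i, Y i), U i)` with normal errors `U i` independent of `(T i, Y i)` and
a Gaussian-weighted second moment of `Y`. -/
structure IsSample {Ω : Type*} [MeasurableSpace Ω] (P : Measure Ω) (T Y U : ℕ → Ω → ℝ)
    (σ2 : ℝ≥0) (ρ' : ℝ) : Prop where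
  measurable_T : ∀ i, Measurable (T i)
  measurable_Y : ∀ i, Measurable (Y i)
  measurable_U : ∀ i, Measurable (U i)
  indep : iIndepFun (fun i ω => ((T i ω, Y i ω), U i ω)) P
  identDistrib : ∀ i, IdentDistrib (fun ω => ((T i ω, Y i ω), U i ω))
    (fun ω => ((T 0 ω, Y 0 ω), U 0 ω)) P P
  law_U : P.map (U 0) = gaussianReal 0 σ2
  indep_U : IndepFun (fun ω => (T 0 ω, Y 0 ω)) (U 0) P
  integrable_sq : Integrable (fun ω => Y 0 ω ^ 2 * gauss ρ' (T 0 ω)) P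
  var_pos : 0 < σ2

namespace IsSample

variable {Ω : Type*} [MeasurableSpace Ω] {P : Measure Ω}
  {T Y U : ℕ → Ω → ℝ} {σ2 : ℝ≥0} {ρ' : ℝ}

lemma measurable_W (hS : IsSample P T Y U σ2 ρ') : Measurable fun ω => (T 0 ω, Y 0 ω) :=
  (hS.measurable_T 0).prodMk (hS.measurable_Y 0)

variable [IsProbabilityMeasure P]

/-- Squaring turns φ_r into r^(-1/2) φ_{θr} with θ just above 1/2, and averaging over U gives
variance θr + σ_u², which is below ρ' for small h. The factor r^(-1/2) is 1/h when s = 0 and bounded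
when s > 0: this is the origin of the two rates. -/
lemma exists_scaled_second_moment_le (hS : IsSample P T Y U σ2 ρ') {F : ℝ → ℝ}
    (hF : Measurable F) (hint : Integrable (fun ω => F (Y 0 ω) ^ 2 * gauss ρ' (T 0 ω)) P)
    {s : ℝ} (hs : 0 ≤ s) (hρ : s / 2 + σ2 < ρ') (j : ℕ) :
    ∃ C, 0 ≤ C ∧ ∀ᶠ h : ℝ in 𝓝[>] 0,
      Integrable (fun ω => (F (Y 0 ω) * ((|T 0 ω + U 0 ω| / √(s + h ^ 2)) ^ j *
        gauss (s + h ^ 2) (T 0 ω + U 0 ω))) ^ 2) P ∧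
      ∫ ω, (F (Y 0 ω) * ((|T 0 ω + U 0 ω| / √(s + h ^ 2)) ^ j *
        gauss (s + h ^ 2) (T 0 ω + U 0 ω))) ^ 2 ∂P ≤ C / √(s + h ^ 2) := by
  have hσ : (0 : ℝ) < σ2 := NNReal.coe_pos.2 hS.var_pos
  have mT := hS.measurable_T 0
  have mY := hS.measurable_Y 0
  have mU := hS.measurable_U 0
  obtain ⟨θ, hθ, hθρ⟩ : ∃ θ : ℝ, 1 / 2 < θ ∧ θ * s + σ2 < ρ' := by
    have hc : Tendsto (fun θ : ℝ => θ * s + σ2) (𝓝[>] (1 / 2)) (𝓝 (1 / 2 * s + σ2)) :=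
      ((continuous_id.mul continuous_const).add continuous_const).continuousWithinAt
    have := (hc.eventually (Iio_mem_nhds (show 1 / 2 * s + (σ2 : ℝ) < ρ' by linarith))).and
      self_mem_nhdsWithin
    obtain ⟨θ, h1, h2⟩ := this.exists
    exact ⟨θ, h2, h1⟩
  have hθ0 : 0 < θ := by linarith
  obtain ⟨ρb, hb, hb'⟩ := exists_between hθρ
  have hθs : 0 ≤ θ * s := by positivity
  obtain ⟨C₁, hC₁, h₁⟩ := exists_scaled_sq_gauss_le j hθ
  obtain ⟨C₂, hC₂, h₂⟩ := exists_pow_mul_gauss_le 0 hσ hb' (by linarith)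
  refine ⟨C₁ * (C₂ * ∫ ω, F (Y 0 ω) ^ 2 * gauss ρ' (T 0 ω) ∂P),
    mul_nonneg hC₁.le (mul_nonneg hC₂.le (integral_nonneg fun ω =>
      mul_nonneg (sq_nonneg _) (gauss_nonneg _ _))), ?_⟩
  have hev : ∀ᶠ h : ℝ in 𝓝[>] 0, θ * (s + h ^ 2) + σ2 < ρb := by
    have hc : Tendsto (fun h : ℝ => θ * (s + h ^ 2) + σ2) (𝓝[>] 0) (𝓝 (θ * (s + 0 ^ 2) + σ2)) :=
      (Continuous.continuousWithinAt (by fun_prop))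
    exact hc.eventually (Iio_mem_nhds (by simpa using hb))
  filter_upwards [hev, self_mem_nhdsWithin] with h hh hpos
  have hpos' : 0 < h := hpos
  set r := s + h ^ 2 with hr
  have hr0 : 0 < r := by positivity
  have hθr : 0 < θ * r := by positivity
  have hle : ∀ ω, F (Y 0 ω) ^ 2 * gauss (θ * r + σ2) (T 0 ω) ≤
      C₂ * (F (Y 0 ω) ^ 2 * gauss ρ' (T 0 ω)) := fun ω => by
    have := h₂ (θ * r + σ2) ⟨by linarith, hh.le⟩ (T 0 ω)
    rw [pow_zero, one_mul] at this
    calc _ ≤ F (Y 0 ω) ^ 2 * (C₂ * gauss ρ' (T 0 ω)) := by gcongr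
      _ = _ := by ring
  have hi : Integrable (fun ω => F (Y 0 ω) ^ 2 * gauss (θ * r + σ2) (T 0 ω)) P := by
    refine (hint.const_mul C₂).mono' (Measurable.aestronglyMeasurable (by fun_prop))
      (ae_of_all _ fun ω => ?_)
    rw [Real.norm_of_nonneg (mul_nonneg (sq_nonneg _) (gauss_nonneg _ _))]
    exact hle ω
  have hi' := integrable_mul_gauss_add hS.measurable_W mU hS.indep_U hS.law_U
    (F := fun w => F w.2 ^ 2) (by fun_prop) hθr hi
  have he := integral_mul_gauss_add hS.measurable_W mU hS.indep_U hS.law_U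
    (F := fun w => F w.2 ^ 2) (by fun_prop) hθr hi
  simp only at hi' he
  have hpt : ∀ ω, (F (Y 0 ω) * ((|T 0 ω + U 0 ω| / √r) ^ j * gauss r (T 0 ω + U 0 ω))) ^ 2 ≤
      C₁ * (√r)⁻¹ * (F (Y 0 ω) ^ 2 * gauss (θ * r) (T 0 ω + U 0 ω)) := fun ω => by
    rw [mul_pow]
    calc _ ≤ F (Y 0 ω) ^ 2 * (C₁ * ((√r)⁻¹ * gauss (θ * r) (T 0 ω + U 0 ω))) := by
          have := h₁ r hr0 (T 0 ω + U 0 ω)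
          gcongr
      _ = _ := by ring
  have hI : Integrable (fun ω => (F (Y 0 ω) * ((|T 0 ω + U 0 ω| / √r) ^ j *
        gauss r (T 0 ω + U 0 ω))) ^ 2) P := by
    refine (hi'.const_mul (C₁ * (√r)⁻¹)).mono' (Measurable.aestronglyMeasurable (by fun_prop))
      (ae_of_all _ fun ω => ?_)
    rw [Real.norm_of_nonneg (sq_nonneg _)]
    exact hpt ω
  refine ⟨hI, ?_⟩
  calc _ ≤ ∫ ω, C₁ * (√r)⁻¹ * (F (Y 0 ω) ^ 2 * gauss (θ * r) (T 0 ω + U 0 ω)) ∂P :=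
        integral_mono hI (hi'.const_mul _) hpt
    _ = C₁ * (√r)⁻¹ * ∫ ω, F (Y 0 ω) ^ 2 * gauss (θ * r + σ2) (T 0 ω) ∂P := by
        rw [integral_const_mul, he]
    _ ≤ C₁ * (√r)⁻¹ * ∫ ω, C₂ * (F (Y 0 ω) ^ 2 * gauss ρ' (T 0 ω)) ∂P := by
        exact mul_le_mul_of_nonneg_left (integral_mono hi (hint.const_mul _) hle) (by positivity)
    _ = _ := by rw [integral_const_mul, div_eq_mul_inv]; ring

/-- Second moments of weights dominated by `(1 + a²/r) φ_r(a)`, where `r = s + h²`. -/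
lemma exists_weight_second_moment_le (hS : IsSample P T Y U σ2 ρ') {F : ℝ → ℝ}
    (hF : Measurable F) (hint : Integrable (fun ω => F (Y 0 ω) ^ 2 * gauss ρ' (T 0 ω)) P)
    {s : ℝ} (hs : 0 ≤ s) (hρ : s / 2 + σ2 < ρ') {χ : ℝ → ℝ → ℝ} (hχ : ∀ h, Measurable (χ h))
    (hle : ∀ h, 0 < h → ∀ a, |χ h a| ≤ (1 + (|a| / √(s + h ^ 2)) ^ 2) * gauss (s + h ^ 2) a) :
    ∃ C, 0 ≤ C ∧ ∀ᶠ h : ℝ in 𝓝[>] 0,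
      MemLp (fun ω => F (Y 0 ω) * χ h (T 0 ω + U 0 ω)) 2 P ∧
      ∫ ω, (F (Y 0 ω) * χ h (T 0 ω + U 0 ω)) ^ 2 ∂P ≤ C / √(s + h ^ 2) := by
  obtain ⟨C₀, hC₀, h₀⟩ := hS.exists_scaled_second_moment_le hF hint hs hρ 0
  obtain ⟨C₂, hC₂, h₂⟩ := hS.exists_scaled_second_moment_le hF hint hs hρ 2
  have mT := hS.measurable_T 0
  have mY := hS.measurable_Y 0
  have mU := hS.measurable_U 0
  refine ⟨2 * C₀ + 2 * C₂, by positivity, ?_⟩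
  filter_upwards [h₀, h₂, self_mem_nhdsWithin] with h h0 h2 hpos
  have hpt : ∀ ω, (F (Y 0 ω) * χ h (T 0 ω + U 0 ω)) ^ 2 ≤
      2 * (F (Y 0 ω) * ((|T 0 ω + U 0 ω| / √(s + h ^ 2)) ^ 0 *
        gauss (s + h ^ 2) (T 0 ω + U 0 ω))) ^ 2 +
      2 * (F (Y 0 ω) * ((|T 0 ω + U 0 ω| / √(s + h ^ 2)) ^ 2 *
        gauss (s + h ^ 2) (T 0 ω + U 0 ω))) ^ 2 := fun ω => by
    set a := T 0 ω + U 0 ω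
    set y := F (Y 0 ω)
    set b := (|a| / √(s + h ^ 2)) ^ 2
    set γ := gauss (s + h ^ 2) a
    have h1 : χ h a ^ 2 ≤ ((1 + b) * γ) ^ 2 := sq_le_sq' (by linarith [(abs_le.1 (hle h hpos a)).1])
      (abs_le.1 (hle h hpos a)).2
    calc (y * χ h a) ^ 2 = y ^ 2 * χ h a ^ 2 := by ring
      _ ≤ y ^ 2 * ((1 + b) * γ) ^ 2 := by gcongr
      _ ≤ _ := by nlinarith [sq_nonneg (y * γ * (1 - b))]
  have hI := (h0.1.const_mul 2).add (h2.1.const_mul 2)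
  have hm : Measurable fun ω => F (Y 0 ω) * χ h (T 0 ω + U 0 ω) :=
    (hF.comp mY).mul ((hχ h).comp (mT.add mU))
  have hI' : Integrable (fun ω => (F (Y 0 ω) * χ h (T 0 ω + U 0 ω)) ^ 2) P := by
    refine hI.mono' (hm.pow_const 2).aestronglyMeasurable (ae_of_all _ fun ω => ?_)
    rw [Real.norm_of_nonneg (sq_nonneg _)]
    exact hpt ω
  refine ⟨(memLp_two_iff_integrable_sq hm.aestronglyMeasurable).2 hI', ?_⟩
  refine (integral_mono hI' hI hpt).trans ?_
  rw [integral_add' (h0.1.const_mul 2) (h2.1.const_mul 2), integral_const_mul, integral_const_mul]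
  have := h0.2
  have := h2.2
  rw [add_div, mul_div_assoc, mul_div_assoc]
  linarith

/-- The variance of the average is of order 1/(n√(s + h²)), exactly what R² compensates. -/
lemma isBoundedInProb_avg (hS : IsSample P T Y U σ2 ρ') {F : ℝ → ℝ}
    (hF : Measurable F) (hint : Integrable (fun ω => F (Y 0 ω) ^ 2 * gauss ρ' (T 0 ω)) P)
    {s : ℝ} (hs : 0 ≤ s) (hρ : s / 2 + σ2 < ρ') {χ : ℝ → ℝ → ℝ} (hχ : ∀ h, Measurable (χ h))
    (hle : ∀ h, 0 < h → ∀ a, |χ h a| ≤ (1 + (|a| / √(s + h ^ 2)) ^ 2) * gauss (s + h ^ 2) a)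
    {h : ℕ → ℝ} (hh : IsBandwidth h) {R : ℕ → ℝ} {D : ℝ}
    (hR : ∀ n, R n ^ 2 ≤ D * (n * √(s + h n ^ 2))) :
    IsBoundedInProb P fun n ω => R n * (avg n (fun i => T i ω + U i ω) (fun i => Y i ω)
      (fun y a => F y * χ (h n) a) - ∫ ω, F (Y 0 ω) * χ (h n) (T 0 ω + U 0 ω) ∂P) := by
  obtain ⟨C, hC, hev⟩ := hS.exists_weight_second_moment_le hF hint hs hρ hχ hle
  have hlim : Tendsto h atTop (𝓝[>] 0) :=
    tendsto_nhdsWithin_iff.2 ⟨hh.tendsto_zero, Eventually.of_forall hh.pos⟩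
  refine isBoundedInProb_of_integral_sq_le (C := D * C) ?_
  filter_upwards [hlim.eventually hev, eventually_gt_atTop 0] with n hn hn0
  have hn' : (0 : ℝ) < n := by exact_mod_cast hn0
  have hφ : Measurable fun z : (ℝ × ℝ) × ℝ => F z.1.2 * χ (h n) (z.1.1 + z.2) :=
    (hF.comp (by fun_prop)).mul ((hχ _).comp (by fun_prop))
  have key := integral_sq_average_sub_le hS.indep hS.identDistrib hφ hn.1 hn0
  have hpos := hh.pos n
  have hr : 0 < √(s + h n ^ 2) := Real.sqrt_pos.2 (by positivity)
  simp only [avg, mul_pow]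
  refine ⟨key.1.const_mul _, ?_⟩
  rw [integral_const_mul]
  calc _ ≤ D * (n * √(s + h n ^ 2)) * ((n : ℝ)⁻¹ * (C / √(s + h n ^ 2))) := by
        refine mul_le_mul (hR n) (key.2.trans ?_) (integral_nonneg fun _ => sq_nonneg _)
          ((sq_nonneg _).trans (hR n))
        have := hn.2
        gcongr
    _ = D * C := by field_simp

end IsSample

/-! ### Centering and bias -/

/-- The ratio of the expected local moments of the estimator, as a function of `u = h²`;
here `ρ = (1 + λ)σ_u²`. -/
def centering {Ω : Type*} [MeasurableSpace Ω] (P : Measure Ω) (T Y : Ω → ℝ) (ρ u : ℝ) : ℝ :=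
  (((1 - u / (ρ + u)) * gaussMoment P (fun _ => 1) T 0 (ρ + u) +
        u / (ρ + u) ^ 2 * gaussMoment P (fun _ => 1) T 2 (ρ + u)) * gaussMoment P Y T 0 (ρ + u) -
      u / (ρ + u) ^ 2 * (gaussMoment P (fun _ => 1) T 1 (ρ + u) * gaussMoment P Y T 1 (ρ + u))) /
    (((1 - u / (ρ + u)) * gaussMoment P (fun _ => 1) T 0 (ρ + u) +
        u / (ρ + u) ^ 2 * gaussMoment P (fun _ => 1) T 2 (ρ + u)) *
          gaussMoment P (fun _ => 1) T 0 (ρ + u) -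
      u / (ρ + u) ^ 2 * gaussMoment P (fun _ => 1) T 1 (ρ + u) ^ 2)

/-- The first bracket multiplies both k0 and e0, so its own variation cancels to first order, and e2
with it. What remains is the derivative of k0/e0 and the term from e1 and k1. -/
lemma hasDerivAt_ratio {e0 e1 e2 k0 k1 : ℝ → ℝ} {ρ e0' e1' e2' k0' k1' : ℝ} (hρ : 0 < ρ)
    (h0 : HasDerivAt e0 e0' ρ) (h1 : HasDerivAt e1 e1' ρ) (h2 : HasDerivAt e2 e2' ρ)
    (hk0 : HasDerivAt k0 k0' ρ) (hk1 : HasDerivAt k1 k1' ρ) (hne : e0 ρ ≠ 0) :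
    HasDerivAt (fun u => (((1 - u / (ρ + u)) * e0 (ρ + u) + u / (ρ + u) ^ 2 * e2 (ρ + u)) *
          k0 (ρ + u) - u / (ρ + u) ^ 2 * (e1 (ρ + u) * k1 (ρ + u))) /
        (((1 - u / (ρ + u)) * e0 (ρ + u) + u / (ρ + u) ^ 2 * e2 (ρ + u)) * e0 (ρ + u) -
          u / (ρ + u) ^ 2 * e1 (ρ + u) ^ 2))
      ((e0 ρ * k0' - e0' * k0 ρ) / e0 ρ ^ 2 +
        e1 ρ * (k0 ρ * e1 ρ - e0 ρ * k1 ρ) / (ρ ^ 2 * e0 ρ ^ 3)) 0 := by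
  have hid : HasDerivAt (fun u => ρ + u) 1 0 := by simpa using (hasDerivAt_id (0 : ℝ)).const_add ρ
  have c0 : HasDerivAt (fun u => e0 (ρ + u)) e0' 0 :=
    HasDerivAt.comp_const_add (f := e0) ρ 0 (by rwa [add_zero])
  have c1 : HasDerivAt (fun u => e1 (ρ + u)) e1' 0 :=
    HasDerivAt.comp_const_add (f := e1) ρ 0 (by rwa [add_zero])
  have c2 : HasDerivAt (fun u => e2 (ρ + u)) e2' 0 :=
    HasDerivAt.comp_const_add (f := e2) ρ 0 (by rwa [add_zero])
  have d0 : HasDerivAt (fun u => k0 (ρ + u)) k0' 0 :=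
    HasDerivAt.comp_const_add (f := k0) ρ 0 (by rwa [add_zero])
  have d1 : HasDerivAt (fun u => k1 (ρ + u)) k1' 0 :=
    HasDerivAt.comp_const_add (f := k1) ρ 0 (by rwa [add_zero])
  have q1 : HasDerivAt (fun u => u / (ρ + u)) (1 / ρ) 0 :=
    ((hasDerivAt_id (0 : ℝ)).fun_div hid (by simpa using hρ.ne')).congr_deriv (by
      simp; field_simp)
  have q2 : HasDerivAt (fun u => u / (ρ + u) ^ 2) (1 / ρ ^ 2) 0 :=
    ((hasDerivAt_id (0 : ℝ)).fun_div (hid.fun_pow 2) (by simpa using hρ.ne')).congr_deriv (by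
      simp; field_simp)
  have a := ((q1.const_sub 1).fun_mul c0).fun_add (q2.fun_mul c2)
  have num := (a.fun_mul d0).fun_sub (q2.fun_mul (c1.fun_mul d1))
  have den := (a.fun_mul c0).fun_sub (q2.fun_mul (c1.fun_pow 2))
  refine (num.fun_div den (by simpa using hne)).congr_deriv ?_
  simp
  field_simp
  ring

section

variable {Ω : Type*} [MeasurableSpace Ω] {P : Measure Ω} {F T : Ω → ℝ}

/-- The derivative of `ρ ↦ E[F φ_ρ(T)]`. -/
def gaussMomentDeriv (P : Measure Ω) (F T : Ω → ℝ) (ρ : ℝ) : ℝ :=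
  ∫ ω, F ω * ((T ω ^ 2 / ρ ^ 2 - 1 / ρ) / 2 * gauss ρ (T ω)) ∂P

lemma hasDerivAt_gaussMoment_zero (hF : Measurable F) (hT : Measurable T) {ρ ρ' : ℝ}
    (hint : Integrable (fun ω => F ω * gauss ρ' (T ω)) P) (hρ : 0 < ρ) (hρ' : ρ < ρ') :
    HasDerivAt (gaussMoment P F T 0) (gaussMomentDeriv P F T ρ) ρ := by
  refine (hasDerivAt_integral_pow_gauss_var hF hT hint 0 hρ hρ').congr_deriv ?_
  simp [gaussMomentDeriv]

lemma differentiableAt_gaussMoment (hF : Measurable F) (hT : Measurable T) {ρ ρ' : ℝ}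
    (hint : Integrable (fun ω => F ω * gauss ρ' (T ω)) P) (j : ℕ) (hρ : 0 < ρ) (hρ' : ρ < ρ') :
    DifferentiableAt ℝ (gaussMoment P F T j) ρ :=
  (hasDerivAt_integral_pow_gauss_var hF hT hint j hρ hρ').differentiableAt

/-- The bias coefficient in terms of Gaussian-weighted moments. -/
def momentBias (P : Measure Ω) (T Y : Ω → ℝ) (ρ : ℝ) : ℝ :=
  (gaussMoment P (fun _ => 1) T 0 ρ * gaussMomentDeriv P Y T ρ -
      gaussMomentDeriv P (fun _ => 1) T ρ * gaussMoment P Y T 0 ρ) /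
      gaussMoment P (fun _ => 1) T 0 ρ ^ 2 +
    gaussMoment P (fun _ => 1) T 1 ρ * (gaussMoment P Y T 0 ρ * gaussMoment P (fun _ => 1) T 1 ρ -
      gaussMoment P (fun _ => 1) T 0 ρ * gaussMoment P Y T 1 ρ) /
      (ρ ^ 2 * gaussMoment P (fun _ => 1) T 0 ρ ^ 3)

variable [IsProbabilityMeasure P]

lemma gaussMoment_one_pos (hT : Measurable T) {ρ : ℝ} (hρ : 0 < ρ) :
    0 < gaussMoment P (fun _ => 1) T 0 ρ := by
  simp only [gaussMoment, pow_zero, one_mul]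
  rw [integral_pos_iff_support_of_nonneg (fun _ => gauss_nonneg _ _)
    (integrable_gauss_comp hT hρ.le)]
  have : Function.support (fun ω => gauss ρ (T ω)) = Set.univ :=
    Set.eq_univ_of_forall fun ω => (gauss_pos hρ _).ne'
  simp [this]

lemma integrable_one_mul_gauss (hT : Measurable T) {ρ : ℝ} (hρ : 0 ≤ ρ) :
    Integrable (fun ω => (1 : ℝ) * gauss ρ (T ω)) P := by
  simpa using integrable_gauss_comp (μ := P) hT hρ

/-- Differentiability at u = 0, read along u = h². -/
lemma centering_isLittleO {Y : Ω → ℝ} (hY : Measurable Y) (hT : Measurable T) {ρ ρ' : ℝ}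
    (hint : Integrable (fun ω => Y ω * gauss ρ' (T ω)) P) (hρ : 0 < ρ) (hρ' : ρ < ρ')
    {h : ℕ → ℝ} (hh : Tendsto h atTop (𝓝 0)) :
    (fun n => gaussMoment P Y T 0 ρ / gaussMoment P (fun _ => 1) T 0 ρ +
      h n ^ 2 * momentBias P T Y ρ - centering P T Y ρ (h n ^ 2)) =o[atTop] fun n => h n ^ 2 := by
  have hone := integrable_one_mul_gauss (P := P) hT (hρ.trans hρ').le
  have hpos := gaussMoment_one_pos (P := P) hT hρ
  have hd := hasDerivAt_ratio hρ (hasDerivAt_gaussMoment_zero measurable_const hT hone hρ hρ')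
    (differentiableAt_gaussMoment measurable_const hT hone 1 hρ hρ').hasDerivAt
    (differentiableAt_gaussMoment measurable_const hT hone 2 hρ hρ').hasDerivAt
    (hasDerivAt_gaussMoment_zero hY hT hint hρ hρ')
    (differentiableAt_gaussMoment hY hT hint 1 hρ hρ').hasDerivAt hpos.ne'
  have ho := hasDerivAt_iff_isLittleO_nhds_zero.1 hd
  have h2 : Tendsto (fun n => h n ^ 2) atTop (𝓝 0) := by simpa using hh.pow 2
  refine ((ho.comp_tendsto h2).neg_left).congr (fun n => ?_) fun n => rfl
  have e0 : gaussMoment P (fun _ => 1) T 0 ρ * gaussMoment P Y T 0 ρ /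
      (gaussMoment P (fun _ => 1) T 0 ρ * gaussMoment P (fun _ => 1) T 0 ρ) =
      gaussMoment P Y T 0 ρ / gaussMoment P (fun _ => 1) T 0 ρ := by field_simp
  simp only [Function.comp_apply, zero_add, zero_div, sub_zero, add_zero, one_mul, zero_mul,
    smul_eq_mul, e0, momentBias, centering]
  ring

end

/-! ### Linearization of the estimator -/

/-- φ_{2ρ'}² is a multiple of φ_ρ', and |y| ≤ (1 + y²)/2: a weighted second moment at ρ' controls
the first moment at 2ρ'. -/
lemma integrable_mul_gauss_two_mul {Ω : Type*} [MeasurableSpace Ω] {P : Measure Ω}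
    [IsFiniteMeasure P] {F T : Ω → ℝ} (mF : Measurable F) (mT : Measurable T) {ρ' : ℝ}
    (hρ' : 0 < ρ') (hint : Integrable (fun ω => F ω ^ 2 * gauss ρ' (T ω)) P) :
    Integrable (fun ω => F ω * gauss (2 * ρ') (T ω)) P := by
  set c : ℝ := (√(2 * Real.pi * (2 * ρ' + 2 * ρ')))⁻¹
  have hg : ∀ a, gauss (2 * ρ') a ^ 2 = c * gauss ρ' a := fun a => by
    rw [sq, gauss_mul_gauss_self (by positivity) (by positivity)]
    congr 2
    field_simp
    norm_num
  refine ((integrable_const (1 / 2 : ℝ)).add (hint.const_mul (c / 2))).mono'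
    (Measurable.aestronglyMeasurable (by fun_prop)) (ae_of_all _ fun ω => ?_)
  rw [Real.norm_eq_abs, Pi.add_apply]
  have h1 : (F ω * gauss (2 * ρ') (T ω)) ^ 2 = c * (F ω ^ 2 * gauss ρ' (T ω)) := by
    rw [mul_pow, hg]; ring
  have h2 := sq_abs (F ω * gauss (2 * ρ') (T ω))
  nlinarith [sq_nonneg (|F ω * gauss (2 * ρ') (T ω)| - 1)]

namespace IsSample

variable {Ω : Type*} [MeasurableSpace Ω] {P : Measure Ω}
  {T Y U : ℕ → Ω → ℝ} {σ2 : ℝ≥0} {ρ' : ℝ}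

lemma rho_pos (hS : IsSample P T Y U σ2 ρ') {s : ℝ} (hs : 0 ≤ s) : 0 < s + σ2 := by
  have : (0 : ℝ) < σ2 := NNReal.coe_pos.2 hS.var_pos
  positivity

variable [IsProbabilityMeasure P]

lemma integrable_mul_gauss_two (hS : IsSample P T Y U σ2 ρ') (hρ' : 0 < ρ') :
    Integrable (fun ω => Y 0 ω * gauss (2 * ρ') (T 0 ω)) P :=
  integrable_mul_gauss_two_mul (hS.measurable_Y 0) (hS.measurable_T 0) hρ' hS.integrable_sq

lemma integrable_one_sq (hS : IsSample P T Y U σ2 ρ') (hρ' : 0 < ρ') :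
    Integrable (fun ω => (fun _ : ℝ => (1 : ℝ)) (Y 0 ω) ^ 2 * gauss ρ' (T 0 ω)) P := by
  simpa using integrable_gauss_comp (μ := P) (hS.measurable_T 0) hρ'.le

end IsSample

lemma abs_gauss_le_weight (s h a : ℝ) :
    |gauss (s + h ^ 2) a| ≤ (1 + (|a| / √(s + h ^ 2)) ^ 2) * gauss (s + h ^ 2) a := by
  rw [abs_of_nonneg (gauss_nonneg _ _)]
  exact le_mul_of_one_le_left (gauss_nonneg _ _) (by linarith [sq_nonneg (|a| / √(s + h ^ 2))])

/-- With r = s + h² one has h ≤ √r, so the prefactor is at most b = |a|/√r, and b ≤ 1 + b². -/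
lemma abs_linWeight_le_weight {s : ℝ} (hs : 0 ≤ s) {h : ℝ} (hh : 0 < h) (a : ℝ) :
    |linWeight s h a| ≤ (1 + (|a| / √(s + h ^ 2)) ^ 2) * gauss (s + h ^ 2) a := by
  have hr : 0 < s + h ^ 2 := by positivity
  have hsr : 0 < √(s + h ^ 2) := Real.sqrt_pos.2 hr
  have h1 : h ≤ √(s + h ^ 2) := Real.le_sqrt_of_sq_le (by linarith)
  have h2 : h / (s + h ^ 2) * |a| ≤ |a| / √(s + h ^ 2) := by
    have h3 : s + h ^ 2 = √(s + h ^ 2) * √(s + h ^ 2) := (Real.mul_self_sqrt hr.le).symm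
    calc h / (s + h ^ 2) * |a| ≤ √(s + h ^ 2) / (s + h ^ 2) * |a| := by gcongr
      _ = √(s + h ^ 2) / (√(s + h ^ 2) * √(s + h ^ 2)) * |a| := by rw [← h3]
      _ = _ := by field_simp
  rw [linWeight, abs_mul, abs_of_nonneg (gauss_nonneg _ _), abs_mul,
    abs_of_pos (show 0 < h / (s + h ^ 2) by positivity)]
  refine mul_le_mul_of_nonneg_right (h2.trans ?_) (gauss_nonneg _ _)
  nlinarith [sq_nonneg (|a| / √(s + h ^ 2) - 1), sq_nonneg (|a| / √(s + h ^ 2))]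

/-- Both s and h² are at most r = s + h². -/
lemma abs_quadWeight_le_weight {s : ℝ} (hs : 0 ≤ s) {h : ℝ} (hh : 0 < h) (a : ℝ) :
    |quadWeight s h a| ≤ (1 + (|a| / √(s + h ^ 2)) ^ 2) * gauss (s + h ^ 2) a := by
  have hr : 0 < s + h ^ 2 := by positivity
  rw [quadWeight, abs_mul, abs_of_nonneg (gauss_nonneg _ _), abs_of_nonneg (by positivity)]
  refine mul_le_mul_of_nonneg_right (add_le_add ?_ ?_) (gauss_nonneg _ _)
  · rw [div_le_one hr]; linarith [sq_nonneg h]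
  · rw [div_pow, sq_abs, Real.sq_sqrt hr.le, sq (s + h ^ 2), div_le_div_iff₀ (by positivity) hr]
    have : 0 ≤ s * (a ^ 2 * (s + h ^ 2)) := by positivity
    nlinarith

lemma tendsto_gaussMoment {Ω : Type*} [MeasurableSpace Ω] {P : Measure Ω} {F : Ω → ℝ}
    (hF : Measurable F) {T₀ : Ω → ℝ} (hT : Measurable T₀)
    {ρm : ℝ} (hint : Integrable (fun ω => F ω * gauss ρm (T₀ ω)) P) (j : ℕ) {ρ : ℝ} (hρ : 0 < ρ)
    (hρm : ρ < ρm) {u : ℕ → ℝ} (hu : Tendsto u atTop (𝓝 ρ)) :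
    Tendsto (fun n => gaussMoment P F T₀ j (u n)) atTop (𝓝 (gaussMoment P F T₀ j ρ)) :=
  (differentiableAt_gaussMoment hF hT hint j hρ hρm).continuousAt.tendsto.comp hu

namespace IsSample

variable {Ω : Type*} [MeasurableSpace Ω] {P : Measure Ω} [IsProbabilityMeasure P]
  {T Y U : ℕ → Ω → ℝ} {σ2 : ℝ≥0} {ρ' : ℝ}

/-- The normalized error of the estimator is asymptotically linear in the averages of
`φ_r(T + U)` and `Y φ_r(T + U)`. -/
lemma tendsto_gHat_sub (hS : IsSample P T Y U σ2 ρ') (lam : ℝ≥0)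
    (hρ : (lam * σ2 : ℝ) / 2 + σ2 < ρ') {h : ℕ → ℝ} (hh : IsBandwidth h) {R : ℕ → ℝ}
    (hRtop : Tendsto R atTop atTop) {D : ℝ}
    (hR : ∀ n, R n ^ 2 ≤ D * (n * √((lam * σ2 : ℝ) + h n ^ 2))) (x : ℝ) :
    Tendsto (fun z : ℕ × Ω => R z.1 * (gHat σ2 lam (h z.1) z.1
          (fun i => x + (T i z.2 + U i z.2)) (fun i => Y i z.2) x -
          centering P (T 0) (Y 0) (lam * σ2 + σ2) (h z.1 ^ 2)) -
        (1 / gaussMoment P (fun _ => 1) (T 0) 0 (lam * σ2 + σ2) *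
          (R z.1 * (avg z.1 (fun i => T i z.2 + U i z.2) (fun i => Y i z.2)
              (fun y a => y * gauss (lam * σ2 + h z.1 ^ 2) a) -
            ∫ ω, Y 0 ω * gauss (lam * σ2 + h z.1 ^ 2) (T 0 ω + U 0 ω) ∂P)) +
        -(gaussMoment P (Y 0) (T 0) 0 (lam * σ2 + σ2) /
            gaussMoment P (fun _ => 1) (T 0) 0 (lam * σ2 + σ2) ^ 2) *
          (R z.1 * (avg z.1 (fun i => T i z.2 + U i z.2) (fun i => Y i z.2)
              (fun _ a => gauss (lam * σ2 + h z.1 ^ 2) a) -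
            ∫ ω, gauss (lam * σ2 + h z.1 ^ 2) (T 0 ω + U 0 ω) ∂P))))
      (probFilter P) (𝓝 0) := by
  have hs : 0 ≤ (lam * σ2 : ℝ) := by positivity
  set s : ℝ := lam * σ2 with hs_def
  have mT := hS.measurable_T 0
  have mY := hS.measurable_Y 0
  have mU := hS.measurable_U 0
  have hσ : (0 : ℝ) < σ2 := NNReal.coe_pos.2 hS.var_pos
  have hρ' : 0 < ρ' := by linarith
  have hρ0 := hS.rho_pos hs
  -- Twice s/2 + σ_u² is s + 2σ_u², so first moments at variance s + σ_u² are finite with room to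
  -- spare.
  have h2 : s + σ2 < 2 * ρ' := by linarith
  have i1 := integrable_one_mul_gauss (P := P) mT (show 0 ≤ 2 * ρ' by positivity)
  have iY := hS.integrable_mul_gauss_two hρ'
  have iF1 := hS.integrable_one_sq hρ'
  have iFY : Integrable (fun ω => (fun y : ℝ => y) (Y 0 ω) ^ 2 * gauss ρ' (T 0 ω)) P :=
    hS.integrable_sq
  have m1 : Measurable fun _ : ℝ => (1 : ℝ) := measurable_const
  have mid : Measurable fun y : ℝ => y := measurable_id
  have hlim : Tendsto h atTop (𝓝[>] 0) :=
    tendsto_nhdsWithin_iff.2 ⟨hh.tendsto_zero, Eventually.of_forall hh.pos⟩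
  have mg : ∀ h : ℝ, Measurable (gauss (s + h ^ 2)) := fun h => measurable_gauss _
  have bg : ∀ h : ℝ, 0 < h → ∀ a, |gauss (s + h ^ 2) a| ≤
    (1 + (|a| / √(s + h ^ 2)) ^ 2) * gauss (s + h ^ 2) a := fun h _ => abs_gauss_le_weight s h
  have bl : ∀ h : ℝ, 0 < h → ∀ a, |linWeight s h a| ≤
    (1 + (|a| / √(s + h ^ 2)) ^ 2) * gauss (s + h ^ 2) a :=
    fun h hh => abs_linWeight_le_weight hs hh
  have bq : ∀ h : ℝ, 0 < h → ∀ a, |quadWeight s h a| ≤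
    (1 + (|a| / √(s + h ^ 2)) ^ 2) * gauss (s + h ^ 2) a :=
    fun h hh => abs_quadWeight_le_weight hs hh
  -- stochastic orders
  have tA := hS.isBoundedInProb_avg m1 iF1 hs hρ (measurable_quadWeight s) bq hh hR
  have tM := hS.isBoundedInProb_avg m1 iF1 hs hρ mg bg hh hR
  have tN := hS.isBoundedInProb_avg mid iFY hs hρ mg bg hh hR
  have tp := hS.isBoundedInProb_avg m1 iF1 hs hρ (measurable_linWeight s) bl hh hR
  have tq := hS.isBoundedInProb_avg mid iFY hs hρ (measurable_linWeight s) bl hh hR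
  simp only [one_mul] at tA tM tp
  -- means
  obtain ⟨_, -, LA⟩ := hS.exists_weight_second_moment_le m1 iF1 hs hρ (measurable_quadWeight s) bq
  obtain ⟨_, -, LM⟩ := hS.exists_weight_second_moment_le m1 iF1 hs hρ mg bg
  obtain ⟨_, -, LN⟩ := hS.exists_weight_second_moment_le mid iFY hs hρ mg bg
  obtain ⟨_, -, Lp⟩ := hS.exists_weight_second_moment_le m1 iF1 hs hρ (measurable_linWeight s) bl
  obtain ⟨_, -, Lq⟩ := hS.exists_weight_second_moment_le mid iFY hs hρ (measurable_linWeight s) bl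
  have hh2 : Tendsto (fun n => h n ^ 2) atTop (𝓝 0) := by simpa using hh.tendsto_zero.pow 2
  have hu : Tendsto (fun n => s + σ2 + h n ^ 2) atTop (𝓝 (s + σ2)) := by
    simpa using hh2.const_add (s + σ2 : ℝ)
  have hcomm : ∀ n, s + h n ^ 2 + σ2 = s + σ2 + h n ^ 2 := fun n => by ring
  have l0 := tendsto_gaussMoment measurable_const mT i1 0 hρ0 h2 hu
  have l1 := tendsto_gaussMoment measurable_const mT i1 1 hρ0 h2 hu
  have l2 := tendsto_gaussMoment measurable_const mT i1 2 hρ0 h2 hu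
  have k0 := tendsto_gaussMoment mY mT iY 0 hρ0 h2 hu
  have k1 := tendsto_gaussMoment mY mT iY 1 hρ0 h2 hu
  have eA : ∀ᶠ n in atTop, ∫ ω, quadWeight s (h n) (T 0 ω + U 0 ω) ∂P =
      (1 - h n ^ 2 / (s + σ2 + h n ^ 2)) *
        gaussMoment P (fun _ => 1) (T 0) 0 (s + σ2 + h n ^ 2) +
      h n ^ 2 / (s + σ2 + h n ^ 2) ^ 2 *
        gaussMoment P (fun _ => 1) (T 0) 2 (s + σ2 + h n ^ 2) := by
    filter_upwards [hlim.eventually LA] with n hn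
    have hi : Integrable (fun ω => quadWeight s (h n) (T 0 ω + U 0 ω)) P := by
      simpa using hn.1.integrable (by norm_num)
    rw [integral_quadWeight hS.measurable_W mU hS.indep_U hS.law_U hs (hh.pos n) hS.var_pos hi,
      hcomm]
  have eM : ∀ᶠ n in atTop, ∫ ω, gauss (s + h n ^ 2) (T 0 ω + U 0 ω) ∂P =
      gaussMoment P (fun _ => 1) (T 0) 0 (s + σ2 + h n ^ 2) := by
    filter_upwards with n
    have hpos := hh.pos n
    have := integral_mul_gauss_add hS.measurable_W mU hS.indep_U hS.law_U (F := fun _ => 1)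
      (by fun_prop) (show 0 < s + h n ^ 2 by positivity)
      (integrable_one_mul_gauss mT (by positivity))
    simpa [gaussMoment, hcomm] using this
  have eN : ∀ᶠ n in atTop, ∫ ω, Y 0 ω * gauss (s + h n ^ 2) (T 0 ω + U 0 ω) ∂P =
      gaussMoment P (Y 0) (T 0) 0 (s + σ2 + h n ^ 2) := by
    filter_upwards [hu.eventually (gt_mem_nhds h2)] with n hn
    have hpos := hh.pos n
    have := integral_mul_gauss_add hS.measurable_W mU hS.indep_U hS.law_U (F := Prod.snd)
      (by fun_prop) (show 0 < s + h n ^ 2 by positivity)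
      (integrable_mul_gauss mY mT iY (by positivity) (by rw [hcomm]; exact hn))
    simpa [gaussMoment, hcomm] using this
  have ep : ∀ᶠ n in atTop, ∫ ω, linWeight s (h n) (T 0 ω + U 0 ω) ∂P =
      h n / (s + σ2 + h n ^ 2) * gaussMoment P (fun _ => 1) (T 0) 1 (s + σ2 + h n ^ 2) := by
    filter_upwards [hlim.eventually Lp] with n hn
    have := integral_mul_linWeight hS.measurable_W mU hS.indep_U hS.law_U (F := fun _ => 1)
      (by fun_prop) hs (hh.pos n) (hn.1.integrable (by norm_num))
    simpa [hcomm] using this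
  have eq : ∀ᶠ n in atTop, ∫ ω, Y 0 ω * linWeight s (h n) (T 0 ω + U 0 ω) ∂P =
      h n / (s + σ2 + h n ^ 2) * gaussMoment P (Y 0) (T 0) 1 (s + σ2 + h n ^ 2) := by
    filter_upwards [hlim.eventually Lq] with n hn
    have := integral_mul_linWeight hS.measurable_W mU hS.indep_U hS.law_U (F := Prod.snd)
      (by fun_prop) hs (hh.pos n) (hn.1.integrable (by norm_num))
    simpa [hcomm] using this
  -- limits of the means
  have hq1 : Tendsto (fun n => h n / (s + σ2 + h n ^ 2)) atTop (𝓝 0) := by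
    simpa using tendsto_fun_div hh.tendsto_zero hu hρ0.ne'
  have hq2 : Tendsto (fun n => h n ^ 2 / (s + σ2 + h n ^ 2)) atTop (𝓝 0) := by
    simpa using tendsto_fun_div hh2 hu hρ0.ne'
  have hq3 : Tendsto (fun n => h n ^ 2 / (s + σ2 + h n ^ 2) ^ 2) atTop (𝓝 0) := by
    simpa using tendsto_fun_div hh2 (hu.pow 2) (by positivity)
  have hα : Tendsto (fun n => ∫ ω, quadWeight s (h n) (T 0 ω + U 0 ω) ∂P) atTop
      (𝓝 (gaussMoment P (fun _ => 1) (T 0) 0 (s + σ2))) := by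
    have := ((hq2.const_sub 1).mul l0).add (hq3.mul l2)
    simp only [sub_zero, one_mul, zero_mul, add_zero] at this
    exact this.congr' (eA.mono fun _ hn => hn.symm)
  have hμ := l0.congr' (eM.mono fun _ hn => hn.symm)
  have hν := k0.congr' (eN.mono fun _ hn => hn.symm)
  have ha : Tendsto (fun n => ∫ ω, linWeight s (h n) (T 0 ω + U 0 ω) ∂P) atTop (𝓝 0) := by
    have := hq1.mul l1
    rw [zero_mul] at this
    exact this.congr' (ep.mono fun _ hn => hn.symm)
  have hb : Tendsto (fun n => ∫ ω, Y 0 ω * linWeight s (h n) (T 0 ω + U 0 ω) ∂P) atTop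
      (𝓝 0) := by
    have := hq1.mul k1
    rw [zero_mul] at this
    exact this.congr' (eq.mono fun _ hn => hn.symm)
  have main := tendsto_ratio_linearization hRtop tA tM tN tp tq hα hμ hν ha hb
    (gaussMoment_one_pos mT hρ0).ne'
  refine main.congr' ?_
  filter_upwards [tendsto_fst_probFilter.eventually eA, tendsto_fst_probFilter.eventually eM,
    tendsto_fst_probFilter.eventually eN, tendsto_fst_probFilter.eventually ep,
    tendsto_fst_probFilter.eventually eq] with z zA zM zN zp zq
  rw [gHat_eq σ2 lam (hh.pos z.1)]
  simp only [add_sub_cancel_left, ← hs_def]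
  congr 3
  -- Each linear mean carries h/(ρ + h²), so the products contribute the factor u/(ρ + u)² with u =
  -- h².
  rw [zA, zM, zN, zp, zq, centering]
  generalize s + (σ2 : ℝ) + h z.1 ^ 2 = u
  congr 1 <;> ring

end IsSample

/-! ### Joint asymptotic normality of the weighted averages -/

namespace IsSample

variable {Ω : Type*} [MeasurableSpace Ω] {P : Measure Ω} [IsProbabilityMeasure P]
  {T Y U : ℕ → Ω → ℝ} {σ2 : ℝ≥0} {ρ' : ℝ}

/-- The product of the two kernels is one kernel, to which smoothing by U adds σ_u². -/
lemma integral_mul_gauss_mul_gauss (hS : IsSample P T Y U σ2 ρ') {F : ℝ → ℝ} (hF : Measurable F)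
    (hint : Integrable (fun ω => F (Y 0 ω) * gauss ρ' (T 0 ω)) P) {r s : ℝ} (hr : 0 < r)
    (hs : 0 < s) (hρ : r * s / (r + s) + σ2 < ρ') :
    ∫ ω, F (Y 0 ω) * (gauss r (T 0 ω + U 0 ω) * gauss s (T 0 ω + U 0 ω)) ∂P =
      (√(2 * Real.pi * (r + s)))⁻¹ *
        ∫ ω, F (Y 0 ω) * gauss (r * s / (r + s) + σ2) (T 0 ω) ∂P := by
  have hv : 0 < r * s / (r + s) := by positivity
  have hσ : (0 : ℝ) < σ2 := NNReal.coe_pos.2 hS.var_pos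
  rw [← integral_mul_gauss_add hS.measurable_W (hS.measurable_U 0) hS.indep_U hS.law_U
    (F := fun w => F w.2) (by fun_prop) hv (integrable_mul_gauss (hF.comp (hS.measurable_Y 0))
      (hS.measurable_T 0) hint (by positivity) hρ), ← integral_const_mul]
  refine integral_congr_ae (ae_of_all _ fun ω => ?_)
  simp only [gauss_mul_gauss_self hr hs]
  ring

lemma integrable_affine_mul_affine (hS : IsSample P T Y U σ2 ρ') (hρ' : 0 < ρ') (a b c d : ℝ) :
    Integrable (fun ω => (a * Y 0 ω + b) * (c * Y 0 ω + d) * gauss ρ' (T 0 ω)) P := by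
  have mT := hS.measurable_T 0
  have mY := hS.measurable_Y 0
  have h1 : Integrable (fun ω => gauss ρ' (T 0 ω)) P := integrable_gauss_comp mT hρ'.le
  have hY : Integrable (fun ω => Y 0 ω * gauss ρ' (T 0 ω)) P := by
    refine (h1.add hS.integrable_sq).mono' (Measurable.aestronglyMeasurable (by fun_prop))
      (ae_of_all _ fun ω => ?_)
    have hg := gauss_nonneg ρ' (T 0 ω)
    rw [Pi.add_apply, norm_mul, Real.norm_of_nonneg hg, Real.norm_eq_abs]
    have : |Y 0 ω| ≤ 1 + Y 0 ω ^ 2 := by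
      rw [← sq_abs]; nlinarith [sq_nonneg (|Y 0 ω| - 1), abs_nonneg (Y 0 ω)]
    nlinarith [mul_le_mul_of_nonneg_right this hg]
  refine (((hS.integrable_sq.const_mul (a * c)).add (hY.const_mul (a * d + b * c))).add
    (h1.const_mul (b * d))).congr (ae_of_all _ fun ω => ?_)
  simp only [Pi.add_apply]
  ring

end IsSample

lemma tendsto_harmonic {s s' : ℝ} (hs : 0 ≤ s) (hs' : 0 ≤ s') {h : ℕ → ℝ} (hh : IsBandwidth h) :
    Tendsto (fun n => (s + h n ^ 2) * (s' + h n ^ 2) / (s + h n ^ 2 + (s' + h n ^ 2))) atTop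
      (𝓝 (s * s' / (s + s'))) := by
  have hh2 : Tendsto (fun n => h n ^ 2) atTop (𝓝 0) := by simpa using hh.tendsto_zero.pow 2
  have h1 : Tendsto (fun n => s + h n ^ 2) atTop (𝓝 s) := by simpa using hh2.const_add s
  have h2 : Tendsto (fun n => s' + h n ^ 2) atTop (𝓝 s') := by simpa using hh2.const_add s'
  rcases (add_nonneg hs hs').eq_or_lt with h0 | h0
  -- When both variances vanish the sequence is h²/2, whose limit 0 is also the value of 0/0.
  · obtain ⟨rfl, rfl⟩ : s = 0 ∧ s' = 0 := ⟨by linarith, by linarith⟩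
    have := hh2.div_const 2
    simp only [zero_div] at this
    simp only [zero_add, mul_zero, zero_div]
    refine this.congr fun n => ?_
    have := hh.pos n
    field_simp
    norm_num
  · exact tendsto_fun_div (h1.mul h2) (h1.add h2) h0.ne'

/-- The harmonic combination is at most half the larger variance, so the condition on ρ' for the
diagonal entries suffices off the diagonal. -/
lemma harmonic_le {s s' b : ℝ} (hs : 0 ≤ s) (hs' : 0 ≤ s') (h1 : s / 2 ≤ b) (h2 : s' / 2 ≤ b) :
    s * s' / (s + s') ≤ b := by
  rcases (add_nonneg hs hs').eq_or_lt with h0 | h0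
  · rw [← h0, div_zero]; linarith
  · rw [div_le_iff₀ h0]
    nlinarith [mul_nonneg hs hs']

/-- Separates a uniformly small kernel factor z from the unbounded response y. The last factor tends
to 0 pointwise with η and is at most 1, so dominated convergence works with second moments only. -/
lemma truncSq_mul_le_of_abs_le {y z η : ℝ} (hz : |z| ≤ η) :
    truncSq (z * y) ≤ z ^ 2 * (y ^ 2 * min 1 (η * |y|)) := by
  have hη : 0 ≤ η := (abs_nonneg z).trans hz
  rcases le_total 1 (η * |y|) with h | h
  · rw [min_eq_left h]
    exact (truncSq_le_sq _).trans_eq (by ring)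
  · rw [min_eq_right h]
    refine (min_le_right _ _).trans ?_
    rw [abs_mul, mul_pow]
    calc |z| ^ 3 * |y| ^ 3 = |z| ^ 2 * |y| ^ 3 * |z| := by ring
      _ ≤ |z| ^ 2 * |y| ^ 3 * η := by gcongr
      _ = _ := by rw [← sq_abs z, ← sq_abs y]; ring

namespace IsSample

variable {Ω : Type*} [MeasurableSpace Ω] {P : Measure Ω} [IsProbabilityMeasure P]
  {T Y U : ℕ → Ω → ℝ} {σ2 : ℝ≥0} {ρ' : ℝ}

lemma tendsto_integral_mul_gauss_mul_gauss (hS : IsSample P T Y U σ2 ρ') {F : ℝ → ℝ}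
    (hF : Measurable F) (hint : Integrable (fun ω => F (Y 0 ω) * gauss ρ' (T 0 ω)) P) {s s' : ℝ}
    (hs : 0 ≤ s) (hs' : 0 ≤ s') (hρ : s / 2 + σ2 < ρ') (hρs' : s' / 2 + σ2 < ρ') {h : ℕ → ℝ}
    (hh : IsBandwidth h) {w : ℕ → ℝ} {γ : ℝ}
    (hw : Tendsto (fun n => w n * (√(2 * Real.pi * (s + h n ^ 2 + (s' + h n ^ 2))))⁻¹) atTop
      (𝓝 γ)) :
    Tendsto (fun n => w n * ∫ ω, F (Y 0 ω) * (gauss (s + h n ^ 2) (T 0 ω + U 0 ω) *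
        gauss (s' + h n ^ 2) (T 0 ω + U 0 ω)) ∂P) atTop
      (𝓝 (γ * ∫ ω, F (Y 0 ω) * gauss (s * s' / (s + s') + σ2) (T 0 ω) ∂P)) := by
  have hσ : (0 : ℝ) < σ2 := NNReal.coe_pos.2 hS.var_pos
  have hv : s * s' / (s + s') + σ2 < ρ' := by
    have := harmonic_le hs hs' (le_max_left (s / 2) (s' / 2)) (le_max_right _ _)
    rcases max_cases (s / 2) (s' / 2) with h | h <;> linarith
  have hlim := (tendsto_harmonic hs hs' hh).add_const (σ2 : ℝ)
  have hm := tendsto_gaussMoment (F := fun ω => F (Y 0 ω)) (hF.comp (hS.measurable_Y 0))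
    (hS.measurable_T 0) hint 0 (show 0 < s * s' / (s + s') + σ2 by positivity) hv hlim
  refine (hw.mul hm).congr' ?_ |>.trans_eq ?_
  · filter_upwards [hlim.eventually (gt_mem_nhds hv)] with n hn
    have := hh.pos n
    rw [hS.integral_mul_gauss_mul_gauss hF hint (by positivity) (by positivity) hn, gaussMoment]
    simp only [pow_zero, one_mul, mul_assoc]
  · simp [gaussMoment]

/-- Since φ_r ≤ r^(-1/2), the kernel factor of the normalized entry is at most η_n = √(w_n/(nr)),
which tends to 0. The Lindeberg sum is then a convergent factor times the second moment of q(Y)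
truncated at scale η_n, which vanishes. -/
lemma tendsto_lindeberg (hS : IsSample P T Y U σ2 ρ') {q : ℝ → ℝ} (hq : Measurable q)
    (hint : Integrable (fun ω => q (Y 0 ω) ^ 2 * gauss ρ' (T 0 ω)) P) {s : ℝ} (hs : 0 ≤ s)
    (hρ : s / 2 + σ2 < ρ') {h : ℕ → ℝ} (hh : IsBandwidth h) {w : ℕ → ℝ} (hw0 : ∀ n, 0 ≤ w n)
    {γ : ℝ} (hw : Tendsto (fun n => w n * (√(2 * Real.pi * (s + h n ^ 2 + (s + h n ^ 2))))⁻¹) atTop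
      (𝓝 γ))
    (hη : Tendsto (fun n : ℕ => w n / (n * (s + h n ^ 2))) atTop (𝓝 0)) :
    Tendsto (fun n : ℕ => n * ∫ ω, truncSq ((√n)⁻¹ * (√(w n) * (q (Y 0 ω) *
      gauss (s + h n ^ 2) (T 0 ω + U 0 ω)))) ∂P) atTop (𝓝 0) := by
  have mT := hS.measurable_T 0
  have mY := hS.measurable_Y 0
  have mU := hS.measurable_U 0
  have hσ : (0 : ℝ) < σ2 := NNReal.coe_pos.2 hS.var_pos
  set η : ℕ → ℝ := fun n => √(w n / (n * (s + h n ^ 2)))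
  have hη0 : ∀ n, 0 ≤ η n := fun n => Real.sqrt_nonneg _
  have hηlim : Tendsto η atTop (𝓝 0) := by simpa using hη.sqrt
  set Q : ℕ → ℝ → ℝ := fun n y => q y ^ 2 * min 1 (η n * |q y|)
  have mQ : ∀ n, Measurable (Q n) := fun n => by fun_prop
  have hQ0 : ∀ n y, 0 ≤ Q n y := fun n y =>
    mul_nonneg (sq_nonneg _) (le_min zero_le_one (mul_nonneg (hη0 n) (abs_nonneg _)))
  have hQle : ∀ n y, Q n y ≤ q y ^ 2 := fun n y =>
    mul_le_of_le_one_right (sq_nonneg _) (min_le_left _ _)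
  have hQi : ∀ n, Integrable (fun ω => Q n (Y 0 ω) * gauss ρ' (T 0 ω)) P := fun n => by
    refine hint.mono' (Measurable.aestronglyMeasurable (by fun_prop)) (ae_of_all _ fun ω => ?_)
    rw [Real.norm_of_nonneg (mul_nonneg (hQ0 _ _) (gauss_nonneg _ _))]
    exact mul_le_mul_of_nonneg_right (hQle _ _) (gauss_nonneg _ _)
  have hQlim : Tendsto (fun n => ∫ ω, Q n (Y 0 ω) * gauss ρ' (T 0 ω) ∂P) atTop (𝓝 0) := by
    have := tendsto_integral_of_dominated_convergence
      (F := fun n ω => Q n (Y 0 ω) * gauss ρ' (T 0 ω)) (f := fun _ => 0) (μ := P)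
      (fun ω => q (Y 0 ω) ^ 2 * gauss ρ' (T 0 ω)) (fun n => (hQi n).1) hint
      (fun n => ae_of_all _ fun ω => by
        rw [Real.norm_of_nonneg (mul_nonneg (hQ0 _ _) (gauss_nonneg _ _))]
        exact mul_le_mul_of_nonneg_right (hQle _ _) (gauss_nonneg _ _))
      (ae_of_all _ fun ω => by
        have h1 : Tendsto (fun n => min 1 (η n * |q (Y 0 ω)|)) atTop
            (𝓝 (min 1 (0 * |q (Y 0 ω)|))) := tendsto_const_nhds.min (hηlim.mul_const _)
        have := (h1.const_mul (q (Y 0 ω) ^ 2)).mul_const (gauss ρ' (T 0 ω))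
        simpa using this)
    simpa using this
  have hhalf : ∀ r : ℝ, r * r / (r + r) = r / 2 := fun r => by
    rcases eq_or_ne r 0 with rfl | hr
    · simp
    · field_simp; norm_num
  obtain ⟨ρb, hb, hb'⟩ := exists_between hρ
  obtain ⟨C, hC, hCle⟩ := exists_pow_mul_gauss_le 0 hσ hb' (by linarith)
  have hlim := (tendsto_harmonic hs hs hh).add_const (σ2 : ℝ)
  have hub := (hw.mul_const C).mul hQlim
  rw [mul_zero] at hub
  refine tendsto_of_tendsto_of_tendsto_of_le_of_le' tendsto_const_nhds hub
    (Eventually.of_forall fun n => mul_nonneg n.cast_nonneg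
      (integral_nonneg fun _ => truncSq_nonneg _)) ?_
  filter_upwards [hlim.eventually (gt_mem_nhds
    (show s * s / (s + s) + (σ2 : ℝ) < ρb by rwa [hhalf])), eventually_gt_atTop 0] with n hn hn0
  have hn' : (0 : ℝ) < n := by exact_mod_cast hn0
  have hpos := hh.pos n
  set r := s + h n ^ 2 with hr
  have hr0 : 0 < r := by positivity
  have hpt : ∀ ω, truncSq ((√n)⁻¹ * (√(w n) * (q (Y 0 ω) * gauss r (T 0 ω + U 0 ω)))) ≤
      (n : ℝ)⁻¹ * w n * (Q n (Y 0 ω) * (gauss r (T 0 ω + U 0 ω) * gauss r (T 0 ω + U 0 ω))) := by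
    intro ω
    set γ' := gauss r (T 0 ω + U 0 ω)
    have hz : |(√n)⁻¹ * √(w n) * γ'| ≤ η n := by
      rw [abs_of_nonneg (mul_nonneg (by positivity) (gauss_nonneg _ _))]
      have h1 : γ' ≤ (√r)⁻¹ := (gauss_le _ _ hr0.le).trans (by
        gcongr
        nlinarith [Real.pi_gt_three])
      calc (√n)⁻¹ * √(w n) * γ' ≤ (√n)⁻¹ * √(w n) * (√r)⁻¹ := by gcongr
        _ = η n := by
          simp only [η, ← hr]
          rw [Real.sqrt_div (hw0 n), Real.sqrt_mul hn'.le]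
          field_simp
    have := truncSq_mul_le_of_abs_le (y := q (Y 0 ω)) hz
    calc _ = truncSq ((√n)⁻¹ * √(w n) * γ' * q (Y 0 ω)) := by congr 1; ring
      _ ≤ _ := this
      _ = _ := by
        rw [mul_pow, mul_pow, inv_pow, Real.sq_sqrt hn'.le, Real.sq_sqrt (hw0 n)]
        ring
  have hi : Integrable (fun ω => Q n (Y 0 ω) *
      (gauss r (T 0 ω + U 0 ω) * gauss r (T 0 ω + U 0 ω))) P := by
    have := (integrable_mul_gauss_add hS.measurable_W mU hS.indep_U hS.law_U
      (F := fun w => Q n w.2) (by fun_prop) (show 0 < r * r / (r + r) by positivity)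
      (integrable_mul_gauss ((mQ n).comp mY) mT (hQi n) (by positivity) (hn.trans hb'))).const_mul
        ((√(2 * Real.pi * (r + r)))⁻¹)
    refine this.congr (ae_of_all _ fun ω => ?_)
    simp only [gauss_mul_gauss_self hr0 hr0]
    ring
  calc (n : ℝ) * _ ≤ n * ∫ ω, (n : ℝ)⁻¹ * w n * (Q n (Y 0 ω) *
        (gauss r (T 0 ω + U 0 ω) * gauss r (T 0 ω + U 0 ω))) ∂P := by
        refine mul_le_mul_of_nonneg_left (integral_mono_of_nonneg (ae_of_all _ fun _ =>
          truncSq_nonneg _) (hi.const_mul _) (ae_of_all _ hpt)) hn'.le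
    _ = w n * (√(2 * Real.pi * (r + r)))⁻¹ *
        ∫ ω, Q n (Y 0 ω) * gauss (r * r / (r + r) + σ2) (T 0 ω) ∂P := by
        rw [integral_const_mul, hS.integral_mul_gauss_mul_gauss (mQ n) (hQi n) hr0 hr0
          (hn.trans hb')]
        field_simp
    _ ≤ w n * (√(2 * Real.pi * (r + r)))⁻¹ *
        ∫ ω, C * (Q n (Y 0 ω) * gauss ρ' (T 0 ω)) ∂P := by
        refine mul_le_mul_of_nonneg_left (integral_mono_of_nonneg (ae_of_all _ fun ω =>
          mul_nonneg (hQ0 _ _) (gauss_nonneg _ _)) ((hQi n).const_mul _) (ae_of_all _ fun ω => ?_))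
          (mul_nonneg (hw0 n) (by positivity))
        have := hCle (r * r / (r + r) + σ2) ⟨by linarith [show 0 ≤ r * r / (r + r) by positivity],
          hn.le⟩ (T 0 ω)
        rw [pow_zero, one_mul] at this
        calc _ ≤ Q n (Y 0 ω) * (C * gauss ρ' (T 0 ω)) :=
              mul_le_mul_of_nonneg_left this (hQ0 _ _)
          _ = _ := by ring
    _ = _ := by rw [integral_const_mul]; ring

/-- Joint asymptotic normality of the averages of `q_k(Y) φ_{s_k + h²}(T + U)`, where `q_k` is
affine. -/
theorem tendstoInDistribution_avg (hS : IsSample P T Y U σ2 ρ') {ι : Type*} [Fintype ι]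
    [DecidableEq ι] {s c d : ι → ℝ} (hs : ∀ k, 0 ≤ s k) (hρ : ∀ k, s k / 2 + σ2 < ρ')
    {h : ℕ → ℝ} (hh : IsBandwidth h) {w : ι → ℕ → ℝ} (hw0 : ∀ k n, 0 ≤ w k n) {γ : ι → ι → ℝ}
    (hw : ∀ k l, Tendsto (fun n => √(w k n) * √(w l n) *
      (√(2 * Real.pi * (s k + h n ^ 2 + (s l + h n ^ 2))))⁻¹) atTop (𝓝 (γ k l)))
    (hη : ∀ k, Tendsto (fun n : ℕ => w k n / (n * (s k + h n ^ 2))) atTop (𝓝 0))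
    {v : ι → ℝ} (hv : ∀ k, Tendsto (fun n => √(w k n)) atTop (𝓝 (v k)))
    (hv0 : ∀ k, v k * ∫ ω, (d k * Y 0 ω + c k) * gauss (s k + σ2) (T 0 ω) ∂P = 0)
    {Δ : Matrix ι ι ℝ}
    (hΔ : ∀ k l, γ k l * ∫ ω, (d k * Y 0 ω + c k) * (d l * Y 0 ω + c l) *
      gauss (s k * s l / (s k + s l) + σ2) (T 0 ω) ∂P = Δ k l) :
    Δ.PosSemidef ∧
    TendstoInDistribution
      (fun (n : ℕ) ω => (WithLp.toLp 2 fun k => √n * √(w k n) *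
        (avg n (fun i => T i ω + U i ω) (fun i => Y i ω)
            (fun y a => (d k * y + c k) * gauss (s k + h n ^ 2) a) -
          ∫ ω, (d k * Y 0 ω + c k) * gauss (s k + h n ^ 2) (T 0 ω + U 0 ω) ∂P) :
        EuclideanSpace ℝ ι))
      atTop (id : EuclideanSpace ℝ ι → EuclideanSpace ℝ ι) (fun _ => P)
      (multivariateGaussian 0 Δ) := by
  have mT := hS.measurable_T 0
  have mY := hS.measurable_Y 0
  have mU := hS.measurable_U 0
  have hσ : (0 : ℝ) < σ2 := NNReal.coe_pos.2 hS.var_pos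
  have hlim : Tendsto h atTop (𝓝[>] 0) :=
    tendsto_nhdsWithin_iff.2 ⟨hh.tendsto_zero, Eventually.of_forall hh.pos⟩
  have hh2 : Tendsto (fun n => h n ^ 2) atTop (𝓝 0) := by simpa using hh.tendsto_zero.pow 2
  set G : ℕ → (ℝ × ℝ) × ℝ → ι → ℝ := fun n z k =>
    √(w k n) * ((d k * z.1.2 + c k) * gauss (s k + h n ^ 2) (z.1.1 + z.2)) with hG
  have hρ' : ∀ k : ι, 0 < ρ' := fun k => by linarith [hs k, hρ k]
  have hint : ∀ k, Integrable (fun ω => (d k * Y 0 ω + c k) ^ 2 * gauss ρ' (T 0 ω)) P := fun k => by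
    simpa only [sq] using hS.integrable_affine_mul_affine (hρ' k) (d k) (c k) (d k) (c k)
  have key := tendstoInDistribution_array (P := P) (V := fun i ω => ((T i ω, Y i ω), U i ω))
    (fun i => ((hS.measurable_T i).prodMk (hS.measurable_Y i)).prodMk (hS.measurable_U i))
    hS.indep hS.identDistrib (G := G) (fun n k => by simp only [hG]; fun_prop) (Δ := Δ)
    ?_ ?_ ?_ ?_
  · refine ⟨key.1, ?_⟩
    convert key.2 using 4 with n ω
    ext k
    simp only [hG, avg]
    rw [integral_const_mul, Finset.sum_sub_distrib, ← Finset.mul_sum, Finset.sum_const,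
      Finset.card_range, nsmul_eq_mul]
    rcases eq_or_ne n 0 with rfl | hn
    · simp
    have hn' : (0 : ℝ) < n := by positivity
    have : (n : ℝ) = √n * √n := (Real.mul_self_sqrt hn'.le).symm
    have h0 : 0 < √(n : ℝ) := Real.sqrt_pos.2 hn'
    generalize √(n : ℝ) = m at *
    rw [this]
    field_simp
  · rw [Filter.eventually_all]
    intro k
    obtain ⟨_, -, hev⟩ := hS.exists_weight_second_moment_le (F := fun y => d k * y + c k)
      (by fun_prop) (hint k) (hs k) (hρ k) (χ := fun h => gauss (s k + h ^ 2))
      (fun h => measurable_gauss _) (fun h _ => abs_gauss_le_weight (s k) h)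
    filter_upwards [hlim.eventually hev] with n hn
    exact hn.1.const_mul _
  -- The limit of the mean is √w times the moment at variance s + σ_u², and that product is zero by
  -- hypothesis.
  · intro k
    have i2 : Integrable (fun ω => (d k * Y 0 ω + c k) * gauss (2 * ρ') (T 0 ω)) P := by
      have h1 := hS.integrable_mul_gauss_two (hρ' k)
      have h2 : Integrable (fun ω => gauss (2 * ρ') (T 0 ω)) P :=
        integrable_gauss_comp mT (by linarith [hρ' k])
      refine ((h1.const_mul (d k)).add (h2.const_mul (c k))).congr (ae_of_all _ fun ω => ?_)
      simp only [Pi.add_apply]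
      ring
    have hl : s k + σ2 < 2 * ρ' := by linarith [hρ k, hs k]
    have hu : Tendsto (fun n => s k + h n ^ 2 + σ2) atTop (𝓝 (s k + σ2)) := by
      simpa using (hh2.const_add (s k)).add_const (σ2 : ℝ)
    have hm := tendsto_gaussMoment (F := fun ω => d k * Y 0 ω + c k) (by fun_prop) mT i2 0
      (hS.rho_pos (hs k)) hl hu
    have := (hv k).mul hm
    simp only [gaussMoment, pow_zero, one_mul, hv0 k] at this
    refine this.congr' ?_
    filter_upwards [hu.eventually (gt_mem_nhds hl)] with n hn
    have hpos := hh.pos n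
    have := hs k
    simp only [hG]
    rw [integral_const_mul, integral_mul_gauss_add hS.measurable_W mU hS.indep_U hS.law_U
      (F := fun w => d k * w.2 + c k) (by fun_prop) (by positivity)
      (integrable_mul_gauss (by fun_prop) mT i2 (by positivity) hn)]
  · intro k l
    have := hS.tendsto_integral_mul_gauss_mul_gauss
      (F := fun y => (d k * y + c k) * (d l * y + c l)) (by fun_prop)
      (hS.integrable_affine_mul_affine (hρ' k) _ _ _ _) (hs k) (hs l) (hρ k) (hρ l) hh (hw k l)
    rw [hΔ k l] at this
    refine this.congr fun n => ?_
    rw [← integral_const_mul]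
    refine integral_congr_ae (ae_of_all _ fun ω => ?_)
    simp only [hG]
    ring
  · intro k
    exact hS.tendsto_lindeberg (q := fun y => d k * y + c k) (by fun_prop) (hint k) (hs k) (hρ k)
      hh (hw0 k) (by simpa only [Real.mul_self_sqrt (hw0 k _)] using hw k k) (hη k)

end IsSample

/-! ### Moments in the regression model -/

namespace IsModel

variable {Ω : Type*} [MeasurableSpace Ω] {P : Measure Ω} [IsProbabilityMeasure P]
  {X ε U : ℕ → Ω → ℝ} {σ2 : ℝ≥0} {fX τ2 m3 : ℝ → ℝ}

lemma integrable_comp_X_iff (hm : IsModel P X ε U σ2 fX τ2 m3) (hf : Measurable fX) {ψ : ℝ → ℝ}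
    (hψ : Measurable ψ) :
    Integrable (fun ω => ψ (X 0 ω)) P ↔ Integrable (fun t => ψ t * fX t) := by
  have h1 : Integrable (fun ω => ψ (X 0 ω)) P ↔ Integrable ψ (P.map (X 0)) :=
    (integrable_map_measure hψ.aestronglyMeasurable (hm.measurable_X 0).aemeasurable).symm
  rw [h1, hm.law_X, integrable_withDensity_iff (by fun_prop) (by simp)]
  simp only [ENNReal.toReal_ofReal (hm.density_nonneg _)]

lemma integral_comp_X (hm : IsModel P X ε U σ2 fX τ2 m3) (hf : Measurable fX) {ψ : ℝ → ℝ}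
    (hψ : Measurable ψ) : ∫ ω, ψ (X 0 ω) ∂P = ∫ t, ψ t * fX t := by
  have h1 : ∫ ω, ψ (X 0 ω) ∂P = ∫ t, ψ t ∂(P.map (X 0)) :=
    (integral_map (hm.measurable_X 0).aemeasurable hψ.aestronglyMeasurable).symm
  rw [h1, hm.law_X, integral_withDensity_eq_integral_toReal_smul (by fun_prop) (by simp)]
  simp only [ENNReal.toReal_ofReal (hm.density_nonneg _), smul_eq_mul, mul_comm]

lemma integrable_iff_compProd (hm : IsModel P X ε U σ2 fX τ2 m3) {Φ : ℝ × ℝ → ℝ}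
    (hΦ : Measurable Φ) :
    Integrable (fun ω => Φ (X 0 ω, ε 0 ω)) P ↔
      Integrable Φ ((P.map (X 0)) ⊗ₘ condDistrib (ε 0) (X 0) P) := by
  rw [compProd_map_condDistrib (hm.measurable_ε 0).aemeasurable, integrable_map_measure
    hΦ.aestronglyMeasurable ((hm.measurable_X 0).prodMk (hm.measurable_ε 0)).aemeasurable]
  rfl

lemma integral_eq_compProd (hm : IsModel P X ε U σ2 fX τ2 m3) {Φ : ℝ × ℝ → ℝ}
    (hΦ : Measurable Φ) (hint : Integrable (fun ω => Φ (X 0 ω, ε 0 ω)) P) :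
    ∫ ω, Φ (X 0 ω, ε 0 ω) ∂P =
      ∫ t, ∫ e, Φ (t, e) ∂(condDistrib (ε 0) (X 0) P t) ∂(P.map (X 0)) := by
  rw [← Measure.integral_compProd ((hm.integrable_iff_compProd hΦ).1 hint),
    compProd_map_condDistrib (hm.measurable_ε 0).aemeasurable, integral_map
    ((hm.measurable_X 0).prodMk (hm.measurable_ε 0)).aemeasurable hΦ.aestronglyMeasurable]

lemma integrable_sq_error (hm : IsModel P X ε U σ2 fX τ2 m3) (hτ : Measurable τ2) {ψ : ℝ → ℝ}
    (hψ : Measurable ψ) (hint : Integrable (fun ω => τ2 (X 0 ω) * ψ (X 0 ω)) P) :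
    Integrable (fun ω => ε 0 ω ^ 2 * ψ (X 0 ω)) P := by
  refine (hm.integrable_iff_compProd (Φ := fun z => z.2 ^ 2 * ψ z.1) (by fun_prop)).2 ?_
  refine (Measure.integrable_compProd_iff (Measurable.aestronglyMeasurable (by fun_prop))).2
    ⟨?_, ?_⟩
  · filter_upwards [hm.integrable_cube] with t ht
    -- Given X, the third moment is finite and e² ≤ 1 + |e|³.
    refine Integrable.mul_const ?_ _
    refine ((integrable_const (1 : ℝ)).add ht).mono' (by fun_prop) (ae_of_all _ fun e => ?_)
    rw [Real.norm_of_nonneg (sq_nonneg _), ← sq_abs, Pi.add_apply]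
    have := abs_nonneg e
    nlinarith [mul_nonneg this (sq_nonneg (|e| - 1)), sq_nonneg (|e| - 1)]
  · have h1 : Integrable (fun t => τ2 t * ψ t) (P.map (X 0)) :=
      (integrable_map_measure (by fun_prop) (hm.measurable_X 0).aemeasurable).2 hint
    refine h1.norm.congr ?_
    filter_upwards [hm.cond_var, hm.cond_var_pos] with t ht ht'
    simp only [norm_mul, norm_pow, Real.norm_eq_abs, sq_abs, integral_mul_const, ht,
      abs_of_pos ht']

lemma integral_sq_error (hm : IsModel P X ε U σ2 fX τ2 m3) (hτ : Measurable τ2) {ψ : ℝ → ℝ}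
    (hψ : Measurable ψ) (hint : Integrable (fun ω => τ2 (X 0 ω) * ψ (X 0 ω)) P) :
    ∫ ω, ε 0 ω ^ 2 * ψ (X 0 ω) ∂P = ∫ ω, τ2 (X 0 ω) * ψ (X 0 ω) ∂P := by
  rw [hm.integral_eq_compProd (Φ := fun z => z.2 ^ 2 * ψ z.1) (by fun_prop)
    (hm.integrable_sq_error hτ hψ hint), ← integral_map (hm.measurable_X 0).aemeasurable
    (f := fun t => τ2 t * ψ t) (by fun_prop)]
  refine integral_congr_ae ?_
  filter_upwards [hm.cond_var] with t ht
  simp only [integral_mul_const, ht]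

lemma integral_error (hm : IsModel P X ε U σ2 fX τ2 m3) {ψ : ℝ → ℝ}
    (hψ : Measurable ψ) (hint : Integrable (fun ω => ε 0 ω * ψ (X 0 ω)) P) :
    ∫ ω, ε 0 ω * ψ (X 0 ω) ∂P = 0 := by
  rw [hm.integral_eq_compProd (Φ := fun z => z.2 * ψ z.1) (by fun_prop) hint]
  refine integral_eq_zero_of_ae ?_
  filter_upwards [hm.cond_mean] with t ht
  simp only [integral_mul_const, ht, zero_mul, Pi.zero_apply]

variable {g : ℝ → ℝ} {x : ℝ} {ρ' : ℝ}

/-- The observations centred at `x` form a sample. -/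
lemma isSample (hm : IsModel P X ε U σ2 fX τ2 m3) (hσ2 : 0 < σ2) (hf : Measurable fX)
    (hg : Measurable g) (hτ : Measurable τ2)
    (hint : Integrable (fun t => (g t ^ 2 + τ2 t) * fX t * gauss ρ' (t - x))) :
    IsSample P (fun i ω => X i ω - x) (fun i ω => g (X i ω) + ε i ω) U σ2 ρ' ∧
      Integrable (fun ω => g (X 0 ω) ^ 2 * gauss ρ' (X 0 ω - x)) P ∧
      Integrable (fun ω => τ2 (X 0 ω) * gauss ρ' (X 0 ω - x)) P := by
  have mX := hm.measurable_X
  have mε := hm.measurable_ε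
  have mU := hm.measurable_U
  have mW : Measurable fun z : ℝ × ℝ × ℝ => ((z.1 - x, g z.1 + z.2.1), z.2.2) := by fun_prop
  have h0 : Integrable (fun ω => (g (X 0 ω) ^ 2 + τ2 (X 0 ω)) * gauss ρ' (X 0 ω - x)) P := by
    refine (hm.integrable_comp_X_iff hf
      (ψ := fun t => (g t ^ 2 + τ2 t) * gauss ρ' (t - x)) (by fun_prop)).2 ?_
    refine hint.congr (ae_of_all _ fun t => ?_)
    simp only
    ring
  -- Positivity of τ² makes each summand at most the sum, so integrability of g² + τ² splits.
  have hpos : ∀ᵐ ω ∂P, 0 < τ2 (X 0 ω) := ae_of_ae_map (mX 0).aemeasurable hm.cond_var_pos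
  have hg2 : Integrable (fun ω => g (X 0 ω) ^ 2 * gauss ρ' (X 0 ω - x)) P := by
    refine h0.mono' (Measurable.aestronglyMeasurable (by fun_prop)) ?_
    filter_upwards [hpos] with ω hω
    have hγ := gauss_nonneg ρ' (X 0 ω - x)
    rw [Real.norm_of_nonneg (by positivity)]
    exact mul_le_mul_of_nonneg_right (by linarith) hγ
  have ht2 : Integrable (fun ω => τ2 (X 0 ω) * gauss ρ' (X 0 ω - x)) P := by
    refine h0.mono' (Measurable.aestronglyMeasurable (by fun_prop)) ?_
    filter_upwards [hpos] with ω hω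
    have hγ := gauss_nonneg ρ' (X 0 ω - x)
    rw [Real.norm_of_nonneg (by positivity)]
    exact mul_le_mul_of_nonneg_right (by linarith [sq_nonneg (g (X 0 ω))]) hγ
  refine ⟨⟨fun i => by fun_prop, fun i => by fun_prop, mU, ?_, fun i => ?_, hm.law_U, ?_, ?_,
    hσ2⟩, hg2, ht2⟩
  · exact hm.indep.comp (fun _ => fun z : ℝ × ℝ × ℝ => ((z.1 - x, g z.1 + z.2.1), z.2.2))
      fun _ => mW
  · exact (hm.identDistrib i).comp mW
  · exact hm.indep_U.comp (φ := fun z : ℝ × ℝ => (z.1 - x, g z.1 + z.2)) (ψ := id)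
      (by fun_prop) measurable_id
  · have he := hm.integrable_sq_error hτ (ψ := fun t => gauss ρ' (t - x)) (by fun_prop) ht2
    refine ((hg2.add he).const_mul 2).mono' (Measurable.aestronglyMeasurable (by fun_prop))
      (ae_of_all _ fun ω => ?_)
    have hγ := gauss_nonneg ρ' (X 0 ω - x)
    rw [Real.norm_of_nonneg (by positivity), Pi.add_apply]
    nlinarith [mul_nonneg (sq_nonneg (g (X 0 ω) - ε 0 ω)) hγ]

end IsModel

/-! ### The limit functions as moments of the model -/

/-- The second derivative of a Gaussian-weighted moment in its centre is twice the derivative in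
its variance. -/
lemma iteratedDeriv_two_integral_gauss_sub {Ω : Type*} [MeasurableSpace Ω] {P : Measure Ω}
    {F X : Ω → ℝ} (hF : Measurable F) (hX : Measurable X) {x ρ ρ' : ℝ} (hρ : 0 < ρ)
    (hρ' : ρ < ρ') (hint : Integrable (fun ω => F ω * gauss ρ' (X ω - x)) P) :
    iteratedDeriv 2 (fun y => ∫ ω, F ω * gauss ρ (X ω - y) ∂P) x =
      2 * gaussMomentDeriv P F (fun ω => X ω - x) ρ := by
  have hT : Measurable fun ω => X ω - x := by fun_prop
  have h1 : ∀ y, HasDerivAt (fun y => ∫ ω, F ω * gauss ρ (X ω - y) ∂P)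
      (ρ⁻¹ * ∫ ω, F ω * ((X ω - y) ^ 1 * gauss ρ (X ω - y)) ∂P) y := fun y => by
    -- Domination is available for X − x, so the derivative is taken there at the shift y − x and
    -- translated back.
    have := (hasDerivAt_integral_pow_gauss_sub hF hT hint 0 hρ hρ' (y - x)).comp_sub_const y x
    refine (this.congr_deriv ?_).congr_of_eventuallyEq (Eventually.of_forall fun z => ?_)
    · rw [← integral_const_mul]
      refine integral_congr_ae (ae_of_all _ fun ω => ?_)
      simp only [sub_sub_sub_cancel_right]
      simp
      ring
    · simp
  have h2 : HasDerivAt (fun y => ρ⁻¹ * ∫ ω, F ω * ((X ω - y) ^ 1 * gauss ρ (X ω - y)) ∂P)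
      (2 * gaussMomentDeriv P F (fun ω => X ω - x) ρ) x := by
    have := ((hasDerivAt_integral_pow_gauss_sub hF hT hint 1 hρ hρ' (x - x)).comp_sub_const x
      x).const_mul ρ⁻¹
    refine (this.congr_deriv ?_).congr_of_eventuallyEq (Eventually.of_forall fun z => ?_)
    · rw [gaussMomentDeriv, ← integral_const_mul, ← integral_const_mul]
      refine integral_congr_ae (ae_of_all _ fun ω => ?_)
      simp
      field_simp
    · simp only [sub_sub_sub_cancel_right]
  rw [iteratedDeriv_succ, iteratedDeriv_one]
  rw [funext fun y => (h1 y).deriv]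
  exact h2.deriv

lemma coe_var_eq (σ2 lam : ℝ≥0) : (((1 + lam) * σ2 : ℝ≥0) : ℝ) = lam * σ2 + σ2 := by
  push_cast; ring

namespace IsModel

variable {Ω : Type*} [MeasurableSpace Ω] {P : Measure Ω} [IsProbabilityMeasure P]
  {X ε U : ℕ → Ω → ℝ} {σ2 : ℝ≥0} {fX τ2 m3 : ℝ → ℝ} {g : ℝ → ℝ}

lemma integral_mul_gauss_eq (hm : IsModel P X ε U σ2 fX τ2 m3) (hf : Measurable fX) {q : ℝ → ℝ}
    (hq : Measurable q) (lam : ℝ≥0) (y : ℝ) :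
    ∫ ω, q (X 0 ω) * gauss (lam * σ2 + σ2) (X 0 ω - y) ∂P =
      ∫ t, q t * fX t * gaussianPDFReal y ((1 + lam) * σ2) t := by
  rw [hm.integral_comp_X hf (ψ := fun t => q t * gauss (lam * σ2 + σ2) (t - y)) (by fun_prop)]
  refine integral_congr_ae (ae_of_all _ fun t => ?_)
  simp only [gaussianPDFReal_eq_gauss, coe_var_eq]
  ring

lemma fMom_eq (hm : IsModel P X ε U σ2 fX τ2 m3) (hf : Measurable fX) (j : ℕ) (lam : ℝ≥0) (y : ℝ) :
    fMom σ2 fX j lam y = ∫ ω, X 0 ω ^ j * gauss (lam * σ2 + σ2) (X 0 ω - y) ∂P :=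
  (hm.integral_mul_gauss_eq hf (q := fun t => t ^ j) (by fun_prop) lam y).symm

lemma gMom_eq (hm : IsModel P X ε U σ2 fX τ2 m3) (hf : Measurable fX) (hg : Measurable g) (j : ℕ)
    (lam : ℝ≥0) (y : ℝ) :
    gMom σ2 fX g j lam y =
      ∫ ω, X 0 ω ^ j * g (X 0 ω) * gauss (lam * σ2 + σ2) (X 0 ω - y) ∂P :=
  (hm.integral_mul_gauss_eq hf (q := fun t => t ^ j * g t) (by fun_prop) lam y).symm

lemma gSqMom_eq (hm : IsModel P X ε U σ2 fX τ2 m3) (hf : Measurable fX) (hg : Measurable g)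
    (j : ℕ) (lam : ℝ≥0) (y : ℝ) :
    gSqMom σ2 fX g j lam y =
      ∫ ω, X 0 ω ^ j * g (X 0 ω) ^ 2 * gauss (lam * σ2 + σ2) (X 0 ω - y) ∂P :=
  (hm.integral_mul_gauss_eq hf (q := fun t => t ^ j * g t ^ 2) (by fun_prop) lam y).symm

lemma tauMom_eq (hm : IsModel P X ε U σ2 fX τ2 m3) (hf : Measurable fX) (hτ : Measurable τ2)
    (j : ℕ) (lam : ℝ≥0) (y : ℝ) :
    tauMom σ2 fX τ2 j lam y =
      ∫ ω, X 0 ω ^ j * τ2 (X 0 ω) * gauss (lam * σ2 + σ2) (X 0 ω - y) ∂P :=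
  (hm.integral_mul_gauss_eq hf (q := fun t => t ^ j * τ2 t) (by fun_prop) lam y).symm

lemma integral_response (hm : IsModel P X ε U σ2 fX τ2 m3) {ψ : ℝ → ℝ} (hψ : Measurable ψ)
    (h1 : Integrable (fun ω => g (X 0 ω) * ψ (X 0 ω)) P)
    (h2 : Integrable (fun ω => (g (X 0 ω) + ε 0 ω) * ψ (X 0 ω)) P) :
    ∫ ω, (g (X 0 ω) + ε 0 ω) * ψ (X 0 ω) ∂P = ∫ ω, g (X 0 ω) * ψ (X 0 ω) ∂P := by
  have h3 : Integrable (fun ω => ε 0 ω * ψ (X 0 ω)) P :=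
    (h2.sub h1).congr (ae_of_all _ fun ω => by simp only [Pi.sub_apply]; ring)
  have h4 := integral_add h1 h3
  rw [hm.integral_error hψ h3, add_zero] at h4
  rw [← h4]
  refine integral_congr_ae (ae_of_all _ fun ω => ?_)
  simp only
  ring

/-- The cross term has mean zero given X; it is integrable because 2|gε| ≤ g² + ε². -/
lemma integral_response_sq (hm : IsModel P X ε U σ2 fX τ2 m3) (hg : Measurable g)
    (hτ : Measurable τ2) {ψ : ℝ → ℝ} (hψ : Measurable ψ) (hψ0 : ∀ t, 0 ≤ ψ t)
    (h1 : Integrable (fun ω => g (X 0 ω) ^ 2 * ψ (X 0 ω)) P)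
    (h2 : Integrable (fun ω => τ2 (X 0 ω) * ψ (X 0 ω)) P) :
    ∫ ω, (g (X 0 ω) + ε 0 ω) ^ 2 * ψ (X 0 ω) ∂P =
      ∫ ω, g (X 0 ω) ^ 2 * ψ (X 0 ω) ∂P + ∫ ω, τ2 (X 0 ω) * ψ (X 0 ω) ∂P := by
  have mX := hm.measurable_X 0
  have mε := hm.measurable_ε 0
  have h3 := hm.integrable_sq_error hτ hψ h2
  have h4 : Integrable (fun ω => ε 0 ω * (2 * g (X 0 ω) * ψ (X 0 ω))) P := by
    refine (h1.add h3).mono' (Measurable.aestronglyMeasurable (by fun_prop))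
      (ae_of_all _ fun ω => ?_)
    rw [Pi.add_apply, Real.norm_eq_abs, abs_le]
    have := hψ0 (X 0 ω)
    constructor <;>
      nlinarith [mul_nonneg (sq_nonneg (g (X 0 ω) - ε 0 ω)) this,
        mul_nonneg (sq_nonneg (g (X 0 ω) + ε 0 ω)) this]
  have h5 := hm.integral_error (ψ := fun t => 2 * g t * ψ t) (by fun_prop) h4
  have h6 := integral_add (h1.add h4) h3
  rw [integral_add' h1 h4, h5, add_zero, hm.integral_sq_error hτ hψ h2] at h6
  rw [← h6]
  refine integral_congr_ae (ae_of_all _ fun ω => ?_)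
  simp only [Pi.add_apply]
  ring

section

variable {x ρ' : ℝ}

lemma gaussMoment_one_zero (hm : IsModel P X ε U σ2 fX τ2 m3) (hf : Measurable fX) (lam : ℝ≥0) :
    gaussMoment P (fun _ => 1) (fun ω => X 0 ω - x) 0 (lam * σ2 + σ2) = fMom σ2 fX 0 lam x := by
  simp [gaussMoment, hm.fMom_eq hf]

lemma gaussMoment_one_one (hm : IsModel P X ε U σ2 fX τ2 m3) (hf : Measurable fX) (lam : ℝ≥0)
    (hσ2 : 0 < σ2) :
    gaussMoment P (fun _ => 1) (fun ω => X 0 ω - x) 1 (lam * σ2 + σ2) =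
      fMom σ2 fX 1 lam x - x * fMom σ2 fX 0 lam x := by
  have mX := hm.measurable_X 0
  have hσ : (0 : ℝ) < σ2 := hσ2
  have hρ : 0 < (lam * σ2 + σ2 : ℝ) := by positivity
  have mT : Measurable fun ω => X 0 ω - x := by fun_prop
  have i0 : Integrable (fun ω => gauss (lam * σ2 + σ2) (X 0 ω - x)) P :=
    integrable_gauss_comp mT hρ.le
  have i1 := integrable_mul_pow_gauss (P := P) measurable_const mT
    (integrable_one_mul_gauss mT (show 0 ≤ (lam * σ2 + σ2 : ℝ) + 1 by positivity)) 1 hρ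
    (lt_add_one _)
  have h := integral_add i1 (i0.const_mul x)
  rw [integral_const_mul x] at h
  rw [hm.fMom_eq hf, hm.fMom_eq hf, gaussMoment, eq_sub_iff_add_eq]
  simp only [pow_zero, one_mul] at h ⊢
  rw [← h]
  refine integral_congr_ae (ae_of_all _ fun ω => ?_)
  simp only
  ring

lemma gaussMomentDeriv_one (hm : IsModel P X ε U σ2 fX τ2 m3) (hf : Measurable fX) (lam : ℝ≥0)
    (hσ2 : 0 < σ2) :
    2 * gaussMomentDeriv P (fun _ => 1) (fun ω => X 0 ω - x) (lam * σ2 + σ2) =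
      iteratedDeriv 2 (fMom σ2 fX 0 lam) x := by
  have mX := hm.measurable_X 0
  have hσ : (0 : ℝ) < σ2 := hσ2
  have hρ : 0 < (lam * σ2 + σ2 : ℝ) := by positivity
  rw [← iteratedDeriv_two_integral_gauss_sub measurable_const mX hρ (lt_add_one _)
    (integrable_one_mul_gauss (by fun_prop) (by positivity))]
  congr 1
  ext y
  simp [hm.fMom_eq hf]

lemma integrable_response (hm : IsModel P X ε U σ2 fX τ2 m3) (hg : Measurable g) (hρ' : 0 < ρ')
    (hg2 : Integrable (fun ω => g (X 0 ω) ^ 2 * gauss ρ' (X 0 ω - x)) P) :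
    Integrable (fun ω => g (X 0 ω) * gauss (2 * ρ') (X 0 ω - x)) P := by
  have mX := hm.measurable_X 0
  exact integrable_mul_gauss_two_mul (by fun_prop) (by fun_prop) hρ' hg2

lemma gaussMoment_response (hm : IsModel P X ε U σ2 fX τ2 m3) (hg : Measurable g) (hρ' : 0 < ρ')
    (hS : IsSample P (fun i ω => X i ω - x) (fun i ω => g (X i ω) + ε i ω) U σ2 ρ')
    (hg2 : Integrable (fun ω => g (X 0 ω) ^ 2 * gauss ρ' (X 0 ω - x)) P) (j : ℕ) {ρ : ℝ}
    (hρ : 0 < ρ) (hρ2 : ρ < 2 * ρ') :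
    gaussMoment P (fun ω => g (X 0 ω) + ε 0 ω) (fun ω => X 0 ω - x) j ρ =
      gaussMoment P (fun ω => g (X 0 ω)) (fun ω => X 0 ω - x) j ρ := by
  have mX := hm.measurable_X 0
  have mε := hm.measurable_ε 0
  exact hm.integral_response (ψ := fun t => (t - x) ^ j * gauss ρ (t - x)) (by fun_prop)
    (integrable_mul_pow_gauss (by fun_prop) (by fun_prop) (hm.integrable_response hg hρ' hg2) j hρ
      hρ2)
    (integrable_mul_pow_gauss (by fun_prop) (by fun_prop) (hS.integrable_mul_gauss_two hρ') j hρ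
      hρ2)

lemma gaussMoment_response_zero (hm : IsModel P X ε U σ2 fX τ2 m3) (hf : Measurable fX)
    (hg : Measurable g) (hσ2 : 0 < σ2)
    (hS : IsSample P (fun i ω => X i ω - x) (fun i ω => g (X i ω) + ε i ω) U σ2 ρ')
    (hg2 : Integrable (fun ω => g (X 0 ω) ^ 2 * gauss ρ' (X 0 ω - x)) P) {lam : ℝ≥0}
    (hρ : (lam * σ2 : ℝ) / 2 + σ2 < ρ') :
    gaussMoment P (fun ω => g (X 0 ω) + ε 0 ω) (fun ω => X 0 ω - x) 0 (lam * σ2 + σ2) =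
      gMom σ2 fX g 0 lam x := by
  have hσ : (0 : ℝ) < σ2 := hσ2
  have h0 : 0 ≤ (lam * σ2 : ℝ) := by positivity
  rw [hm.gaussMoment_response hg (by linarith) hS hg2 0 (by positivity) (by linarith)]
  simp [gaussMoment, hm.gMom_eq hf hg]

lemma gaussMoment_response_one (hm : IsModel P X ε U σ2 fX τ2 m3) (hf : Measurable fX)
    (hg : Measurable g) (hσ2 : 0 < σ2)
    (hS : IsSample P (fun i ω => X i ω - x) (fun i ω => g (X i ω) + ε i ω) U σ2 ρ')
    (hg2 : Integrable (fun ω => g (X 0 ω) ^ 2 * gauss ρ' (X 0 ω - x)) P) {lam : ℝ≥0}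
    (hρ : (lam * σ2 : ℝ) / 2 + σ2 < ρ') :
    gaussMoment P (fun ω => g (X 0 ω) + ε 0 ω) (fun ω => X 0 ω - x) 1 (lam * σ2 + σ2) =
      gMom σ2 fX g 1 lam x - x * gMom σ2 fX g 0 lam x := by
  have mX := hm.measurable_X 0
  have hσ : (0 : ℝ) < σ2 := hσ2
  have h0 : 0 ≤ (lam * σ2 : ℝ) := by positivity
  have hρ0 : 0 < (lam * σ2 + σ2 : ℝ) := by positivity
  have hi := hm.integrable_response hg (by linarith) hg2
  have mT : Measurable fun ω => X 0 ω - x := by fun_prop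
  have mgX : Measurable fun ω => g (X 0 ω) := by fun_prop
  have hlt : (lam * σ2 + σ2 : ℝ) < 2 * ρ' := by linarith
  rw [hm.gaussMoment_response hg (by linarith) hS hg2 1 hρ0 hlt]
  have i0 := integrable_mul_gauss mgX mT hi hρ0 hlt
  have i1 := integrable_mul_pow_gauss mgX mT hi 1 hρ0 hlt
  have h := integral_add i1 (i0.const_mul x)
  rw [integral_const_mul] at h
  rw [hm.gMom_eq hf hg, hm.gMom_eq hf hg, gaussMoment, eq_sub_iff_add_eq]
  simp only [pow_zero, one_mul] at h ⊢
  rw [← h]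
  refine integral_congr_ae (ae_of_all _ fun ω => ?_)
  simp only
  ring

lemma gaussMomentDeriv_response (hm : IsModel P X ε U σ2 fX τ2 m3) (hf : Measurable fX)
    (hg : Measurable g) (hσ2 : 0 < σ2)
    (hS : IsSample P (fun i ω => X i ω - x) (fun i ω => g (X i ω) + ε i ω) U σ2 ρ')
    (hg2 : Integrable (fun ω => g (X 0 ω) ^ 2 * gauss ρ' (X 0 ω - x)) P) {lam : ℝ≥0}
    (hρ : (lam * σ2 : ℝ) / 2 + σ2 < ρ') :
    2 * gaussMomentDeriv P (fun ω => g (X 0 ω) + ε 0 ω) (fun ω => X 0 ω - x) (lam * σ2 + σ2) =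
      iteratedDeriv 2 (gMom σ2 fX g 0 lam) x := by
  have mX := hm.measurable_X 0
  have mε := hm.measurable_ε 0
  have hσ : (0 : ℝ) < σ2 := hσ2
  have h0 : 0 ≤ (lam * σ2 : ℝ) := by positivity
  have hρ' : 0 < ρ' := by linarith
  have hρ0 : 0 < (lam * σ2 + σ2 : ℝ) := by positivity
  have hlt : (lam * σ2 + σ2 : ℝ) < 2 * ρ' := by linarith
  have mT : Measurable fun ω => X 0 ω - x := by fun_prop
  have mgX : Measurable fun ω => g (X 0 ω) := by fun_prop
  have hi := hm.integrable_response hg hρ' hg2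
  have e : gMom σ2 fX g 0 lam =
      fun y => ∫ ω, g (X 0 ω) * gauss (lam * σ2 + σ2) (X 0 ω - y) ∂P := by
    ext y
    simp [hm.gMom_eq hf hg]
  rw [e, iteratedDeriv_two_integral_gauss_sub mgX mX hρ0 hlt hi]
  have d1 := hasDerivAt_gaussMoment_zero (mgX.add mε) mT (hS.integrable_mul_gauss_two hρ') hρ0 hlt
  have d2 := hasDerivAt_gaussMoment_zero mgX mT hi hρ0 hlt
  congr 1
  -- The moments of Y and of g(X) agree for all variances near this one, hence so do their
  -- derivatives.
  refine d1.unique (d2.congr_of_eventuallyEq ?_)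
  filter_upwards [lt_mem_nhds hρ0, gt_mem_nhds hlt] with r hr hr'
  exact hm.gaussMoment_response hg hρ' hS hg2 0 hr hr'

/-- The heat equation produces the factor 2 in the first denominator, and ρ² = (λ + 1)²σ_u⁴ gives
the second. Centring at x drops out of g₀f₁ − f₀g₁. -/
lemma momentBias_eq_bias (hm : IsModel P X ε U σ2 fX τ2 m3) (hf : Measurable fX)
    (hg : Measurable g) (hσ2 : 0 < σ2)
    (hS : IsSample P (fun i ω => X i ω - x) (fun i ω => g (X i ω) + ε i ω) U σ2 ρ')
    (hg2 : Integrable (fun ω => g (X 0 ω) ^ 2 * gauss ρ' (X 0 ω - x)) P) {lam : ℝ≥0}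
    (hρ : (lam * σ2 : ℝ) / 2 + σ2 < ρ') :
    momentBias P (fun ω => X 0 ω - x) (fun ω => g (X 0 ω) + ε 0 ω) (lam * σ2 + σ2) =
      bias σ2 fX g lam x := by
  have hσ : (0 : ℝ) < σ2 := hσ2
  rw [bias, ← hm.gaussMomentDeriv_one hf lam hσ2,
    ← hm.gaussMomentDeriv_response hf hg hσ2 hS hg2 hρ, momentBias,
    hm.gaussMoment_one_zero hf, hm.gaussMoment_one_one hf lam hσ2,
    hm.gaussMoment_response_zero hf hg hσ2 hS hg2 hρ,
    hm.gaussMoment_response_one hf hg hσ2 hS hg2 hρ]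
  have hpos : 0 < fMom σ2 fX 0 lam x := by
    rw [← hm.gaussMoment_one_zero hf]
    exact gaussMoment_one_pos ((hm.measurable_X 0).sub_const x) (by positivity)
  congr 1
  · field_simp
  · have : (lam * σ2 + σ2 : ℝ) ^ 2 = (lam + 1) ^ 2 * σ2 ^ 2 := by ring
    rw [this]
    congr 1
    ring

lemma integral_affine_mul_affine (hm : IsModel P X ε U σ2 fX τ2 m3) (hf : Measurable fX)
    (hg : Measurable g) (hτ : Measurable τ2) (hσ2 : 0 < σ2)
    (hS : IsSample P (fun i ω => X i ω - x) (fun i ω => g (X i ω) + ε i ω) U σ2 ρ')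
    (hg2 : Integrable (fun ω => g (X 0 ω) ^ 2 * gauss ρ' (X 0 ω - x)) P)
    (ht2 : Integrable (fun ω => τ2 (X 0 ω) * gauss ρ' (X 0 ω - x)) P) {κ : ℝ≥0}
    (hρ : (κ * σ2 + σ2 : ℝ) < ρ') (a b c d : ℝ) :
    ∫ ω, (a * (g (X 0 ω) + ε 0 ω) + b) * (c * (g (X 0 ω) + ε 0 ω) + d) *
        gauss (κ * σ2 + σ2) (X 0 ω - x) ∂P =
      a * c * (gSqMom σ2 fX g 0 κ x + tauMom σ2 fX τ2 0 κ x) +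
        (a * d + b * c) * gMom σ2 fX g 0 κ x + b * d * fMom σ2 fX 0 κ x := by
  have mX := hm.measurable_X 0
  have mε := hm.measurable_ε 0
  have hσ : (0 : ℝ) < σ2 := hσ2
  have h0 : 0 ≤ (κ * σ2 : ℝ) := by positivity
  have hρ0 : 0 < (κ * σ2 + σ2 : ℝ) := by positivity
  have mT : Measurable fun ω => X 0 ω - x := by fun_prop
  have i0 : Integrable (fun ω => gauss (κ * σ2 + σ2) (X 0 ω - x)) P :=
    integrable_gauss_comp mT hρ0.le
  have i1 : Integrable (fun ω => (g (X 0 ω) + ε 0 ω) * gauss (κ * σ2 + σ2) (X 0 ω - x)) P :=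
    integrable_mul_gauss (by fun_prop) mT (hS.integrable_mul_gauss_two (by linarith)) hρ0
      (by linarith)
  have i2 : Integrable (fun ω => (g (X 0 ω) + ε 0 ω) ^ 2 * gauss (κ * σ2 + σ2) (X 0 ω - x)) P :=
    integrable_mul_gauss (by fun_prop) mT hS.integrable_sq hρ0 hρ
  have e1 : ∫ ω, (g (X 0 ω) + ε 0 ω) * gauss (κ * σ2 + σ2) (X 0 ω - x) ∂P =
      gMom σ2 fX g 0 κ x := by
    rw [← hm.gaussMoment_response_zero hf hg hσ2 hS hg2 (by linarith)]
    simp [gaussMoment]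
  have e2 : ∫ ω, (g (X 0 ω) + ε 0 ω) ^ 2 * gauss (κ * σ2 + σ2) (X 0 ω - x) ∂P =
      gSqMom σ2 fX g 0 κ x + tauMom σ2 fX τ2 0 κ x := by
    rw [hm.integral_response_sq hg hτ (ψ := fun t => gauss (κ * σ2 + σ2) (t - x)) (by fun_prop)
      (fun _ => gauss_nonneg _ _) (integrable_mul_gauss (by fun_prop) mT hg2 hρ0 hρ)
      (integrable_mul_gauss (by fun_prop) mT ht2 hρ0 hρ), hm.gSqMom_eq hf hg, hm.tauMom_eq hf hτ]
    simp
  have h := integral_add ((i2.const_mul (a * c)).add (i1.const_mul (a * d + b * c)))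
    (i0.const_mul (b * d))
  rw [integral_add' (i2.const_mul _) (i1.const_mul _), integral_const_mul, integral_const_mul,
    integral_const_mul, e1, e2] at h
  rw [hm.fMom_eq hf]
  simp only [pow_zero, one_mul]
  rw [← h]
  refine integral_congr_ae (ae_of_all _ fun ω => ?_)
  simp only [Pi.add_apply]
  ring

end

end IsModel

/-! ### Growth of functions with a Gaussian square integrable derivative -/

/-- η(t) − η(x) is the integral of η' over [x, t]. Between 0 and t − x the Gaussian weight is at
least a constant times exp(−(t − x)²/(2σ_u²)), and balancing the square integrable part against this
loss costs only its square root. -/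
lemma exists_abs_le_of_memLp_deriv {η : ℝ → ℝ} (hη : ContDiff ℝ 1 η) {x : ℝ} {σ2 : ℝ≥0}
    (hσ2 : 0 < σ2) (hL : MemLp (fun t => deriv η (t + x)) 2 (gaussianReal 0 σ2)) :
    ∃ A B : ℝ, ∀ t, |η t| ≤ |η x| + Real.exp ((t - x) ^ 2 / (4 * σ2)) * (A + B * |t - x|) := by
  have hσ : (0 : ℝ) < σ2 := hσ2
  have hd : Continuous (deriv η) := hη.continuous_deriv le_rfl
  have hI : Integrable (fun u => deriv η (u + x) ^ 2 * gauss σ2 u) := by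
    have h1 := hL.integrable_sq
    rw [gaussianReal_of_var_ne_zero _ hσ2.ne'] at h1
    have h2 := (integrable_withDensity_iff (measurable_gaussianPDF 0 σ2)
      (ae_of_all _ fun _ => gaussianPDF_lt_top)).1 h1
    refine h2.congr (ae_of_all _ fun u => ?_)
    simp only [toReal_gaussianPDF, gaussianPDFReal_eq_gauss, sub_zero]
  refine ⟨∫ u, deriv η (u + x) ^ 2 * gauss σ2 u, √(2 * Real.pi * σ2), fun t => ?_⟩
  set τ := t - x
  set θ := Real.exp (τ ^ 2 / (4 * σ2)) with hθ
  have hθ0 : 0 < θ := Real.exp_pos _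
  have hftc : η t - η x = ∫ u in (0 : ℝ)..τ, deriv η (u + x) := by
    rw [intervalIntegral.integral_comp_add_right (fun u => deriv η u),
      intervalIntegral.integral_deriv_eq_sub' η rfl (fun u _ => hη.differentiable one_ne_zero u)
        hd.continuousOn]
    simp [τ]
  have hpt : ∀ u ∈ Set.uIoc 0 τ, ‖deriv η (u + x)‖ ≤
      θ * (deriv η (u + x) ^ 2 * gauss σ2 u) + θ * √(2 * Real.pi * σ2) := by
    intro u hu
    have hu2 : u ^ 2 ≤ τ ^ 2 := by
      rcases Set.mem_uIoc.1 hu with h | h <;> nlinarith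
    set b := |deriv η (u + x)| with hb
    set γ := gauss σ2 u
    have hγ : 0 < γ := gauss_pos hσ u
    have hγ' : γ⁻¹ ≤ √(2 * Real.pi * σ2) * θ ^ 2 := by
      simp only [γ, gauss, mul_inv, inv_inv, ← Real.exp_neg, hθ, ← Real.exp_nat_mul]
      gcongr
      rw [neg_div, neg_neg]
      calc u ^ 2 / (2 * σ2) ≤ τ ^ 2 / (2 * σ2) := by gcongr
        _ = _ := by push_cast; field_simp; norm_num
    -- Arithmetic-geometric mean with weight θ; as γ⁻¹ is at most a multiple of θ², both terms grow
    -- like θ.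
    have h1 : b ≤ θ * (b ^ 2 * γ) + θ⁻¹ * γ⁻¹ := by
      have h2 : θ * (b ^ 2 * γ) + θ⁻¹ * γ⁻¹ - b =
          ((θ * γ * b - 1) ^ 2 + θ * γ * b) / (θ * γ) := by
        field_simp
        ring
      have : 0 ≤ ((θ * γ * b - 1) ^ 2 + θ * γ * b) / (θ * γ) := by positivity
      linarith
    rw [Real.norm_eq_abs, ← sq_abs]
    refine h1.trans (add_le_add le_rfl ?_)
    calc θ⁻¹ * γ⁻¹ ≤ θ⁻¹ * (√(2 * Real.pi * σ2) * θ ^ 2) := by gcongr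
      _ = _ := by field_simp
  have hvol : volume.real (Set.uIoc 0 τ) = |τ| := by
    rw [Set.uIoc, Measure.real, Real.volume_Ioc, ENNReal.toReal_ofReal (by simp),
      max_sub_min_eq_abs]
    simp
  have hI1 : IntegrableOn (fun u => θ * (deriv η (u + x) ^ 2 * gauss σ2 u)) (Set.uIoc 0 τ) :=
    (hI.const_mul θ).integrableOn
  have hI2 : IntegrableOn (fun _ : ℝ => θ * √(2 * Real.pi * σ2)) (Set.uIoc 0 τ) :=
    integrableOn_const (by simp [Set.uIoc])
  have hbound : |η t - η x| ≤ θ * ((∫ u, deriv η (u + x) ^ 2 * gauss σ2 u) +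
      √(2 * Real.pi * σ2) * |τ|) := by
    rw [hftc, ← Real.norm_eq_abs]
    calc _ ≤ ∫ u in Set.uIoc 0 τ, ‖deriv η (u + x)‖ :=
          intervalIntegral.norm_integral_le_integral_norm_uIoc
      _ ≤ ∫ u in Set.uIoc 0 τ, (θ * (deriv η (u + x) ^ 2 * gauss σ2 u) +
            θ * √(2 * Real.pi * σ2)) := by
          refine setIntegral_mono_on ?_ (hI1.add hI2) measurableSet_uIoc hpt
          exact ((hd.comp (continuous_id.add continuous_const)).norm.intervalIntegrable 0
            τ).def'
      _ = (∫ u in Set.uIoc 0 τ, θ * (deriv η (u + x) ^ 2 * gauss σ2 u)) +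
            |τ| * (θ * √(2 * Real.pi * σ2)) := by
          rw [integral_add hI1 hI2, setIntegral_const, hvol, smul_eq_mul]
      _ ≤ (∫ u, θ * (deriv η (u + x) ^ 2 * gauss σ2 u)) + |τ| * (θ * √(2 * Real.pi * σ2)) := by
          refine add_le_add (setIntegral_le_integral (hI.const_mul θ) (ae_of_all _ fun u => ?_))
            le_rfl
          have := gauss_nonneg σ2 u
          simp only [Pi.zero_apply]
          positivity
      _ = _ := by rw [integral_const_mul]; ring
  have := abs_sub_abs_le_abs_sub (η t) (η x)
  linarith

/-- For ρ < 2σ_u² the density decays faster than exp((t − x)²/(4σ_u²)) grows. -/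
lemma exists_abs_mul_gauss_le {η : ℝ → ℝ} (hη : ContDiff ℝ 1 η) {x : ℝ} {σ2 : ℝ≥0}
    (hσ2 : 0 < σ2) (hL : MemLp (fun t => deriv η (t + x)) 2 (gaussianReal 0 σ2)) {ρ : ℝ}
    (hρ : 0 < ρ) (hρσ : ρ < 2 * σ2) : ∃ C, ∀ t, |η t| * gauss ρ (t - x) ≤ C := by
  obtain ⟨A, B, hAB⟩ := exists_abs_le_of_memLp_deriv hη hσ2 hL
  have hσ : (0 : ℝ) < σ2 := hσ2
  have hc : 0 < 1 / (2 * ρ) - 1 / (4 * σ2) :=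
    sub_pos.2 (one_div_lt_one_div_of_lt (by positivity) (by linarith))
  obtain ⟨C₀, hC₀, h0⟩ := exists_pow_mul_exp_neg_le 0 hc
  obtain ⟨C₁, hC₁, h1⟩ := exists_pow_mul_exp_neg_le 1 hc
  set κ := (√(2 * Real.pi * ρ))⁻¹
  have hκ : 0 ≤ κ := by positivity
  refine ⟨|η x| * κ + κ * (|A| * C₀ + |B| * C₁), fun t => ?_⟩
  set τ := t - x
  have h0 := h0 τ
  have h1 := h1 τ
  have he : Real.exp (τ ^ 2 / (4 * σ2)) * gauss ρ τ =
      κ * Real.exp (-((1 / (2 * ρ) - 1 / (4 * σ2)) * τ ^ 2)) := by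
    rw [gauss, mul_left_comm, ← Real.exp_add]
    congr 2
    field_simp
    ring
  have hg := gauss_nonneg ρ τ
  calc |η t| * gauss ρ τ
      ≤ (|η x| + Real.exp (τ ^ 2 / (4 * σ2)) * (|A| + |B| * |τ|)) * gauss ρ τ := by
        refine mul_le_mul_of_nonneg_right ((hAB t).trans ?_) hg
        gcongr <;> exact le_abs_self _
    _ = |η x| * gauss ρ τ + (|A| + |B| * |τ|) * (Real.exp (τ ^ 2 / (4 * σ2)) * gauss ρ τ) := by
        ring
    _ = |η x| * gauss ρ τ + κ * (|A| * (|τ| ^ 0 *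
          Real.exp (-((1 / (2 * ρ) - 1 / (4 * σ2)) * τ ^ 2))) + |B| * (|τ| ^ 1 *
          Real.exp (-((1 / (2 * ρ) - 1 / (4 * σ2)) * τ ^ 2)))) := by rw [he]; ring
    _ ≤ _ := by
        have := gauss_le ρ τ hρ.le
        gcongr

/-- The smoothness conditions bound (g² + τ²)φ_ρ, and f_X is integrable. This supplies the
domination when no positive λ is present. -/
lemma IsModel.integrable_of_isRegular {Ω : Type*} [MeasurableSpace Ω] {P : Measure Ω}
    [IsProbabilityMeasure P] {X ε U : ℕ → Ω → ℝ} {σ2 : ℝ≥0} {fX τ2 m3 g : ℝ → ℝ}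
    (hm : IsModel P X ε U σ2 fX τ2 m3) (hσ2 : 0 < σ2)
    (hreg : IsRegular (P.map (X 0)).support σ2 fX g τ2 m3) {x : ℝ}
    (hx : x ∈ (P.map (X 0)).support) {ρ : ℝ} (hρ : 0 < ρ) (hρσ : ρ < 2 * σ2) :
    Integrable (fun t => (g t ^ 2 + τ2 t) * fX t * gauss ρ (t - x)) := by
  have mf := hreg.contDiff_fX.continuous.measurable
  have mg := hreg.contDiff_g.continuous.measurable
  have mτ := hreg.contDiff_τ2.continuous.measurable
  obtain ⟨C, hC⟩ := exists_abs_mul_gauss_le (η := fun t => g t ^ 2)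
    ((hreg.contDiff_g.pow 2).of_le (by norm_num)) hσ2
    (hreg.memLp_deriv x hx (fun t => g t ^ 2) (by simp)).1 hρ hρσ
  obtain ⟨D, hD⟩ := exists_abs_mul_gauss_le (hreg.contDiff_τ2.of_le (by norm_num)) hσ2
    (hreg.memLp_deriv x hx τ2 (by simp)).1 hρ hρσ
  have hf : Integrable fX := by
    simpa using (hm.integrable_comp_X_iff mf (ψ := fun _ => 1) measurable_const).1
      (integrable_const _)
  refine (hf.const_mul (C + D)).mono' (Measurable.aestronglyMeasurable (by fun_prop))
    (ae_of_all _ fun t => ?_)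
  have h1 := hC t
  have h2 := hD t
  have hγ := gauss_nonneg ρ (t - x)
  have h3 : |g t ^ 2 + τ2 t| * gauss ρ (t - x) ≤ C + D := by
    nlinarith [mul_le_mul_of_nonneg_right (abs_add_le (g t ^ 2) (τ2 t)) hγ]
  rw [Real.norm_eq_abs, abs_mul, abs_mul, abs_of_nonneg hγ, abs_of_nonneg (hm.density_nonneg t)]
  nlinarith [mul_le_mul_of_nonneg_right h3 (hm.density_nonneg t)]

/-! ### Joint asymptotic normality of the estimators -/

namespace IsSample

variable {Ω : Type*} [MeasurableSpace Ω] {P : Measure Ω} [IsProbabilityMeasure P]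
  {T Y U : ℕ → Ω → ℝ} {σ2 : ℝ≥0} {ρ' : ℝ}

lemma integral_affine_mul_gauss (hS : IsSample P T Y U σ2 ρ') (hρ' : 0 < ρ') {ρ : ℝ} (hρ : 0 < ρ)
    (hρ2 : ρ < 2 * ρ') (c d : ℝ) :
    ∫ ω, (d * Y 0 ω + c) * gauss ρ (T 0 ω) ∂P =
      d * gaussMoment P (Y 0) (T 0) 0 ρ + c * gaussMoment P (fun _ => 1) (T 0) 0 ρ := by
  have mT := hS.measurable_T 0
  have i1 := integrable_mul_gauss (hS.measurable_Y 0) mT (hS.integrable_mul_gauss_two hρ') hρ hρ2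
  have i0 : Integrable (fun ω => gauss ρ (T 0 ω)) P := integrable_gauss_comp mT hρ.le
  have h := integral_add (i1.const_mul d) (i0.const_mul c)
  rw [integral_const_mul, integral_const_mul] at h
  simp only [gaussMoment, pow_zero, one_mul]
  rw [← h]
  refine integral_congr_ae (ae_of_all _ fun ω => ?_)
  simp only
  ring

/-- The normalized error of the estimator is asymptotically a centred average. -/
lemma tendsto_gHat_sub_avg (hS : IsSample P T Y U σ2 ρ') (lam : ℝ≥0)
    (hρ : (lam * σ2 : ℝ) / 2 + σ2 < ρ') {h : ℕ → ℝ} (hh : IsBandwidth h) {R : ℕ → ℝ}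
    (hRtop : Tendsto R atTop atTop) {D : ℝ}
    (hR : ∀ n, R n ^ 2 ≤ D * (n * √((lam * σ2 : ℝ) + h n ^ 2))) (x : ℝ) {f k c d : ℝ}
    (hf : gaussMoment P (fun _ => 1) (T 0) 0 (lam * σ2 + σ2) = f)
    (hk : gaussMoment P (Y 0) (T 0) 0 (lam * σ2 + σ2) = k) (hd : d = 1 / f)
    (hc : c = -(k / f ^ 2)) :
    Tendsto (fun z : ℕ × Ω => R z.1 * (gHat σ2 lam (h z.1) z.1
          (fun i => x + (T i z.2 + U i z.2)) (fun i => Y i z.2) x -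
          centering P (T 0) (Y 0) (lam * σ2 + σ2) (h z.1 ^ 2)) -
        R z.1 * (avg z.1 (fun i => T i z.2 + U i z.2) (fun i => Y i z.2)
              (fun y a => (d * y + c) * gauss (lam * σ2 + h z.1 ^ 2) a) -
            ∫ ω, (d * Y 0 ω + c) * gauss (lam * σ2 + h z.1 ^ 2) (T 0 ω + U 0 ω) ∂P))
      (probFilter P) (𝓝 0) := by
  have main := hS.tendsto_gHat_sub lam hρ hh hRtop hR x
  rw [hf, hk, ← hd, ← hc] at main
  have mT := hS.measurable_T 0
  have mU := hS.measurable_U 0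
  have hσ : (0 : ℝ) < σ2 := NNReal.coe_pos.2 hS.var_pos
  have hs : 0 ≤ (lam * σ2 : ℝ) := by positivity
  have hρ' : 0 < ρ' := by linarith
  have hu : Tendsto (fun n => lam * σ2 + h n ^ 2 + σ2 : ℕ → ℝ) atTop (𝓝 (lam * σ2 + σ2)) := by
    have hh2 : Tendsto (fun n => h n ^ 2) atTop (𝓝 0) := by simpa using hh.tendsto_zero.pow 2
    simpa using (hh2.const_add (lam * σ2 : ℝ)).add_const (σ2 : ℝ)
  refine main.congr' ?_
  have hlt : (lam * σ2 + σ2 : ℝ) < 2 * ρ' := by linarith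
  filter_upwards [tendsto_fst_probFilter.eventually (hu.eventually (gt_mem_nhds hlt))] with z hz
  have hpos := hh.pos z.1
  have hr : 0 < (lam * σ2 + h z.1 ^ 2 : ℝ) := by positivity
  have i1 := integrable_mul_gauss_add hS.measurable_W mU hS.indep_U hS.law_U (F := Prod.snd)
    (by fun_prop) hr (integrable_mul_gauss (hS.measurable_Y 0) mT
      (hS.integrable_mul_gauss_two hρ') (by positivity) hz)
  have i0 : Integrable (fun ω => gauss (lam * σ2 + h z.1 ^ 2) (T 0 ω + U 0 ω)) P :=
    integrable_gauss_comp (mT.add mU) hr.le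
  have e1 : ∫ ω, (d * Y 0 ω + c) * gauss (lam * σ2 + h z.1 ^ 2) (T 0 ω + U 0 ω) ∂P =
      d * ∫ ω, Y 0 ω * gauss (lam * σ2 + h z.1 ^ 2) (T 0 ω + U 0 ω) ∂P +
        c * ∫ ω, gauss (lam * σ2 + h z.1 ^ 2) (T 0 ω + U 0 ω) ∂P := by
    have h := integral_add (i1.const_mul d) (i0.const_mul c)
    rw [integral_const_mul, integral_const_mul] at h
    rw [← h]
    refine integral_congr_ae (ae_of_all _ fun ω => ?_)
    simp only
    ring
  have e2 : avg z.1 (fun i => T i z.2 + U i z.2) (fun i => Y i z.2)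
        (fun y a => (d * y + c) * gauss (lam * σ2 + h z.1 ^ 2) a) =
      d * avg z.1 (fun i => T i z.2 + U i z.2) (fun i => Y i z.2)
        (fun y a => y * gauss (lam * σ2 + h z.1 ^ 2) a) +
      c * avg z.1 (fun i => T i z.2 + U i z.2) (fun i => Y i z.2)
        (fun _ a => gauss (lam * σ2 + h z.1 ^ 2) a) := by
    simp only [avg, add_mul, Finset.sum_add_distrib, mul_assoc, ← Finset.mul_sum]
    ring
  rw [e1, e2]
  ring

end IsSample

/-! ### Slutsky's theorem, rates and covariance factors. -/

lemma measurable_gHat {Ω : Type*} [MeasurableSpace Ω] {Z Y : ℕ → Ω → ℝ}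
    (hZ : ∀ i, Measurable (Z i)) (hY : ∀ i, Measurable (Y i)) (σ2 lam : ℝ≥0) {h : ℝ} (hh : 0 < h)
    (n : ℕ) (x : ℝ) :
    Measurable fun ω => gHat σ2 lam h n (fun i => Z i ω) (fun i => Y i ω) x := by
  simp only [gHat_eq σ2 lam hh, avg]
  fun_prop

lemma tendstoInDistribution_of_tendsto_probFilter {Ω ι : Type*} [Fintype ι] [MeasurableSpace Ω]
    {P : Measure Ω} [IsProbabilityMeasure P] {V W : ℕ → Ω → ι → ℝ}
    {ν : Measure (EuclideanSpace ℝ ι)} [IsProbabilityMeasure ν]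
    (hV : TendstoInDistribution (fun n ω => (WithLp.toLp 2 (V n ω) : EuclideanSpace ℝ ι)) atTop
      (id : EuclideanSpace ℝ ι → EuclideanSpace ℝ ι) (fun _ => P) ν)
    (hW : ∀ n k, Measurable fun ω => W n ω k)
    (hVW : ∀ k, Tendsto (fun z : ℕ × Ω => W z.1 z.2 k - V z.1 z.2 k) (probFilter P) (𝓝 0)) :
    TendstoInDistribution (fun n ω => (WithLp.toLp 2 (W n ω) : EuclideanSpace ℝ ι)) atTop
      (id : EuclideanSpace ℝ ι → EuclideanSpace ℝ ι) (fun _ => P) ν := by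
  refine tendstoInDistribution_of_tendstoInMeasure_sub _ _ hV
    (tendstoInMeasure_of_tendsto_probFilter ?_) fun n => ?_
  · have h1 : Tendsto (fun z : ℕ × Ω => W z.1 z.2 - V z.1 z.2) (probFilter P) (𝓝 0) :=
      tendsto_pi_nhds.2 hVW
    exact ((PiLp.continuous_toLp 2 fun _ : ι => ℝ).tendsto 0).comp h1
  · exact (WithLp.measurable_toLp 2 _ |>.comp (measurable_pi_iff.2 (hW n))).aemeasurable

/-- The common scale σ_u² factors out; degenerate denominators agree because division by zero gives
zero on both sides. -/
lemma coe_harmonic_mul (a b σ2 : ℝ≥0) :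
    (a * σ2 * (b * σ2) / (a * σ2 + b * σ2) : ℝ) = (a * b / (a + b) : ℝ≥0) * σ2 := by
  push_cast
  rcases eq_or_ne (σ2 : ℝ) 0 with h | h
  · simp [h]
  rcases eq_or_ne (a + b : ℝ) 0 with h' | h'
  · rw [← add_mul, h']; simp
  · field_simp

lemma IsBandwidth.tendsto_rate {h : ℕ → ℝ} (hh : IsBandwidth h) {K : ℕ} (k : Fin (K + 1)) :
    Tendsto (fun n => rate K (h n) n k) atTop atTop := by
  refine Fin.cases ?_ (fun i => ?_) k
  · exact Real.tendsto_sqrt_atTop.comp hh.tendsto_atTop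
  · exact Real.tendsto_sqrt_atTop.comp tendsto_natCast_atTop_atTop

/-- For λ = 0 the square root is h itself, so D = 1; for λ > 0 it is bounded below by √(λσ_u²). -/
lemma exists_rate_sq_le {K : ℕ} {lam : Fin K → ℝ≥0} (hlam : ∀ i, 0 < lam i) {σ2 : ℝ≥0}
    (hσ2 : 0 < σ2) {h : ℕ → ℝ} (hh : IsBandwidth h) (k : Fin (K + 1)) :
    ∃ D : ℝ, ∀ n : ℕ, rate K (h n) n k ^ 2 ≤
      D * (n * √((withZero lam k * σ2 : ℝ) + h n ^ 2)) := by
  refine Fin.cases ⟨1, fun n => ?_⟩ (fun i => ⟨(√(lam i * σ2 : ℝ))⁻¹, fun n => ?_⟩) k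
  · have := hh.pos n
    simp only [rate, withZero, Fin.cons_zero, Real.sq_sqrt (show 0 ≤ n * h n by positivity)]
    simp [Real.sqrt_sq this.le]
  · have h0 : (0 : ℝ) < lam i * σ2 := by exact_mod_cast mul_pos (hlam i) hσ2
    simp only [rate, withZero, Fin.cons_succ, Real.sq_sqrt (Nat.cast_nonneg n)]
    have h1 : √(lam i * σ2 : ℝ) ≤ √((lam i * σ2 : ℝ) + h n ^ 2) :=
      Real.sqrt_le_sqrt (by linarith [sq_nonneg (h n)])
    have h2 : 0 < √(lam i * σ2 : ℝ) := Real.sqrt_pos.2 h0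
    rw [inv_mul_eq_div, le_div_iff₀ h2]
    gcongr

/-- The factors `(h, 1, …, 1)`, which satisfy `rate = √n √factor`. -/
def bandwidthFactor (K : ℕ) (h : ℝ) : Fin (K + 1) → ℝ := Fin.cons h fun _ => 1

lemma rate_eq {K : ℕ} (h : ℝ) (n : ℕ) (k : Fin (K + 1)) :
    rate K h n k = √n * √(bandwidthFactor K h k) := by
  refine Fin.cases ?_ (fun i => ?_) k <;> simp [rate, bandwidthFactor]

lemma bandwidthFactor_nonneg {K : ℕ} {h : ℝ} (hh : 0 < h) (k : Fin (K + 1)) :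
    0 ≤ bandwidthFactor K h k := by
  refine Fin.cases ?_ (fun i => ?_) k <;> simp [bandwidthFactor, hh.le]

lemma tendsto_sqrt_bandwidthFactor {h : ℕ → ℝ} (hh : IsBandwidth h) {K : ℕ} (k : Fin (K + 1)) :
    Tendsto (fun n => √(bandwidthFactor K (h n) k)) atTop
      (𝓝 ((Fin.cons 0 fun _ => 1 : Fin (K + 1) → ℝ) k)) := by
  refine Fin.cases ?_ (fun i => ?_) k
  · simpa [bandwidthFactor] using hh.tendsto_zero.sqrt
  · simp [bandwidthFactor]

/-- The limits of `√(w_k w_l) / √(2π(s_k + s_l + 2h²))`, where `w` is `bandwidthFactor` and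
`s = λσ_u²`. -/
def covFactor {K : ℕ} (σ2 : ℝ≥0) (lam : Fin K → ℝ≥0) : Fin (K + 1) → Fin (K + 1) → ℝ :=
  fun k l => Fin.cases (Fin.cases (1 / (2 * √Real.pi)) (fun _ => 0) l)
    (fun i => Fin.cases 0 (fun j => (√(2 * Real.pi * (lam i * σ2 + lam j * σ2)))⁻¹) l) k

/-- At (0, 0) the sequence is constant, h/√(4πh²) = 1/(2√π). In a mixed entry √h tends to 0 against
a finite limit: the naive estimator is asymptotically independent of the others. -/
lemma tendsto_covFactor {K : ℕ} {lam : Fin K → ℝ≥0} (hlam : ∀ i, 0 < lam i) {σ2 : ℝ≥0}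
    (hσ2 : 0 < σ2) {h : ℕ → ℝ} (hh : IsBandwidth h) (k l : Fin (K + 1)) :
    Tendsto (fun n => √(bandwidthFactor K (h n) k) * √(bandwidthFactor K (h n) l) *
      (√(2 * Real.pi * ((withZero lam k * σ2 : ℝ) + h n ^ 2 +
        ((withZero lam l * σ2 : ℝ) + h n ^ 2))))⁻¹) atTop (𝓝 (covFactor σ2 lam k l)) := by
  have hσ : (0 : ℝ) < σ2 := hσ2
  have hl : ∀ i, (0 : ℝ) < lam i := fun i => hlam i
  have hh2 : Tendsto (fun n => h n ^ 2) atTop (𝓝 0) := by simpa using hh.tendsto_zero.pow 2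
  have hlim : ∀ a b : ℝ, 0 < a + b → Tendsto
      (fun n => (√(2 * Real.pi * (a + h n ^ 2 + (b + h n ^ 2))))⁻¹) atTop
      (𝓝 (√(2 * Real.pi * (a + b)))⁻¹) := fun a b hab => by
    have h1 : Tendsto (fun n => 2 * Real.pi * (a + h n ^ 2 + (b + h n ^ 2))) atTop
        (𝓝 (2 * Real.pi * (a + 0 + (b + 0)))) :=
      ((hh2.const_add a).add (hh2.const_add b)).const_mul _
    rw [add_zero, add_zero] at h1
    exact h1.sqrt.inv₀ (Real.sqrt_pos.2 (by positivity)).ne'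
  have hw := fun k : Fin (K + 1) => tendsto_sqrt_bandwidthFactor hh k
  refine Fin.cases (Fin.cases ?_ (fun j => ?_) l)
    (fun i => Fin.cases ?_ (fun j => ?_) l) k
  · refine tendsto_const_nhds.congr fun n => ?_
    have hn := hh.pos n
    have e : 2 * Real.pi * (0 + h n ^ 2 + (0 + h n ^ 2)) = (2 * √Real.pi * h n) ^ 2 := by
      rw [mul_pow, mul_pow, Real.sq_sqrt Real.pi_pos.le]; ring
    simp only [covFactor, bandwidthFactor, withZero, Fin.cons_zero, Fin.cases_zero,
      NNReal.coe_zero, zero_mul, Real.mul_self_sqrt hn.le, e]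
    rw [Real.sqrt_sq (by positivity)]
    field_simp
  · have := ((hw 0).mul (hw j.succ)).mul (hlim 0 (lam j * σ2)
      (by have := hl j; positivity))
    simpa [covFactor, withZero] using this
  · have := ((hw i.succ).mul (hw 0)).mul (hlim (lam i * σ2) 0
      (by have := hl i; positivity))
    simpa [covFactor, withZero] using this
  · have := ((hw i.succ).mul (hw j.succ)).mul (hlim (lam i * σ2) (lam j * σ2)
      (by have := hl i; have := hl j; positivity))
    simpa [covFactor, withZero] using this

lemma tendsto_bandwidthFactor_div {K : ℕ} {lam : Fin K → ℝ≥0} (hlam : ∀ i, 0 < lam i) {σ2 : ℝ≥0}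
    (hσ2 : 0 < σ2) {h : ℕ → ℝ} (hh : IsBandwidth h) (k : Fin (K + 1)) :
    Tendsto (fun n : ℕ => bandwidthFactor K (h n) k /
      (n * ((withZero lam k * σ2 : ℝ) + h n ^ 2))) atTop (𝓝 0) := by
  refine Fin.cases ?_ (fun i => ?_) k
  · refine (tendsto_inv_atTop_zero.comp hh.tendsto_atTop).congr fun n => ?_
    have hn := hh.pos n
    simp only [bandwidthFactor, withZero, Fin.cons_zero, NNReal.coe_zero, zero_mul, zero_add,
      Function.comp_apply]
    rcases eq_or_ne (n : ℝ) 0 with h0 | h0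
    · simp [h0]
    · field_simp
  · have h0 : (0 : ℝ) < lam i * σ2 := by exact_mod_cast mul_pos (hlam i) hσ2
    have hh2 : Tendsto (fun n => h n ^ 2) atTop (𝓝 0) := by simpa using hh.tendsto_zero.pow 2
    have h1 : Tendsto (fun n => (lam i * σ2 : ℝ) + h n ^ 2) atTop (𝓝 (lam i * σ2)) := by
      simpa using hh2.const_add (lam i * σ2 : ℝ)
    simpa [bandwidthFactor, withZero, Function.comp_def] using tendsto_inv_atTop_zero.comp
      (tendsto_natCast_atTop_atTop.atTop_mul_pos h0 h1)

lemma covFactor_mul_eq_deltaMatrix {K : ℕ} (σ2 : ℝ≥0) (fX g τ2 : ℝ → ℝ) (lam : Fin K → ℝ≥0)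
    (x : ℝ) (hf : ∀ k, 0 < fMom σ2 fX 0 (withZero lam k) x) (k l : Fin (K + 1)) {κ : ℝ≥0}
    (hκ : κ = withZero lam k * withZero lam l / (withZero lam k + withZero lam l)) :
    covFactor σ2 lam k l *
      (d0 σ2 fX (withZero lam k) x * d0 σ2 fX (withZero lam l) x *
          (gSqMom σ2 fX g 0 κ x + tauMom σ2 fX τ2 0 κ x) +
        (d0 σ2 fX (withZero lam k) x * c0 σ2 fX g (withZero lam l) x +
            c0 σ2 fX g (withZero lam k) x * d0 σ2 fX (withZero lam l) x) *
          gMom σ2 fX g 0 κ x +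
        c0 σ2 fX g (withZero lam k) x * c0 σ2 fX g (withZero lam l) x * fMom σ2 fX 0 κ x) =
      deltaMatrix σ2 fX g τ2 lam x k l := by
  induction k using Fin.cases with
  | zero =>
    induction l using Fin.cases with
    | zero =>
      have h0 := hf 0
      simp only [withZero, Fin.cons_zero] at h0
      simp only [withZero, Fin.cons_zero, mul_zero, zero_div] at hκ
      subst hκ
      simp only [covFactor, deltaMatrix, Matrix.of_apply, Fin.cases_zero, withZero, Fin.cons_zero,
        deltaZero, c0, d0]
      field_simp
      ring
    | succ j => simp [covFactor, deltaMatrix]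
  | succ i =>
    induction l using Fin.cases with
    | zero => simp [covFactor, deltaMatrix]
    | succ j =>
      have hi := hf i.succ
      have hj := hf j.succ
      simp only [withZero, Fin.cons_succ] at hi hj hκ
      subst hκ
      simp only [covFactor, deltaMatrix, Matrix.of_apply, Fin.cases_succ, withZero, Fin.cons_succ,
        deltaPos, ← add_mul, mul_assoc]
      set s := √(2 * (Real.pi * ((lam i + lam j : ℝ) * σ2)))
      have e : ∀ k : ℝ≥0, 0 < fMom σ2 fX 0 k x →
          c0 σ2 fX g k x * fMom σ2 fX 0 k x + d0 σ2 fX k x * gMom σ2 fX g 0 k x = 0 :=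
        fun k hk => by
          simp only [c0, d0]
          field_simp
          ring
      -- The subtracted products of means in Δ factor as (cf + dg)(c'f' + d'g'), and cf + dg = 0.
      linear_combination (c0 σ2 fX g (lam j) x * fMom σ2 fX 0 (lam j) x +
        d0 σ2 fX (lam j) x * gMom σ2 fX g 0 (lam j) x) * e _ hi

namespace IsModel

variable {Ω : Type*} [MeasurableSpace Ω] {P : Measure Ω} [IsProbabilityMeasure P]
  {X ε U : ℕ → Ω → ℝ} {σ2 : ℝ≥0} {fX τ2 m3 : ℝ → ℝ} {g : ℝ → ℝ}

theorem tendstoInDistribution_gHat (hm : IsModel P X ε U σ2 fX τ2 m3) (hσ2 : 0 < σ2)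
    (hf : Measurable fX) (hg : Measurable g) (hτ : Measurable τ2) {h : ℕ → ℝ} (hh : IsBandwidth h)
    {K : ℕ} {lam : Fin K → ℝ≥0} (hlam : ∀ i, 0 < lam i) {x ρ' : ℝ}
    (hρ : ∀ k, (withZero lam k * σ2 : ℝ) / 2 + σ2 < ρ')
    (hint : Integrable (fun t => (g t ^ 2 + τ2 t) * fX t * gauss ρ' (t - x))) :
    (deltaMatrix σ2 fX g τ2 lam x).PosSemidef ∧
    ∃ ρ : ℕ → Fin (K + 1) → ℝ,
      (∀ k, (fun n => ρ n k) =o[atTop] fun n => h n ^ 2) ∧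
      TendstoInDistribution
        (fun (n : ℕ) (ω : Ω) => (WithLp.toLp 2 fun k : Fin (K + 1) =>
          rate K (h n) n k *
            (gHat σ2 (withZero lam k) (h n) n (fun i => X i ω + U i ω)
                (fun i => g (X i ω) + ε i ω) x
              - gMom σ2 fX g 0 (withZero lam k) x / fMom σ2 fX 0 (withZero lam k) x
              - h n ^ 2 * bias σ2 fX g (withZero lam k) x
              + ρ n k) : EuclideanSpace ℝ (Fin (K + 1))))
        atTop (id : EuclideanSpace ℝ (Fin (K + 1)) → EuclideanSpace ℝ (Fin (K + 1)))
        (fun _ => P) (multivariateGaussian 0 (deltaMatrix σ2 fX g τ2 lam x)) := by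
  have hσ : (0 : ℝ) < σ2 := hσ2
  have mX := hm.measurable_X
  have mε := hm.measurable_ε
  have mU := hm.measurable_U
  have mT : Measurable fun ω => X 0 ω - x := by fun_prop
  obtain ⟨hS, hg2, ht2⟩ := hm.isSample hσ2 hf hg hτ hint
  have hs : ∀ k, 0 ≤ (withZero lam k * σ2 : ℝ) := fun k => by positivity
  have hρ' : 0 < ρ' := by linarith [hρ 0, hs 0]
  have hlt : ∀ k, (withZero lam k * σ2 + σ2 : ℝ) < 2 * ρ' := fun k => by linarith [hρ k, hs k]
  have hρ0 : ∀ k, 0 < (withZero lam k * σ2 + σ2 : ℝ) := fun k => by positivity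
  have ef := fun k => hm.gaussMoment_one_zero hf (x := x) (withZero lam k)
  have eg := fun k => hm.gaussMoment_response_zero hf hg hσ2 hS hg2 (hρ k)
  have hfpos : ∀ k, 0 < fMom σ2 fX 0 (withZero lam k) x := fun k => by
    rw [← ef k]; exact gaussMoment_one_pos mT (hρ0 k)
  have hclt := hS.tendstoInDistribution_avg (s := fun k => (withZero lam k * σ2 : ℝ))
    (c := fun k => c0 σ2 fX g (withZero lam k) x) (d := fun k => d0 σ2 fX (withZero lam k) x)
    hs hρ hh (w := fun k n => bandwidthFactor K (h n) k)
    (fun k n => bandwidthFactor_nonneg (hh.pos n) k) (tendsto_covFactor hlam hσ2 hh)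
    (tendsto_bandwidthFactor_div hlam hσ2 hh) (fun k => tendsto_sqrt_bandwidthFactor hh k)
    (fun k => by
      rw [hS.integral_affine_mul_gauss hρ' (hρ0 k) (hlt k), ef k, eg k]
      have := hfpos k
      simp only [c0, d0]
      field_simp
      ring)
    (Δ := deltaMatrix σ2 fX g τ2 lam x)
    (fun k l => by
      have hle := harmonic_le (hs k) (hs l) (le_max_left _ _)
        (le_max_right ((withZero lam k * σ2 : ℝ) / 2) ((withZero lam l * σ2 : ℝ) / 2))
      rw [coe_harmonic_mul] at hle ⊢
      rw [hm.integral_affine_mul_affine hf hg hτ hσ2 hS hg2 ht2]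
      · exact covFactor_mul_eq_deltaMatrix σ2 fX g τ2 lam x hfpos k l rfl
      · have := hρ k
        have := hρ l
        rcases max_cases ((withZero lam k * σ2 : ℝ) / 2) ((withZero lam l * σ2 : ℝ) / 2) with h | h
          <;> linarith)
  -- The remainder is the exact gap between the second-order expansion and the ratio of means, so
  -- adding it recentres the estimator at that ratio.
  refine ⟨hclt.1, fun n k => gMom σ2 fX g 0 (withZero lam k) x / fMom σ2 fX 0 (withZero lam k) x +
    h n ^ 2 * bias σ2 fX g (withZero lam k) x -
    centering P (fun ω => X 0 ω - x) (fun ω => g (X 0 ω) + ε 0 ω) (withZero lam k * σ2 + σ2)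
      (h n ^ 2), fun k => ?_, ?_⟩
  · beta_reduce
    rw [← ef k, ← eg k, ← hm.momentBias_eq_bias hf hg hσ2 hS hg2 (hρ k)]
    exact centering_isLittleO (by fun_prop) mT (hS.integrable_mul_gauss_two hρ') (hρ0 k) (hlt k)
      hh.tendsto_zero
  · refine tendstoInDistribution_of_tendsto_probFilter hclt.2 (fun n k => ?_) fun k => ?_
    · have := measurable_gHat (fun i => (mX i).add (mU i))
        (fun i => (hg.comp (mX i)).add (mε i)) σ2 (withZero lam k) (hh.pos n) n x
      exact (((this.sub_const _).sub_const _).add_const _).const_mul _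
    · obtain ⟨D, hD⟩ := exists_rate_sq_le hlam hσ2 hh k
      have := hS.tendsto_gHat_sub_avg (withZero lam k) (hρ k) hh (hh.tendsto_rate k) hD x (ef k)
        (eg k) rfl rfl
      refine this.congr fun z => ?_
      have e : ∀ i, x + (X i z.2 - x + U i z.2) = X i z.2 + U i z.2 := fun i => by ring
      simp only [e, ← rate_eq]
      congr 2
      ring

end IsModel

end ExtrapolationEstimator

end

/-! ### Choice of the dominating variance and conclusion. -/

open ExtrapolationEstimator in
theorem theorem3 {Ω : Type*} [MeasurableSpace Ω] (P : Measure Ω) [IsProbabilityMeasure P]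
    (X ε U : ℕ → Ω → ℝ) (σ2 : ℝ≥0) (hσ2 : 0 < σ2) (fX g τ2 m3 : ℝ → ℝ)
    (hmodel : IsModel P X ε U σ2 fX τ2 m3)
    (hreg : IsRegular (P.map (X 0)).support σ2 fX g τ2 m3)
    (h : ℕ → ℝ) (hh : IsBandwidth h)
    (K : ℕ) (lam : Fin K → ℝ≥0) (hlam_pos : ∀ i, 0 < lam i) (hlam_mono : StrictMono lam)
    (x : ℝ) (hx : x ∈ (P.map (X 0)).support)
    (hint : ∀ i, ∃ κ : ℝ≥0, lam i / 2 < κ ∧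
      Integrable (fun t => (g t ^ 2 + τ2 t) * fX t * gaussianPDFReal x ((1 + κ) * σ2) t)) :
    (deltaMatrix σ2 fX g τ2 lam x).PosSemidef ∧
    ∃ ρ : ℕ → Fin (K + 1) → ℝ,
      (∀ k, (fun n => ρ n k) =o[atTop] fun n => h n ^ 2) ∧
      TendstoInDistribution
        (fun (n : ℕ) (ω : Ω) => (WithLp.toLp 2 fun k : Fin (K + 1) =>
          rate K (h n) n k *
            (gHat σ2 (withZero lam k) (h n) n (fun i => X i ω + U i ω)
                (fun i => g (X i ω) + ε i ω) x
              - gMom σ2 fX g 0 (withZero lam k) x / fMom σ2 fX 0 (withZero lam k) x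
              - h n ^ 2 * bias σ2 fX g (withZero lam k) x
              + ρ n k) : EuclideanSpace ℝ (Fin (K + 1))))
        atTop (id : EuclideanSpace ℝ (Fin (K + 1)) → EuclideanSpace ℝ (Fin (K + 1)))
        (fun _ => P) (multivariateGaussian 0 (deltaMatrix σ2 fX g τ2 lam x)) := by
  have hf := hreg.contDiff_fX.continuous.measurable
  have hg := hreg.contDiff_g.continuous.measurable
  have hτ := hreg.contDiff_τ2.continuous.measurable
  have hσ : (0 : ℝ) < σ2 := hσ2
  obtain ⟨ρ', hρ, hi⟩ : ∃ ρ' : ℝ, (∀ k, (withZero lam k * σ2 : ℝ) / 2 + σ2 < ρ') ∧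
      Integrable (fun t => (g t ^ 2 + τ2 t) * fX t * gauss ρ' (t - x)) := by
    rcases K with _ | K
    -- With λ = 0 alone, any ρ' strictly between σ_u² and 2σ_u² serves: above the variance needed,
    -- below the growth threshold of the smoothness conditions.
    · refine ⟨3 / 2 * σ2, fun k => ?_, hmodel.integrable_of_isRegular hσ2 hreg hx (by positivity)
        (by linarith)⟩
      obtain rfl : k = 0 := Fin.ext (by omega)
      simp only [withZero, Fin.cons_zero, NNReal.coe_zero, zero_mul, zero_div]
      linarith
    -- The largest λ imposes the strongest condition, so its κ serves all coordinates at once.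
    · obtain ⟨κ, hκ, hi⟩ := hint (Fin.last K)
      have hκ' : (lam (Fin.last K) : ℝ) / 2 < κ := by exact_mod_cast hκ
      refine ⟨κ * σ2 + σ2, fun k => ?_, ?_⟩
      · have hle : (withZero lam k : ℝ) ≤ lam (Fin.last K) := by
          refine Fin.cases ?_ (fun i => ?_) k
          · simp [withZero]
          · exact_mod_cast hlam_mono.monotone (Fin.le_last i)
        nlinarith
      · simpa only [gaussianPDFReal_eq_gauss, coe_var_eq] using hi
  exact hmodel.tendstoInDistribution_gHat hσ2 hf hg hτ hh hlam_pos hρ hi
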